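/- Notation. Let $V$ be a finite dimensional complex vector space; by a choice of basis operators on $V^{\otimes n}$ are matrices. For $X\in\mathrm{End}(V^{\otimes 2})$, $X_i$ (or $X_{i\,i+1}$) is $X$ acting in the factors $i,i+1$ of $V^{\otimes n}$; $\mathrm{Tr}_{(i_1,\dots,i_s)}$ is the trace over the indicated factors; $P(u\otimes v)=v\otimes u$; $i_q=(q^i-q^{-i})/(q-q^{-1})$. *Yang–Baxter pairs.* $R\in\mathrm{Aut}(V^{\otimes 2})$ is a Yang–Baxter matrix if $R_1R_2R_1=R_2R_1R_2$. It is skew invertible if there is $\Psi_R\in\mathrm{End}(V^{\otimes2})$ with $\mathrm{Tr}_{(2)}R_1(\Psi_R)_2=\mathrm{Tr}_{(2)}(\Psi_R)_1R_2=P$, and then $D_R:=\mathrm{Tr}_{(2)}\Psi_R\in\mathrm{End}(V)$; it is strict skew invertible if $R$ and $R^{-1}$ are skew invertible. A pair $\{R,F\}$ of Yang–Baxter matrices is compatible if $R_1F_2F_1=F_2F_1R_2$ and $R_2F_1F_2=F_1F_2R_1$. *BMW algebra.* For $q\in\mathbb C\setminus\{0,\pm1\}$, $\mu\in\mathbb C\setminus\{0,q,-q^{-1}\}$,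 $W_n(q,\mu)$ is the unital algebra generated by invertible $\sigma_i$ and by $\kappa_i$, $1\le i\le n-1$, with the relations $\sigma_i\sigma_{i+1}\sigma_i=\sigma_{i+1}\sigma_i\sigma_{i+1}$; $\sigma_i\sigma_j=\sigma_j\sigma_i$ for $|i-j|>1$; $\kappa_i=\frac{(q-\sigma_i)(q^{-1}+\sigma_i)}{\mu(q-q^{-1})}$; $\sigma_i\kappa_i=\kappa_i\sigma_i=\mu\kappa_i$; $\kappa_i\sigma_{i\pm1}^{\epsilon}=\kappa_i\kappa_{i\pm1}\sigma_i^{-\epsilon}$ and $\sigma_{i\pm1}^{\epsilon}\kappa_i=\sigma_i^{-\epsilon}\kappa_{i\pm1}\kappa_i$ for $\epsilon=\pm1$; $\kappa_i\kappa_{i\pm1}\kappa_i=\kappa_i$; $\kappa_i^2=\eta\kappa_i$ with $\eta=\frac{(q-\mu)(q^{-1}+\mu)}{\mu(q-q^{-1})}$. Put $\sigma_i^-(x)=1+\frac{x-1}{q-q^{-1}}\sigma_i+\frac{\mu(x-1)}{\mu+qx}\kappa_i$, and define the antisymmetrizers by $a^{(1)}=1$, $a^{(i+1)}=\frac{q^i}{(i+1)_q}a^{(i)}\sigma_i^-(q^{-2i})a^{(i)}$.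 Let $x\mapsto x^{\uparrow1}$ be the homomorphism $W_n\to W_{n+1}$, $\sigma_i\mapsto\sigma_{i+1}$. *Type $O(k)$.* $R$ is of BMW type with parameters $q,\mu$ if, for all $n$, $\sigma_i\mapsto R_i$ extends to a homomorphism $\rho_R:W_n(q,\mu)\to\mathrm{End}(V^{\otimes n})$, and $\rho_R(\kappa_1)\ne0$. For $k\ge2$, $R$ is of type $O(k)$ if it is skew invertible, of BMW type with $\mu=q^{1-k}$, if $q^{2i}\neq1$ and $\mu\ne-q^{1-2i}$ for $i=1,\dots,k$, $\rho_R(a^{(i)})\ne0$ for $i=2,\dots,k$, $\rho_R\bigl(a^{(k)\uparrow1}\sigma_1^-(q^{-2k})a^{(k)\uparrow1}\bigr)=0$, and $\mathrm{rk}\,\rho_R(a^{(k)})=1$. *Quantum matrix algebra.* Let $\{R,F\}$ be a compatible pair of strict skew invertible Yang–Baxter matrices. $\mathcal M(R,F)$ is the unital algebra generated by the entries $M^a_b$ of a matrix $M$ subject to $R_1M_{\overline1}M_{\overline2}=M_{\overline1}M_{\overline2}R_1$, where $M_{\overline1}=M_1$ and $M_{\overline{i+1}}=F_iM_{\overline i}F_i^{-1}$.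 If $R$ is of type $O(k)$, the quantum determinant is $$\mathfrak e_k=\mathrm{Tr}_{(1,\dots,k)}\bigl((D_R)_1\cdots(D_R)_k\,M_{\overline1}\cdots M_{\overline k}\,\rho_R(a^{(k)})\bigr)\in\mathcal M(R,F).$$ **Proposition.** Let $R$ be of type $O(k)$ and $\{R,F\}$ a compatible pair of strict skew invertible Yang–Baxter matrices. The operators $O,O^{-1}\in\mathrm{End}(V)$ given by $$O_1=\tfrac{k_q(1+q^{2-k})}{q+q^{1-k}}\mathrm{Tr}_{(2,\dots,k+1)}\bigl(\rho_R(a^{(k)\uparrow1})F_1^{-1}F_2^{-1}\cdots F_k^{-1}\bigr),\qquad O^{-1}_1=\tfrac{k_q(1+q^{2-k})}{q+q^{1-k}}\mathrm{Tr}_{(2,\dots,k+1)}\bigl(F_k\cdots F_2F_1\,\rho_R(a^{(k)\uparrow1})\bigr)$$ are inverse to each other. For each sign $\varepsilon=\pm1$ there is exactly one representation $\alpha_\varepsilon:\mathcal M(R,F)\to\mathrm{End}(V)$ with $\alpha_\varepsilon(M_1)_0=R_{01}^{\varepsilon}F_{01}$ (here $0$ labels the copy of $V$ on which $\mathcal M(R,F)$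 is represented), and $$\alpha_\pm(\mathfrak e_k)=(-1)^{k-1}q^{k(1-k)}\,O^{-1}.$$ -/

import Mathlib

/-! Throughout, `V = ι → ℂ` with `ι` finite, `End (V^{⊗ n})` is the algebra of matrices indexed by
`Fin n → ι` (for `n = 1, 2` also by `ι` and `ι × ι`), and `Aut (V ⊗ V) = GL (ι × ι) ℂ`.
The tensor factors `1, …, n` are labelled `0, …, n - 1`. -/

namespace QMat

open Matrix

noncomputable section

/-! ### Operators on tensor powers -/

section Tensor

variable {ι : Type} [Fintype ι] [DecidableEq ι] {A : Type} [Ring A]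

/-- The operator on `V^{⊗ n}` acting as `X` in the factor `i` and as the identity elsewhere. -/
def at₁ (n : ℕ) (X : Matrix ι ι A) (i : Fin n) : Matrix (Fin n → ι) (Fin n → ι) A :=
  Matrix.of fun x y => if ∀ j, j ≠ i → x j = y j then X (x i) (y i) else 0

/-- The operator on `V^{⊗ n}` acting as `X` in the factors `i, i + 1` and as the identity
elsewhere. -/
def at₂ (n : ℕ) (X : Matrix (ι × ι) (ι × ι) A) (i : ℕ) (h : i + 1 < n) :
    Matrix (Fin n → ι) (Fin n → ι) A :=
  Matrix.of fun x y =>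
    if ∀ j : Fin n, j.1 ≠ i → j.1 ≠ i + 1 → x j = y j then
      X (x ⟨i, by omega⟩, x ⟨i + 1, h⟩) (y ⟨i, by omega⟩, y ⟨i + 1, h⟩)
    else 0

/-- `X ⊗ ⋯ ⊗ X = X_1 ⋯ X_n` on `V^{⊗ n}`. -/
def tensorPow (n : ℕ) (X : Matrix ι ι ℂ) : Matrix (Fin n → ι) (Fin n → ι) ℂ :=
  Matrix.of fun x y => ∏ j, X (x j) (y j)

/-- The partial trace `Tr_(2)` over the middle factor of `V^{⊗ 3}`. -/
def traceMiddle (X : Matrix (Fin 3 → ι) (Fin 3 → ι) ℂ) : Matrix (ι × ι) (ι × ι) ℂ :=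
  Matrix.of fun x y => ∑ e, X ![x.1, e, x.2] ![y.1, e, y.2]

/-- The partial trace `Tr_(2, …, n + 1)` over all factors of `V^{⊗ (n + 1)}` but the first. -/
def traceTail (n : ℕ) (X : Matrix (Fin (n + 1) → ι) (Fin (n + 1) → ι) ℂ) : Matrix ι ι ℂ :=
  Matrix.of fun a b => ∑ z : Fin n → ι, X (Fin.cons a z) (Fin.cons b z)

/-- The permutation operator `P (u ⊗ v) = v ⊗ u`. -/
def flipOp : Matrix (ι × ι) (ι × ι) ℂ :=
  Matrix.of fun x y => if x.1 = y.2 ∧ x.2 = y.1 then 1 else 0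

end Tensor

/-! ### Yang–Baxter matrices and skew invertibility -/

section YangBaxter

variable {ι : Type} [Fintype ι] [DecidableEq ι]

/-- The braid relation `R_1 R_2 R_1 = R_2 R_1 R_2` on `V^{⊗ 3}`. -/
def IsYangBaxter (R : GL (ι × ι) ℂ) : Prop :=
  at₂ 3 R.1 0 (by norm_num) * at₂ 3 R.1 1 (by norm_num) * at₂ 3 R.1 0 (by norm_num) =
    at₂ 3 R.1 1 (by norm_num) * at₂ 3 R.1 0 (by norm_num) * at₂ 3 R.1 1 (by norm_num)

/-- `Tr_(2) R_1 Ψ_2 = P = Tr_(2) Ψ_1 R_2`. -/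
def IsSkewInverse (R Ψ : Matrix (ι × ι) (ι × ι) ℂ) : Prop :=
  traceMiddle (at₂ 3 R 0 (by norm_num) * at₂ 3 Ψ 1 (by norm_num)) = flipOp ∧
    traceMiddle (at₂ 3 Ψ 0 (by norm_num) * at₂ 3 R 1 (by norm_num)) = flipOp

def SkewInvertible (R : GL (ι × ι) ℂ) : Prop :=
  ∃ Ψ : Matrix (ι × ι) (ι × ι) ℂ, IsSkewInverse R.1 Ψ

def StrictSkewInvertible (R : GL (ι × ι) ℂ) : Prop :=
  SkewInvertible R ∧ SkewInvertible R⁻¹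

/-- The (unique) operator `Ψ_R`. -/
def SkewInvertible.psi {R : GL (ι × ι) ℂ} (h : SkewInvertible R) :
    Matrix (ι × ι) (ι × ι) ℂ :=
  Classical.choose h

/-- `D_R = Tr_(2) Ψ_R`. -/
def SkewInvertible.matD {R : GL (ι × ι) ℂ} (h : SkewInvertible R) : Matrix ι ι ℂ :=
  Matrix.of fun a b => ∑ e, h.psi (a, e) (b, e)

/-- The twist relations `R_1 F_2 F_1 = F_2 F_1 R_2` and `R_2 F_1 F_2 = F_1 F_2 R_1`. -/
def TwistRelations (R F : GL (ι × ι) ℂ) : Prop :=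
  at₂ 3 R.1 0 (by norm_num) * at₂ 3 F.1 1 (by norm_num) * at₂ 3 F.1 0 (by norm_num) =
      at₂ 3 F.1 1 (by norm_num) * at₂ 3 F.1 0 (by norm_num) * at₂ 3 R.1 1 (by norm_num) ∧
    at₂ 3 R.1 1 (by norm_num) * at₂ 3 F.1 0 (by norm_num) * at₂ 3 F.1 1 (by norm_num) =
      at₂ 3 F.1 0 (by norm_num) * at₂ 3 F.1 1 (by norm_num) * at₂ 3 R.1 0 (by norm_num)

/-- `{R, F}` is a compatible pair of strict skew invertible Yang–Baxter matrices. -/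
structure IsQMPair (R F : GL (ι × ι) ℂ) : Prop where
  ybR : IsYangBaxter R
  ybF : IsYangBaxter F
  twist : TwistRelations R F
  strictR : StrictSkewInvertible R
  strictF : StrictSkewInvertible F

end YangBaxter

/-! ### Birman–Murakami–Wenzl algebras -/

/-- The generators `σ_i, σ_i⁻¹, κ_i`, `i = 1, …, n - 1` (labelled from `0`), of `W_n (q, μ)`. -/
inductive BMWGen (n : ℕ) : Type
  | s : Fin (n - 1) → BMWGen n
  | t : Fin (n - 1) → BMWGen n
  | k : Fin (n - 1) → BMWGen n

/-- The indices `i, j` differ by one. -/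
def Adj {m : ℕ} (i j : Fin m) : Prop := i.1 + 1 = j.1 ∨ j.1 + 1 = i.1

/-- `η = (q - μ) (q⁻¹ + μ) / (μ (q - q⁻¹))`. -/
def eta (q μ : ℂ) : ℂ := (q - μ) * (q⁻¹ + μ) / (μ * (q - q⁻¹))

/-- The `q`-number `i_q = (q^i - q^{-i}) / (q - q⁻¹)`. -/
def qNum (q : ℂ) (i : ℕ) : ℂ := (q ^ i - (q ^ i)⁻¹) / (q - q⁻¹)

/-- The element `(q 1 - s) (q⁻¹ 1 + s) / (μ (q - q⁻¹))`. -/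
def kappaOf {A : Type} [Ring A] [Algebra ℂ A] (q μ : ℂ) (s : A) : A :=
  (μ * (q - q⁻¹))⁻¹ • ((q • (1 : A) - s) * (q⁻¹ • (1 : A) + s))

section BMW

open FreeAlgebra BMWGen

/-- The defining relations of `W_n (q, μ)`. -/
inductive BMWRel (q μ : ℂ) (n : ℕ) :
    FreeAlgebra ℂ (BMWGen n) → FreeAlgebra ℂ (BMWGen n) → Prop
  | s_t (i : Fin (n - 1)) : BMWRel q μ n (ι ℂ (s i) * ι ℂ (t i)) 1
  | t_s (i : Fin (n - 1)) : BMWRel q μ n (ι ℂ (t i) * ι ℂ (s i)) 1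
  | braid (i j : Fin (n - 1)) (h : Adj i j) :
      BMWRel q μ n (ι ℂ (s i) * ι ℂ (s j) * ι ℂ (s i)) (ι ℂ (s j) * ι ℂ (s i) * ι ℂ (s j))
  | comm (i j : Fin (n - 1)) (h : i.1 + 1 < j.1) :
      BMWRel q μ n (ι ℂ (s i) * ι ℂ (s j)) (ι ℂ (s j) * ι ℂ (s i))
  | kappa (i : Fin (n - 1)) : BMWRel q μ n (ι ℂ (k i)) (kappaOf q μ (ι ℂ (s i)))
  | s_k (i : Fin (n - 1)) : BMWRel q μ n (ι ℂ (s i) * ι ℂ (k i)) (μ • ι ℂ (k i))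
  | k_s (i : Fin (n - 1)) : BMWRel q μ n (ι ℂ (k i) * ι ℂ (s i)) (μ • ι ℂ (k i))
  | k_s_adj (i j : Fin (n - 1)) (h : Adj i j) :
      BMWRel q μ n (ι ℂ (k i) * ι ℂ (s j)) (ι ℂ (k i) * ι ℂ (k j) * ι ℂ (t i))
  | k_t_adj (i j : Fin (n - 1)) (h : Adj i j) :
      BMWRel q μ n (ι ℂ (k i) * ι ℂ (t j)) (ι ℂ (k i) * ι ℂ (k j) * ι ℂ (s i))
  | s_k_adj (i j : Fin (n - 1)) (h : Adj i j) :
      BMWRel q μ n (ι ℂ (s j) * ι ℂ (k i)) (ι ℂ (t i) * ι ℂ (k j) * ι ℂ (k i))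
  | t_k_adj (i j : Fin (n - 1)) (h : Adj i j) :
      BMWRel q μ n (ι ℂ (t j) * ι ℂ (k i)) (ι ℂ (s i) * ι ℂ (k j) * ι ℂ (k i))
  | k_k_k (i j : Fin (n - 1)) (h : Adj i j) :
      BMWRel q μ n (ι ℂ (k i) * ι ℂ (k j) * ι ℂ (k i)) (ι ℂ (k i))
  | k_k (i : Fin (n - 1)) : BMWRel q μ n (ι ℂ (k i) * ι ℂ (k i)) (eta q μ • ι ℂ (k i))

/-- The Birman–Murakami–Wenzl algebra `W_n (q, μ)`. -/
abbrev BMW (q μ : ℂ) (n : ℕ) : Type := RingQuot (BMWRel q μ n)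

namespace BMW

def gen (q μ : ℂ) (n : ℕ) (g : BMWGen n) : BMW q μ n :=
  RingQuot.mkAlgHom ℂ (BMWRel q μ n) (ι ℂ g)

/-- The generator `σ_{i+1}` of `W_n`. -/
def σ (q μ : ℂ) (n : ℕ) (i : Fin (n - 1)) : BMW q μ n := gen q μ n (s i)

/-- The generator `κ_{i+1}` of `W_n`. -/
def κ (q μ : ℂ) (n : ℕ) (i : Fin (n - 1)) : BMW q μ n := gen q μ n (k i)

/-- Translation of the labels of the generators by `p`. -/
def trGen (n n' p : ℕ) (h : p + n ≤ n') : BMWGen n → BMWGen n'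
  | s i => s ⟨i.1 + p, by omega⟩
  | t i => t ⟨i.1 + p, by omega⟩
  | k i => k ⟨i.1 + p, by omega⟩

theorem lift_trGen_rel (q μ : ℂ) (n n' p : ℕ) (h : p + n ≤ n')
    ⦃x y : FreeAlgebra ℂ (BMWGen n)⦄ (r : BMWRel q μ n x y) :
    FreeAlgebra.lift ℂ (fun g => gen q μ n' (trGen n n' p h g)) x =
      FreeAlgebra.lift ℂ (fun g => gen q μ n' (trGen n n' p h g)) y := by
  have key : ∀ {a b : FreeAlgebra ℂ (BMWGen n')}, BMWRel q μ n' a b →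
      RingQuot.mkAlgHom ℂ (BMWRel q μ n') a = RingQuot.mkAlgHom ℂ (BMWRel q μ n') b :=
    fun r => RingQuot.mkAlgHom_rel ℂ r
  have adj : ∀ {i j : Fin (n - 1)}, Adj i j →
      Adj (⟨i.1 + p, by omega⟩ : Fin (n' - 1)) ⟨j.1 + p, by omega⟩ := by
    intro i j h; unfold Adj at h ⊢; simp only; omega
  cases r with
  | s_t i => simpa [gen, trGen] using key (.s_t ⟨i.1 + p, by omega⟩)
  | t_s i => simpa [gen, trGen] using key (.t_s ⟨i.1 + p, by omega⟩)
  | braid i j h => simpa [gen, trGen] using key (.braid _ _ (adj h))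
  | comm i j h' =>
    simpa [gen, trGen] using
      key (.comm ⟨i.1 + p, by omega⟩ ⟨j.1 + p, by omega⟩ (by simp only; omega))
  | kappa i => simpa [gen, trGen, kappaOf] using key (.kappa ⟨i.1 + p, by omega⟩)
  | s_k i => simpa [gen, trGen] using key (.s_k ⟨i.1 + p, by omega⟩)
  | k_s i => simpa [gen, trGen] using key (.k_s ⟨i.1 + p, by omega⟩)
  | k_s_adj i j h => simpa [gen, trGen] using key (.k_s_adj _ _ (adj h))
  | k_t_adj i j h => simpa [gen, trGen] using key (.k_t_adj _ _ (adj h))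
  | s_k_adj i j h => simpa [gen, trGen] using key (.s_k_adj _ _ (adj h))
  | t_k_adj i j h => simpa [gen, trGen] using key (.t_k_adj _ _ (adj h))
  | k_k_k i j h => simpa [gen, trGen] using key (.k_k_k _ _ (adj h))
  | k_k i => simpa [gen, trGen] using key (.k_k ⟨i.1 + p, by omega⟩)

/-- The homomorphism `W_n → W_n'`, `σ_i ↦ σ_{i+p}`, for `p + n ≤ n'`. For `p = 0` it is the
standard embedding, and `x ↦ x^{↑ p}` otherwise. -/
def shift (q μ : ℂ) (n n' p : ℕ) (h : p + n ≤ n') : BMW q μ n →ₐ[ℂ] BMW q μ n' :=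
  RingQuot.liftAlgHom ℂ
    ⟨FreeAlgebra.lift ℂ fun g => gen q μ n' (trGen n n' p h g), lift_trGen_rel q μ n n' p h⟩

/-- The baxterized element
`σ_i^-(x) = 1 + (x - 1) / (q - q⁻¹) σ_i + μ (x - 1) / (μ + q x) κ_i`. -/
def baxMinus (q μ : ℂ) (n : ℕ) (i : Fin (n - 1)) (x : ℂ) : BMW q μ n :=
  1 + ((x - 1) / (q - q⁻¹)) • σ q μ n i + (μ * (x - 1) / (μ + q * x)) • κ q μ n i

/-- The `q`-antisymmetrizer `a^{(n)} ∈ W_n`: `a^{(1)} = 1` and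
`a^{(i+1)} = q^i / (i+1)_q a^{(i)} σ_i^-(q^{-2i}) a^{(i)}`. (The value at `n = 0` is irrelevant.) -/
def antisym (q μ : ℂ) : (n : ℕ) → BMW q μ n
  | 0 => 1
  | 1 => 1
  | i + 2 =>
    (q ^ (i + 1) / qNum q (i + 2)) •
      (shift q μ (i + 1) (i + 2) 0 (by omega) (antisym q μ (i + 1)) *
        baxMinus q μ (i + 2) ⟨i, by omega⟩ ((q ^ (2 * (i + 1)))⁻¹) *
        shift q μ (i + 1) (i + 2) 0 (by omega) (antisym q μ (i + 1)))

/-- `a^{(n) ↑ 1} ∈ W_{n+1}`. -/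
def antisymUp (q μ : ℂ) (n : ℕ) : BMW q μ (n + 1) :=
  shift q μ n (n + 1) 1 (by omega) (antisym q μ n)

end BMW

end BMW

/-! ### Yang–Baxter matrices of the BMW type and of the type `O(k)` -/

section Types

variable {ι : Type} [Fintype ι] [DecidableEq ι]

/-- `R` is a Yang–Baxter matrix of the BMW type with parameters `q, μ`: `σ_i ↦ R_i` extends to a
homomorphism `W_n (q, μ) → End (V^{⊗ n})` for all `n`. The image `K` of `κ_1` is required not to
vanish (otherwise `R` is of the Hecke type, and `μ` is not determined by `R`; for skew invertible
`R` the image `K` then has rank one). -/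
structure IsBMWType (q μ : ℂ) (R : GL (ι × ι) ℂ) : Prop where
  q_ne_zero : q ≠ 0
  q_ne_one : q ≠ 1
  q_ne_neg_one : q ≠ -1
  mu_ne_zero : μ ≠ 0
  mu_ne_q : μ ≠ q
  mu_ne_neg_q_inv : μ ≠ -q⁻¹
  exists_rep : ∀ n : ℕ, ∃ ρ : BMW q μ n →ₐ[ℂ] Matrix (Fin n → ι) (Fin n → ι) ℂ,
    ∀ i : Fin (n - 1), ρ (BMW.σ q μ n i) = at₂ n R.1 i.1 (by omega)
  K_ne_zero : kappaOf q μ R.1 ≠ 0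

/-- The Yang–Baxter representation `ρ_R` of `W_n (q, μ)` (the homomorphism is unique, as
the relations express `σ_i⁻¹` and `κ_i` through `σ_i`). -/
def IsBMWType.ρ {q μ : ℂ} {R : GL (ι × ι) ℂ} (h : IsBMWType q μ R) (n : ℕ) :
    BMW q μ n →ₐ[ℂ] Matrix (Fin n → ι) (Fin n → ι) ℂ :=
  Classical.choose (h.exists_rep n)

/-- `R` is a skew invertible BMW type Yang–Baxter matrix of height `k`. -/
structure IsHeight (k : ℕ) (q μ : ℂ) (R : GL (ι × ι) ℂ) : Prop where
  two_le : 2 ≤ k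
  bmw : IsBMWType q μ R
  skew : SkewInvertible R
  q_pow_ne : ∀ i, 1 ≤ i → i ≤ k → q ^ (2 * i) ≠ 1
  mu_ne : ∀ i : ℕ, 1 ≤ i → i ≤ k → μ ≠ -q ^ (1 - 2 * (i : ℤ))
  rank_ne_zero : ∀ i, 2 ≤ i → i ≤ k → (bmw.ρ i (BMW.antisym q μ i)).rank ≠ 0
  vanish : bmw.ρ (k + 1) (BMW.antisymUp q μ k *
    BMW.baxMinus q μ (k + 1) ⟨0, by omega⟩ ((q ^ (2 * k))⁻¹) * BMW.antisymUp q μ k) = 0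

/-- `R` is an orthogonal Yang–Baxter matrix of the type `O(k)`. -/
structure IsOrthogonalType (k : ℕ) (q : ℂ) (R : GL (ι × ι) ℂ) : Prop where
  height : IsHeight k q (q ^ (1 - (k : ℤ))) R
  rank_eq_one :
    (height.bmw.ρ k (BMW.antisym q (q ^ (1 - (k : ℤ))) k)).rank = 1

end Types

/-! ### Quantum matrix algebras -/

section QMA

variable {ι : Type} [Fintype ι] [DecidableEq ι]

/-- A matrix of numbers as a matrix over the algebra `A`. -/
abbrev num {κ : Type} (A : Type) [Ring A] [Algebra ℂ A] (X : Matrix κ κ ℂ) : Matrix κ κ A :=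
  X.map (algebraMap ℂ A)

/-- The copy `M_{\overline{i+1}}` on `V^{⊗ n}` of a matrix `M` over `A`:
`M_{\overline 1} = M_1`, `M_{\overline{i+1}} = F_i M_{\overline i} F_i⁻¹`. -/
def copy {A : Type} [Ring A] [Algebra ℂ A] (F : GL (ι × ι) ℂ) (n : ℕ) (M : Matrix ι ι A) :
    (i : ℕ) → i < n → Matrix (Fin n → ι) (Fin n → ι) A
  | 0, h => at₁ n M ⟨0, h⟩
  | i + 1, h =>
    num A (at₂ n F.1 i h) * copy F n M i (by omega) * num A (at₂ n (F⁻¹).1 i h)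

/-- The product `M_{\overline 1} M_{\overline 2} ⋯ M_{\overline n}` on `V^{⊗ n}`. -/
def copyProd {A : Type} [Ring A] [Algebra ℂ A] (F : GL (ι × ι) ℂ) (n : ℕ) (M : Matrix ι ι A) :
    Matrix (Fin n → ι) (Fin n → ι) A :=
  (List.ofFn fun i : Fin n => copy F n M i.1 i.2).prod

/-- The matrix of the free generators `M^a_b` (row `a`, column `b`). -/
def freeM : Matrix ι ι (FreeAlgebra ℂ (ι × ι)) :=
  Matrix.of fun a b => FreeAlgebra.ι ℂ (a, b)

/-- The entries of `R_1 M_{\overline 1} M_{\overline 2} = M_{\overline 1} M_{\overline 2} R_1`. -/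
inductive QMARel (R F : GL (ι × ι) ℂ) :
    FreeAlgebra ℂ (ι × ι) → FreeAlgebra ℂ (ι × ι) → Prop
  | mk (x y : Fin 2 → ι) : QMARel R F
      ((num (FreeAlgebra ℂ (ι × ι)) (at₂ 2 R.1 0 (by norm_num)) * copyProd F 2 freeM :
        Matrix (Fin 2 → ι) (Fin 2 → ι) (FreeAlgebra ℂ (ι × ι))) x y)
      ((copyProd F 2 freeM * num (FreeAlgebra ℂ (ι × ι)) (at₂ 2 R.1 0 (by norm_num)) :
        Matrix (Fin 2 → ι) (Fin 2 → ι) (FreeAlgebra ℂ (ι × ι))) x y)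

/-- The quantum matrix algebra `M(R, F)`. -/
abbrev QMA (R F : GL (ι × ι) ℂ) : Type := RingQuot (QMARel R F)

/-- The quantum matrix `M`, whose entries are the generators of `M(R, F)`. -/
def qM (R F : GL (ι × ι) ℂ) : Matrix ι ι (QMA R F) :=
  freeM.map (RingQuot.mkAlgHom ℂ (QMARel R F))

/-- `ch(α) = Tr_{R (1, …, n)} (M_{\overline 1} ⋯ M_{\overline n} ρ_R(α))` for `α ∈ W_n`, where
`Tr_{R (1, …, n)} X = Tr (D_R ⊗ ⋯ ⊗ D_R X)`. -/
def ch {q μ : ℂ} {R : GL (ι × ι) ℂ} (F : GL (ι × ι) ℂ) (hb : IsBMWType q μ R)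
    (hs : SkewInvertible R) (n : ℕ) (α : BMW q μ n) : QMA R F :=
  Matrix.trace (num (QMA R F) (tensorPow n hs.matD) *
    (copyProd F n (qM R F) * num (QMA R F) (hb.ρ n α)))

/-- The quantum determinant `e_k = ch(a^{(k)})` of the `O(k)` type algebra `M(R, F)`. -/
def qDet {k : ℕ} {q : ℂ} {R : GL (ι × ι) ℂ} (F : GL (ι × ι) ℂ) (hR : IsOrthogonalType k q R) :
    QMA R F :=
  ch F hR.height.bmw hR.height.skew k (BMW.antisym q (q ^ (1 - (k : ℤ))) k)

/-- The factor `k_q (1 + q^{2-k}) / (q + q^{1-k})`. -/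
def normO (k : ℕ) (q : ℂ) : ℂ :=
  qNum q k * (1 + q ^ (2 - (k : ℤ))) / (q + q ^ (1 - (k : ℤ)))

/-- `F_k ⋯ F_2 F_1` on `V^{⊗ (k + 1)}`. -/
def prodDown (F : GL (ι × ι) ℂ) (k : ℕ) : Matrix (Fin (k + 1) → ι) (Fin (k + 1) → ι) ℂ :=
  ((List.ofFn fun i : Fin k => at₂ (k + 1) F.1 i.1 (by omega)).reverse).prod

/-- `F_1⁻¹ F_2⁻¹ ⋯ F_k⁻¹` on `V^{⊗ (k + 1)}`. -/
def prodInvUp (F : GL (ι × ι) ℂ) (k : ℕ) : Matrix (Fin (k + 1) → ι) (Fin (k + 1) → ι) ℂ :=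
  (List.ofFn fun i : Fin k => at₂ (k + 1) (F⁻¹).1 i.1 (by omega)).prod

/-- `ρ_R(a^{(k) ↑ 1})` on `V^{⊗ (k + 1)}`. -/
def rhoUp {k : ℕ} {q : ℂ} {R : GL (ι × ι) ℂ} (hR : IsOrthogonalType k q R) :
    Matrix (Fin (k + 1) → ι) (Fin (k + 1) → ι) ℂ :=
  hR.height.bmw.ρ (k + 1) (BMW.antisymUp q (q ^ (1 - (k : ℤ))) k)

/-- `O = k_q (1 + q^{2-k}) / (q + q^{1-k}) Tr_(2, …, k+1) (ρ_R(a^{(k) ↑ 1}) F_1⁻¹ ⋯ F_k⁻¹)`. -/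
def opO {k : ℕ} {q : ℂ} {R : GL (ι × ι) ℂ} (F : GL (ι × ι) ℂ) (hR : IsOrthogonalType k q R) :
    Matrix ι ι ℂ :=
  normO k q • traceTail k (rhoUp hR * prodInvUp F k)

/-- `O⁻¹ = k_q (1 + q^{2-k}) / (q + q^{1-k}) Tr_(2, …, k+1) (F_k ⋯ F_1 ρ_R(a^{(k) ↑ 1}))`. -/
def opOInv {k : ℕ} {q : ℂ} {R : GL (ι × ι) ℂ} (F : GL (ι × ι) ℂ) (hR : IsOrthogonalType k q R) :
    Matrix ι ι ℂ :=
  normO k q • traceTail k (prodDown F k * rhoUp hR)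

/-- The algebra homomorphism `α : M(R, F) → End V` is the representation `α_ε`, that is,
`α(M_1)_0 = R_{01}^ε F_{01}`: the operator `α(M^a_b)` has the matrix elements
`(R^ε F)^{c a}_{d b}`, where `c, d` belong to the factor `0` and `a, b` to the factor `1`. -/
def IsAlpha {R F : GL (ι × ι) ℂ} (ε : ℤˣ) (α : QMA R F →ₐ[ℂ] Matrix ι ι ℂ) : Prop :=
  ∀ a b c d : ι, α (qM R F a b) c d = (R ^ (ε : ℤ) * F).1 (c, a) (d, b)

end QMA

end

end QMat

/-! Write `A` for the image of the top antisymmetrizer. It is idempotent of rank one, so `A = u vᵗ`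
with `v · u = 1`. On `k + 1` factors this gives `1 ⊗ A = U W` and `A ⊗ 1 = U' W'`, where `U : x ↦ x
⊗ u` and `U' : x ↦ u ⊗ x` are `colR u` and `colL u`, while `W` and `W'` are the transposes of `colR
v` and `colL v`, so that `W U = W' U' = 1`. An operator that intertwines `1 ⊗ A` and `A ⊗ 1` is
thereby reduced to an operator on `V`.

Let `G = F_k ⋯ F_1` and `E = R_1^ε ⋯ R_k^ε`. Under `α_ε` the product of the copies of `M` becomes `E
G` (`IsQMPair.foldEnd_copyProd`). Twist and braid relations give `G (1 ⊗ A) = (A ⊗ 1) G` and `E (A ⊗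
1) = (1 ⊗ A) E`. Put `S = W U'`, `T = W' U`, `N = W' G U` and `c = normO k q`. Then `O⁻¹ = c W G U =
c S N` and `O = c N⁻¹ T`, so the two are inverse to each other as soon as `S T = c⁻²`. The
determinant is sent to `W D E G U = (W D U) (W E U') N`, with `D` standing for the tensor power of
`D_R`. Three computations remain.

The product `S T` (`IsHeight.scalars`): mirror symmetry of the antisymmetrizers makes `S T` a
combination of `1`, `W R_1 U` and `f = W K_1 U`. The vanishing condition of height `k` eliminates `W
R_1 U`, so `S T` is an affine function of `f`. The BMW relations give `K_1 U f = f₀ K_1 U`, whence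
`f² = f₀ f`; this already makes `S T` invertible. Invertibility together with nondegeneracy of `K`
forces `f = f₀`, and every quantity becomes a scalar.

The factor `W E U'`: on `U` each of `R_2, …, R_k` acts by `-q⁻¹`, and `W R_1 U` is known, so `W E U
= (-1)^{k-1} c⁻¹` for both signs. Since `W E U = (W E U') T`, it follows that `W E U' = (-1)^{k-1} c
S`.

The factor `W D U`: it is the quantum trace of `A`, computed by tracing out one factor at a time;
the product telescopes to `q^{k(1-k)}` (`trace_tensorPow_mul_alt`). -/

namespace QMat

noncomputable section

/-! ### Antisymmetrizers in algebras with a representation of the BMW relations -/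

section Abstract

variable {B : Type} [Ring B] [Algebra ℂ B]

/-- Elements `s i`, `t i`, `κ i`, `i < m`, of an algebra which satisfy the relations of the
generators `σ_{i+1}`, `σ_{i+1}⁻¹`, `κ_{i+1}` of the algebra `W_{m+1} (q, μ)`. -/
structure BMWFamily (q μ : ℂ) (m : ℕ) (s t κ : ℕ → B) : Prop where
  q_ne : q ≠ 0
  nu_ne : q - q⁻¹ ≠ 0
  mu_ne : μ ≠ 0
  s_t : ∀ i < m, s i * t i = 1
  t_s : ∀ i < m, t i * s i = 1
  braid : ∀ i < m, ∀ j < m, (i + 1 = j ∨ j + 1 = i) → s i * s j * s i = s j * s i * s j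
  comm : ∀ i < m, ∀ j < m, (i + 1 < j ∨ j + 1 < i) → s i * s j = s j * s i
  kappa : ∀ i < m, κ i = kappaOf q μ (s i)
  s_k : ∀ i < m, s i * κ i = μ • κ i
  k_s : ∀ i < m, κ i * s i = μ • κ i
  k_s_adj : ∀ i < m, ∀ j < m, (i + 1 = j ∨ j + 1 = i) → κ i * s j = κ i * κ j * t i
  k_t_adj : ∀ i < m, ∀ j < m, (i + 1 = j ∨ j + 1 = i) → κ i * t j = κ i * κ j * s i
  s_k_adj : ∀ i < m, ∀ j < m, (i + 1 = j ∨ j + 1 = i) → s j * κ i = t i * κ j * κ i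
  t_k_adj : ∀ i < m, ∀ j < m, (i + 1 = j ∨ j + 1 = i) → t j * κ i = s i * κ j * κ i
  k_k_k : ∀ i < m, ∀ j < m, (i + 1 = j ∨ j + 1 = i) → κ i * κ j * κ i = κ i
  k_k : ∀ i < m, κ i * κ i = eta q μ • κ i

/-- The baxterized element `1 + (x - 1) / (q - q⁻¹) s + μ (x - 1) / (μ + q x) κ`. -/
def bax (q μ : ℂ) (s κ : B) (x : ℂ) : B :=
  1 + ((x - 1) / (q - q⁻¹)) • s + (μ * (x - 1) / (μ + q * x)) • κ

/-- The antisymmetrizers built from a family `s`, `κ`. -/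
def asym (q μ : ℂ) (s κ : ℕ → B) : ℕ → B
  | 0 => 1
  | 1 => 1
  | i + 2 => (q ^ (i + 1) / qNum q (i + 2)) •
      (asym q μ s κ (i + 1) * bax q μ (s i) (κ i) ((q ^ (2 * (i + 1)))⁻¹) *
        asym q μ s κ (i + 1))

namespace BMWFamily

variable {q μ : ℂ} {m : ℕ} {s t κ : ℕ → B}

theorem mono (h : BMWFamily q μ m s t κ) {n : ℕ} (hn : n ≤ m) : BMWFamily q μ n s t κ where
  q_ne := h.q_ne
  nu_ne := h.nu_ne
  mu_ne := h.mu_ne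
  s_t i hi := h.s_t i (by omega)
  t_s i hi := h.t_s i (by omega)
  braid i hi j hj := h.braid i (by omega) j (by omega)
  comm i hi j hj := h.comm i (by omega) j (by omega)
  kappa i hi := h.kappa i (by omega)
  s_k i hi := h.s_k i (by omega)
  k_s i hi := h.k_s i (by omega)
  k_s_adj i hi j hj := h.k_s_adj i (by omega) j (by omega)
  k_t_adj i hi j hj := h.k_t_adj i (by omega) j (by omega)
  s_k_adj i hi j hj := h.s_k_adj i (by omega) j (by omega)
  t_k_adj i hi j hj := h.t_k_adj i (by omega) j (by omega)
  k_k_k i hi j hj := h.k_k_k i (by omega) j (by omega)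
  k_k i hi := h.k_k i (by omega)

/-- Relabelling of the generators by a map which preserves and reflects adjacency. -/
theorem relabel (h : BMWFamily q μ m s t κ) {n : ℕ} (f : ℕ → ℕ) (hf : ∀ i < n, f i < m)
    (hadj : ∀ i < n, ∀ j < n, (i + 1 = j ∨ j + 1 = i) → (f i + 1 = f j ∨ f j + 1 = f i))
    (hfar : ∀ i < n, ∀ j < n, (i + 1 < j ∨ j + 1 < i) → (f i + 1 < f j ∨ f j + 1 < f i)) :
    BMWFamily q μ n (fun i => s (f i)) (fun i => t (f i)) (fun i => κ (f i)) where
  q_ne := h.q_ne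
  nu_ne := h.nu_ne
  mu_ne := h.mu_ne
  s_t i hi := h.s_t _ (hf i hi)
  t_s i hi := h.t_s _ (hf i hi)
  braid i hi j hj e := h.braid _ (hf i hi) _ (hf j hj) (hadj i hi j hj e)
  comm i hi j hj e := h.comm _ (hf i hi) _ (hf j hj) (hfar i hi j hj e)
  kappa i hi := h.kappa _ (hf i hi)
  s_k i hi := h.s_k _ (hf i hi)
  k_s i hi := h.k_s _ (hf i hi)
  k_s_adj i hi j hj e := h.k_s_adj _ (hf i hi) _ (hf j hj) (hadj i hi j hj e)
  k_t_adj i hi j hj e := h.k_t_adj _ (hf i hi) _ (hf j hj) (hadj i hi j hj e)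
  s_k_adj i hi j hj e := h.s_k_adj _ (hf i hi) _ (hf j hj) (hadj i hi j hj e)
  t_k_adj i hi j hj e := h.t_k_adj _ (hf i hi) _ (hf j hj) (hadj i hi j hj e)
  k_k_k i hi j hj e := h.k_k_k _ (hf i hi) _ (hf j hj) (hadj i hi j hj e)
  k_k i hi := h.k_k _ (hf i hi)

theorem shift (h : BMWFamily q μ m s t κ) {n : ℕ} (p : ℕ) (hn : n + p ≤ m) :
    BMWFamily q μ n (fun i => s (i + p)) (fun i => t (i + p)) (fun i => κ (i + p)) :=
  h.relabel (fun i => i + p) (fun i hi => by omega) (fun i _ j _ e => by omega)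
    (fun i _ j _ e => by omega)

theorem reverse (h : BMWFamily q μ m s t κ) :
    BMWFamily q μ m (fun i => s (m - 1 - i)) (fun i => t (m - 1 - i)) (fun i => κ (m - 1 - i)) :=
  h.relabel (fun i => m - 1 - i) (fun i hi => by omega) (fun i _ j _ e => by omega)
    (fun i _ j _ e => by omega)

theorem nu_smul_kappa (h : BMWFamily q μ m s t κ) {i : ℕ} (hi : i < m) :
    (μ * (q - q⁻¹)) • κ i = 1 + (q - q⁻¹) • s i - s i * s i := by
  have h1 := h.mu_ne; have h2 := h.nu_ne; have h3 := h.q_ne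
  rw [h.kappa i hi, kappaOf, smul_smul, mul_inv_cancel₀ (mul_ne_zero h1 h2), one_smul]
  simp only [sub_mul, mul_add, smul_mul_assoc, mul_smul_comm, one_mul, mul_one]
  match_scalars <;> field_simp
  ring

theorem s_s (h : BMWFamily q μ m s t κ) {i : ℕ} (hi : i < m) :
    s i * s i = 1 + (q - q⁻¹) • s i - (μ * (q - q⁻¹)) • κ i := by
  rw [h.nu_smul_kappa hi]; abel

theorem t_k (h : BMWFamily q μ m s t κ) {i : ℕ} (hi : i < m) : t i * κ i = μ⁻¹ • κ i := by
  have h1 : t i * (s i * κ i) = κ i := by rw [← mul_assoc, h.t_s i hi, one_mul]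
  rw [h.s_k i hi, mul_smul_comm] at h1
  rw [← h1, smul_smul, inv_mul_cancel₀ h.mu_ne, one_smul, h1]

theorem t_eq (h : BMWFamily q μ m s t κ) {i : ℕ} (hi : i < m) :
    t i = s i - (q - q⁻¹) • (1 : B) + (q - q⁻¹) • κ i := by
  have h1 := congrArg (t i * ·) (h.nu_smul_kappa hi)
  simp only [mul_smul_comm, h.t_k hi, mul_add, mul_sub (t i), mul_one, ← mul_assoc, h.t_s i hi,
    one_mul, smul_smul] at h1
  rw [show μ * (q - q⁻¹) * μ⁻¹ = q - q⁻¹ by field_simp [h.mu_ne]] at h1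
  rw [h1]; abel

theorem k_s_k (h : BMWFamily q μ m s t κ) {i j : ℕ} (hi : i < m) (hj : j < m)
    (e : i + 1 = j ∨ j + 1 = i) : κ i * s j * κ i = μ⁻¹ • κ i := by
  rw [h.k_s_adj i hi j hj e, mul_assoc, h.t_k hi, mul_smul_comm, h.k_k_k i hi j hj e]

theorem s_k_s (h : BMWFamily q μ m s t κ) {i j : ℕ} (hi : i < m) (hj : j < m)
    (e : i + 1 = j ∨ j + 1 = i) : s i * κ j * s i = t j * κ i * t j := by
  have e' := e.symm
  rw [h.s_k_adj j hj i hi e', mul_assoc, mul_assoc, ← mul_assoc (κ i), ← h.k_t_adj i hi j hj e,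
    mul_assoc]

/-- The BMW relations reduce both sides to combinations of the same words in the generators, and the
coefficients are then compared. The auxiliary identities supply the rewriting rules. -/
theorem yangBaxter (h : BMWFamily q μ m s t κ) {i j : ℕ} (hi : i < m) (hj : j < m)
    (e : i + 1 = j ∨ j + 1 = i) {x y : ℂ} (hx : μ + q * x ≠ 0) (hy : μ + q * y ≠ 0)
    (hxy : μ + q * (x * y) ≠ 0) :
    bax q μ (s i) (κ i) x * bax q μ (s j) (κ j) (x * y) * bax q μ (s i) (κ i) y =
      bax q μ (s j) (κ j) y * bax q μ (s i) (κ i) (x * y) * bax q μ (s j) (κ j) x := by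
  have e' := e.symm
  have hq := h.q_ne
  have hμ := h.mu_ne
  have hν := h.nu_ne
  have kks : ∀ {i j : ℕ}, i < m → j < m → (i + 1 = j ∨ j + 1 = i) →
      κ i * κ j * s i = κ i * s j - (q - q⁻¹) • κ i + (q - q⁻¹) • (κ i * κ j) := by
    intro i j hi hj e
    rw [← h.k_t_adj i hi j hj e, h.t_eq hj]
    simp only [mul_add, mul_sub, mul_smul_comm, mul_one]
  have skk : ∀ {i j : ℕ}, i < m → j < m → (i + 1 = j ∨ j + 1 = i) →
      s i * κ j * κ i = s j * κ i - (q - q⁻¹) • κ i + (q - q⁻¹) • (κ j * κ i) := by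
    intro i j hi hj e
    rw [← h.t_k_adj i hi j hj e, h.t_eq hj]
    simp only [add_mul, sub_mul, smul_mul_assoc, one_mul]
  have kss : ∀ {i j : ℕ}, i < m → j < m → (i + 1 = j ∨ j + 1 = i) →
      κ i * s j * s i = κ i * κ j := by
    intro i j hi hj e
    rw [h.k_s_adj i hi j hj e, mul_assoc, h.t_s i hi, mul_one]
  have ssk : ∀ {i j : ℕ}, i < m → j < m → (i + 1 = j ∨ j + 1 = i) →
      s i * s j * κ i = κ j * κ i := by
    intro i j hi hj e
    rw [mul_assoc, h.s_k_adj i hi j hj e, ← mul_assoc, ← mul_assoc, h.s_t i hi, one_mul]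
  -- Of the two words `s i * κ j * s i` and `s j * κ i * s j` only one may survive in the normal
  -- form.
  have sks : s i * κ j * s i = s j * κ i * s j - (q - q⁻¹) • (s j * κ i) - (q - q⁻¹) • (κ i * s j)
      + (q - q⁻¹) • (s i * κ j) + (q - q⁻¹) • (κ j * s i)
      - ((q - q⁻¹) * (q - q⁻¹)) • κ j + ((q - q⁻¹) * (q - q⁻¹)) • κ i := by
    have h1 : s j * κ i * κ j = s i * κ j - (q - q⁻¹) • κ j + (q - q⁻¹) • (κ i * κ j) :=
      skk hj hi e'
    have h2 : κ j * κ i * s j = κ j * s i - (q - q⁻¹) • κ j + (q - q⁻¹) • (κ j * κ i) :=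
      kks hj hi e'
    rw [h.s_k_s hi hj e, h.t_eq hj]
    simp only [mul_add, mul_sub, add_mul, sub_mul, mul_smul_comm, smul_mul_assoc, mul_one, one_mul,
      h1, h2, h.k_k_k j hj i hi e']
    module
  simp only [bax, mul_add, add_mul, smul_mul_assoc, mul_smul_comm, one_mul, mul_one,
    kks hi hj e, kks hj hi e', skk hi hj e, skk hj hi e', kss hi hj e, kss hj hi e', ssk hi hj e,
    ssk hj hi e', h.k_s_k hi hj e, h.k_s_k hj hi e', h.k_k_k i hi j hj e, h.k_k_k j hj i hi e',
    sks, h.braid i hi j hj e, h.s_s hi, h.s_s hj, h.s_k i hi, h.s_k j hj, h.k_s i hi, h.k_s j hj,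
    h.k_k i hi, h.k_k j hj]
  rw [show eta q μ = (1 + (q - q⁻¹) * μ - μ ^ 2) / (μ * (q - q⁻¹)) by
    rw [eta]; congr 1; field_simp; ring]
  -- Once `q - q⁻¹` is replaced by a free symbol, this relation is all that the comparison of
  -- coefficients needs to know about it.
  have hqν : q * (q - q⁻¹) = q ^ 2 - 1 := by field_simp
  generalize q - q⁻¹ = ν at hν hqν ⊢
  generalize hX : μ + q * x = X at hx ⊢
  generalize hY : μ + q * y = Y at hy ⊢
  generalize hZ : μ + q * (x * y) = Z at hxy ⊢
  match_scalars
  all_goals try (field_simp; ring1)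
  all_goals field_simp
  all_goals subst hX hY hZ
  all_goals first
    | ring1
    | linear_combination (x * y * (1 - x) * (1 - y) * (μ + q * (x * y))) * hqν
    | linear_combination (-(x * y * (1 - x) * (1 - y) * (μ + q * (x * y)))) * hqν

/-! #### Absorption -/

theorem q_sq_ne (h : BMWFamily q μ m s t κ) : q ^ 2 - 1 ≠ 0 := by
  intro h0
  apply h.nu_ne
  have := h.q_ne
  field_simp
  simpa using h0

/-- The factor `q⁻¹ + s i` of `κ i` kills `x`. -/
theorem kappa_mul_eq_zero (h : BMWFamily q μ m s t κ) {i : ℕ} (hi : i < m) {x : B}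
    (hx : s i * x = (-q⁻¹) • x) : κ i * x = 0 := by
  rw [h.kappa i hi, kappaOf, smul_mul_assoc, mul_assoc, add_mul, hx]
  simp

theorem mul_kappa_eq_zero (h : BMWFamily q μ m s t κ) {i : ℕ} (hi : i < m) {x : B}
    (hx : x * s i = (-q⁻¹) • x) : x * κ i = 0 := by
  have : (q • (1 : B) - s i) * (q⁻¹ • (1 : B) + s i) =
      (q⁻¹ • (1 : B) + s i) * (q • (1 : B) - s i) := by
    simp only [sub_mul, mul_sub, mul_add, add_mul, smul_mul_assoc, mul_smul_comm, one_mul, mul_one]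
    module
  rw [h.kappa i hi, kappaOf, this, mul_smul_comm, ← mul_assoc, mul_add, hx]
  simp

theorem bax_scalar (h : BMWFamily q μ m s t κ) (z : ℂ) :
    1 + (z - 1) / (q - q⁻¹) * (-q⁻¹) = (q - q⁻¹ * z) / (q - q⁻¹) := by
  have h1 := h.q_ne
  have h2 := h.nu_ne
  have h3 := h.q_sq_ne
  field_simp
  ring

theorem bax_mul (h : BMWFamily q μ m s t κ) {i : ℕ} (hi : i < m) {x : B}
    (hx : s i * x = (-q⁻¹) • x) (z : ℂ) :
    bax q μ (s i) (κ i) z * x = ((q - q⁻¹ * z) / (q - q⁻¹)) • x := by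
  rw [← h.bax_scalar, bax, add_mul, add_mul, smul_mul_assoc, smul_mul_assoc, hx,
    h.kappa_mul_eq_zero hi hx]
  simp only [one_mul, smul_zero]
  module

theorem mul_bax (h : BMWFamily q μ m s t κ) {i : ℕ} (hi : i < m) {x : B}
    (hx : x * s i = (-q⁻¹) • x) (z : ℂ) :
    x * bax q μ (s i) (κ i) z = ((q - q⁻¹ * z) / (q - q⁻¹)) • x := by
  rw [← h.bax_scalar, bax, mul_add, mul_add, mul_smul_comm, mul_smul_comm, hx,
    h.mul_kappa_eq_zero hi hx]
  simp only [mul_one, smul_zero]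
  module

/-- This fixes the prefactor in the recursion for `asym`: on a `(-q⁻¹)`-eigenvector of all the `s j`
the antisymmetrizer must act as the identity. -/
theorem normalization (h : BMWFamily q μ m s t κ) {i : ℕ} (hi : qNum q (i + 1) ≠ 0) :
    q ^ i / qNum q (i + 1) * ((q - q⁻¹ * (q ^ (2 * i))⁻¹) / (q - q⁻¹)) = 1 := by
  have h1 := h.q_ne
  have h2 := h.nu_ne
  rw [div_mul_div_comm, div_eq_one_iff_eq (mul_ne_zero hi h2), qNum, div_mul_cancel₀ _ h2]
  field_simp
  ring

theorem asym_mul (h : BMWFamily q μ m s t κ) {x : B} (n : ℕ) (hn : n ≤ m + 1)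
    (hq : ∀ j, 2 ≤ j → j ≤ n → qNum q j ≠ 0)
    (hx : ∀ i, i + 1 < n → s i * x = (-q⁻¹) • x) : asym q μ s κ n * x = x := by
  induction n with
  | zero => simp [asym]
  | succ n ih =>
    cases n with
    | zero => simp [asym]
    | succ n =>
      have ih' := ih (by omega) (fun j h1 h2 => hq j h1 (by omega)) fun i hi => hx i (by omega)
      rw [asym, smul_mul_assoc, mul_assoc, mul_assoc, ih',
        h.bax_mul (by omega) (hx n (by omega)), mul_smul_comm, ih', smul_smul,
        h.normalization (hq (n + 2) (by omega) le_rfl), one_smul]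

theorem mul_asym (h : BMWFamily q μ m s t κ) {x : B} (n : ℕ) (hn : n ≤ m + 1)
    (hq : ∀ j, 2 ≤ j → j ≤ n → qNum q j ≠ 0)
    (hx : ∀ i, i + 1 < n → x * s i = (-q⁻¹) • x) : x * asym q μ s κ n = x := by
  induction n with
  | zero => simp [asym]
  | succ n ih =>
    cases n with
    | zero => simp [asym]
    | succ n =>
      have ih' := ih (by omega) (fun j h1 h2 => hq j h1 (by omega)) fun i hi => hx i (by omega)
      rw [asym, mul_smul_comm, ← mul_assoc, ← mul_assoc, ih',
        h.mul_bax (by omega) (hx n (by omega)), smul_mul_assoc, ih', smul_smul,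
        h.normalization (hq (n + 2) (by omega) le_rfl), one_smul]

end BMWFamily

/-- Two families with the same values below `n - 1` have the same antisymmetrizers. -/
theorem asym_congr {q μ : ℂ} {s κ s' κ' : ℕ → B} (n : ℕ)
    (hs : ∀ i, i + 1 < n → s i = s' i) (hk : ∀ i, i + 1 < n → κ i = κ' i) :
    asym q μ s κ n = asym q μ s' κ' n := by
  induction n with
  | zero => rfl
  | succ n ih =>
    cases n with
    | zero => rfl
    | succ n =>
      rw [asym, asym, ih (fun i hi => hs i (by omega)) fun i hi => hk i (by omega),
        hs n (by omega), hk n (by omega)]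

theorem commute_bax {q μ : ℂ} {a s κ : B} (hs : Commute a s) (hk : Commute a κ) (z : ℂ) :
    Commute a (bax q μ s κ z) :=
  ((Commute.one_right a).add_right (hs.smul_right _)).add_right (hk.smul_right _)

theorem commute_asym {q μ : ℂ} {a : B} {s κ : ℕ → B} (n : ℕ)
    (hs : ∀ i, i + 1 < n → Commute a (s i)) (hk : ∀ i, i + 1 < n → Commute a (κ i)) :
    Commute a (asym q μ s κ n) := by
  induction n with
  | zero => exact Commute.one_right a
  | succ n ih =>
    cases n with
    | zero => exact Commute.one_right a
    | succ n =>
      have ih' := ih (fun i hi => hs i (by omega)) fun i hi => hk i (by omega)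
      exact ((ih'.mul_right (commute_bax (hs n (by omega)) (hk n (by omega)) _)).mul_right
        ih').smul_right _

namespace BMWFamily

variable {q μ : ℂ} {m : ℕ} {s t κ : ℕ → B}

theorem commute_s_k (h : BMWFamily q μ m s t κ) {i j : ℕ} (hi : i < m) (hj : j < m)
    (e : i + 1 < j ∨ j + 1 < i) : Commute (s i) (κ j) := by
  have h1 : Commute (s i) (s j) := h.comm i hi j hj e
  rw [h.kappa j hj, kappaOf]
  exact ((((Commute.one_right _).smul_right _).sub_right h1).mul_right
    (((Commute.one_right _).smul_right _).add_right h1)).smul_right _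

theorem commute_k_k (h : BMWFamily q μ m s t κ) {i j : ℕ} (hi : i < m) (hj : j < m)
    (e : i + 1 < j ∨ j + 1 < i) : Commute (κ i) (κ j) := by
  have h1 : Commute (κ i) (s j) := (h.commute_s_k hj hi e.symm).symm
  rw [h.kappa j hj, kappaOf]
  exact ((((Commute.one_right _).smul_right _).sub_right h1).mul_right
    (((Commute.one_right _).smul_right _).add_right h1)).smul_right _

theorem commute_s_asym (h : BMWFamily q μ m s t κ) {i n : ℕ} (hi : i < m) (hn : n ≤ i) :
    Commute (s i) (asym q μ s κ n) :=
  commute_asym n (fun j hj => h.comm i hi j (by omega) (by omega))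
    fun j hj => h.commute_s_k hi (by omega) (by omega)

theorem commute_k_asym (h : BMWFamily q μ m s t κ) {i n : ℕ} (hi : i < m) (hn : n ≤ i) :
    Commute (κ i) (asym q μ s κ n) :=
  commute_asym n (fun j hj => (h.commute_s_k (by omega) hi (by omega)).symm)
    fun j hj => h.commute_k_k hi (by omega) (by omega)

/-- At `x = q⁻²` the baxterized element degenerates to a multiple of the antisymmetrizer on two
strands. This is the source of all the absorption rules. -/
theorem bax_inv_q_sq (h : BMWFamily q μ m s t κ) {i : ℕ} (hi : i < m)
    (hμ : μ + q * (q ^ 2)⁻¹ ≠ 0) :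
    bax q μ (s i) (κ i) (q ^ 2)⁻¹ * s i = (-q⁻¹) • bax q μ (s i) (κ i) (q ^ 2)⁻¹ ∧
    s i * bax q μ (s i) (κ i) (q ^ 2)⁻¹ = (-q⁻¹) • bax q μ (s i) (κ i) (q ^ 2)⁻¹ := by
  have h1 := h.q_ne
  have h2 := h.nu_ne
  have h3 := h.q_sq_ne
  have h4 : q * μ + 1 ≠ 0 := by
    intro h0; apply hμ; field_simp; linear_combination h0
  constructor <;>
  · simp only [bax, add_mul, mul_add, smul_mul_assoc, mul_smul_comm, one_mul, mul_one, h.s_s hi,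
      h.s_k i hi, h.k_s i hi]
    match_scalars <;> field_simp <;> ring

end BMWFamily

end Abstract

end

end QMat

namespace QMat

noncomputable section

/-! ### Absorption, idempotency and mirror symmetry of the antisymmetrizers. -/

section Abstract

variable {B : Type} [Ring B] [Algebra ℂ B]

namespace BMWFamily

variable {q μ : ℂ} {m : ℕ} {s t κ : ℕ → B}

open MulOpposite in
-- The relations are invariant under reading words backwards, so each right absorption rule yields
-- the left one.
theorem opposite (h : BMWFamily q μ m s t κ) :
    BMWFamily q μ m (fun i => op (s i)) (fun i => op (t i)) (fun i => op (κ i)) where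
  q_ne := h.q_ne
  nu_ne := h.nu_ne
  mu_ne := h.mu_ne
  s_t i hi := congrArg op (h.t_s i hi)
  t_s i hi := congrArg op (h.s_t i hi)
  braid i hi j hj e := by
    simpa only [op_mul, mul_assoc] using congrArg op (h.braid i hi j hj e)
  comm i hi j hj e := congrArg op (h.comm i hi j hj e).symm
  kappa i hi := by
    have : (q • (1 : B) - s i) * (q⁻¹ • (1 : B) + s i) =
        (q⁻¹ • (1 : B) + s i) * (q • (1 : B) - s i) := by
      simp only [sub_mul, mul_sub, mul_add, add_mul, smul_mul_assoc, mul_smul_comm, one_mul,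
        mul_one]
      module
    rw [h.kappa i hi, kappaOf, this]
    simp [kappaOf]
  s_k i hi := congrArg op (h.k_s i hi)
  k_s i hi := congrArg op (h.s_k i hi)
  k_s_adj i hi j hj e := by
    simpa only [op_mul, mul_assoc] using congrArg op (h.s_k_adj i hi j hj e)
  k_t_adj i hi j hj e := by
    simpa only [op_mul, mul_assoc] using congrArg op (h.t_k_adj i hi j hj e)
  s_k_adj i hi j hj e := by
    simpa only [op_mul, mul_assoc] using congrArg op (h.k_s_adj i hi j hj e)
  t_k_adj i hi j hj e := by
    simpa only [op_mul, mul_assoc] using congrArg op (h.k_t_adj i hi j hj e)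
  k_k_k i hi j hj e := by
    simpa only [op_mul, mul_assoc] using congrArg op (h.k_k_k i hi j hj e)
  k_k i hi := congrArg op (h.k_k i hi)

end BMWFamily

open MulOpposite in
theorem asym_op (q μ : ℂ) (s κ : ℕ → B) (n : ℕ) :
    asym q μ (fun i => op (s i)) (fun i => op (κ i)) n = op (asym q μ s κ n) := by
  induction n with
  | zero => rfl
  | succ n ih =>
    cases n with
    | zero => rfl
    | succ n => rw [asym, asym, ih]; simp [bax, mul_assoc]

/-- The parameters are generic enough for the antisymmetrizers on up to `n` strands. -/
structure Regular (q μ : ℂ) (n : ℕ) : Prop where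
  qNum_ne : ∀ j, 1 ≤ j → j ≤ n → qNum q j ≠ 0
  mu_ne : ∀ i, 1 ≤ i → i < n → μ + q * (q ^ (2 * i))⁻¹ ≠ 0

theorem Regular.mono {q μ : ℂ} {n n' : ℕ} (h : Regular q μ n) (hn : n' ≤ n) : Regular q μ n' where
  qNum_ne j h1 h2 := h.qNum_ne j h1 (by omega)
  mu_ne i h1 h2 := h.mu_ne i h1 (by omega)

namespace BMWFamily

variable {q μ : ℂ} {m : ℕ} {s t κ : ℕ → B}

/-- Only the last generator needs an argument. The Yang–Baxter equation is used to move a factor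
`bax` at `q⁻²` in that generator to the far right of the antisymmetrizer, where `bax_inv_q_sq`
applies. -/
theorem asym_mul_s (h : BMWFamily q μ m s t κ) {n : ℕ} (hn : n ≤ m + 1) (hr : Regular q μ n)
    {i : ℕ} (hi : i + 1 < n) : asym q μ s κ n * s i = (-q⁻¹) • asym q μ s κ n := by
  induction n generalizing i with
  | zero => omega
  | succ n ih =>
    cases n with
    | zero => omega
    | succ n =>
      have hr' : Regular q μ (n + 1) := hr.mono (by omega)
      by_cases hin : i < n
      · rw [asym, smul_mul_assoc, mul_assoc, ih (by omega) hr' (by omega), mul_smul_comm,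
          smul_comm]
      obtain rfl : i = n := by omega
      have h2 : μ + q * (q ^ 2)⁻¹ ≠ 0 := by simpa using hr.mu_ne 1 le_rfl (by omega)
      cases i with
      | zero =>
        rw [asym, smul_mul_assoc, mul_assoc, asym]
        simp only [one_mul, mul_one]
        rw [show 2 * (0 + 1) = 2 from rfl, (h.bax_inv_q_sq (by omega) h2).1, smul_comm]
      | succ n =>
        set a := asym q μ s κ (n + 1) with ha
        set a' := asym q μ s κ (n + 2) with ha'
        set b := fun (j : ℕ) (z : ℂ) => bax q μ (s j) (κ j) z with hb
        have hq : q ≠ 0 := h.q_ne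
        have e1 : Commute a (s (n + 1)) := (h.commute_s_asym (by omega) le_rfl).symm
        have e2 : Commute a (κ (n + 1)) := (h.commute_k_asym (by omega) le_rfl).symm
        have e3 : a' * a = a' := h.mul_asym (n + 1) (by omega)
          (fun j h1 h2 => hr.qNum_ne j (by omega) (by omega))
          fun j hj => ih (by omega) hr' (by omega)
        have e4 : a' * b n (q ^ 2)⁻¹ = ((q - q⁻¹ * (q ^ 2)⁻¹) / (q - q⁻¹)) • a' :=
          h.mul_bax (by omega) (ih (by omega) hr' (by omega)) _
        have e5 : (q - q⁻¹ * (q ^ 2)⁻¹) / (q - q⁻¹) ≠ 0 := by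
          have := hr.qNum_ne 2 (by omega) (by omega)
          intro h0
          apply this
          rw [qNum]
          have h1 := h.nu_ne
          rw [div_eq_zero_iff, or_iff_left h1] at h0
          rw [div_eq_zero_iff, or_iff_left h1]
          field_simp at h0 ⊢
          linear_combination h0
        -- The inductive hypothesis lets `a'` emit a factor `b n (q⁻²)`, the one missing for the
        -- left side of the Yang–Baxter equation.
        have e6 : a' = ((q - q⁻¹ * (q ^ 2)⁻¹) / (q - q⁻¹))⁻¹ • (a' * b n (q ^ 2)⁻¹) := by
          rw [e4, smul_smul, inv_mul_cancel₀ e5, one_smul]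
        have e7 : b n (q ^ 2)⁻¹ * b (n + 1) (q ^ (2 * (n + 1 + 1)))⁻¹ * b n (q ^ (2 * (n + 1)))⁻¹ =
            b (n + 1) (q ^ (2 * (n + 1)))⁻¹ * b n (q ^ (2 * (n + 1 + 1)))⁻¹ *
              b (n + 1) (q ^ 2)⁻¹ := by
          have e : (q ^ (2 * (n + 1 + 1)))⁻¹ = (q ^ 2)⁻¹ * (q ^ (2 * (n + 1)))⁻¹ := by
            rw [← mul_inv]; congr 1; ring
          have h3 := hr.mu_ne (n + 1) (by omega) (by omega)
          have h4 := hr.mu_ne (n + 1 + 1) (by omega) (by omega)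
          rw [e] at h4 ⊢
          exact h.yangBaxter (by omega) (by omega) (Or.inl rfl) h2 h3 h4
        have e8 : ∀ z, Commute a (b (n + 1) z) := fun z => commute_bax e1 e2 z
        have key : a' * b (n + 1) (q ^ (2 * (n + 1 + 1)))⁻¹ * a' =
            (q ^ (n + 1) / qNum q (n + 2)) • ((q - q⁻¹ * (q ^ 2)⁻¹) / (q - q⁻¹))⁻¹ •
              (a' * (b (n + 1) (q ^ (2 * (n + 1)))⁻¹ * b n (q ^ (2 * (n + 1 + 1)))⁻¹) * a *
                b (n + 1) (q ^ 2)⁻¹) := by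
          calc a' * b (n + 1) (q ^ (2 * (n + 1 + 1)))⁻¹ * a'
              = (q ^ (n + 1) / qNum q (n + 2)) •
                ((a' * a) * b (n + 1) (q ^ (2 * (n + 1 + 1)))⁻¹ * b n (q ^ (2 * (n + 1)))⁻¹ * a) := by
                conv_lhs => rw [ha']
                nth_rewrite 2 [asym]
                rw [← ha, ← ha', mul_smul_comm, mul_assoc a' a, (e8 _).eq]
                simp only [mul_assoc, hb]
            _ = _ := by
                rw [e3]
                nth_rewrite 1 [e6]
                rw [smul_mul_assoc, smul_mul_assoc, smul_mul_assoc, mul_assoc a', mul_assoc a', e7]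
                congr 2
                simp only [mul_assoc]
                rw [(e8 _).eq]
        rw [asym, ← ha']
        change _ • (a' * b (n + 1) _ * a') * _ = _ • _ • (a' * b (n + 1) _ * a')
        rw [key, smul_mul_assoc, smul_mul_assoc, smul_mul_assoc, mul_assoc _ (b (n + 1) _),
          (h.bax_inv_q_sq (by omega) h2).1, mul_smul_comm, smul_comm (-q⁻¹), smul_comm (-q⁻¹),
          smul_comm (-q⁻¹)]

theorem s_mul_asym (h : BMWFamily q μ m s t κ) {n : ℕ} (hn : n ≤ m + 1) (hr : Regular q μ n)
    {i : ℕ} (hi : i + 1 < n) : s i * asym q μ s κ n = (-q⁻¹) • asym q μ s κ n := by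
  have := h.opposite.asym_mul_s hn hr hi
  rw [asym_op] at this
  exact congrArg MulOpposite.unop this

theorem asym_mul_asym (h : BMWFamily q μ m s t κ) {n n' : ℕ} (hn : n ≤ m + 1) (hn' : n' ≤ n)
    (hr : Regular q μ n) : asym q μ s κ n * asym q μ s κ n' = asym q μ s κ n :=
  h.mul_asym n' (by omega) (fun j _ _ => hr.qNum_ne j (by omega) (by omega)) fun i hi =>
    h.asym_mul_s hn hr (by omega)

theorem asym_mul_asym' (h : BMWFamily q μ m s t κ) {n n' : ℕ} (hn : n ≤ m + 1) (hn' : n' ≤ n)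
    (hr : Regular q μ n) : asym q μ s κ n' * asym q μ s κ n = asym q μ s κ n :=
  h.asym_mul n' (by omega) (fun j _ _ => hr.qNum_ne j (by omega) (by omega)) fun i hi =>
    h.s_mul_asym hn hr (by omega)

/-- The antisymmetrizer of the reversed family is the same. -/
theorem asym_reverse (h : BMWFamily q μ m s t κ) (hr : Regular q μ (m + 1)) :
    asym q μ (fun i => s (m - 1 - i)) (fun i => κ (m - 1 - i)) (m + 1) =
      asym q μ s κ (m + 1) := by
  -- The product of the two antisymmetrizers equals each of them, since each absorbs the other.
  have h1 := h.reverse.asym_mul (x := asym q μ s κ (m + 1)) (m + 1) le_rfl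
    (fun j _ _ => hr.qNum_ne j (by omega) (by omega)) fun i hi =>
      h.s_mul_asym le_rfl hr (by omega)
  have h2 := h.mul_asym
    (x := asym q μ (fun i => s (m - 1 - i)) (fun i => κ (m - 1 - i)) (m + 1)) (m + 1) le_rfl
    (fun j _ _ => hr.qNum_ne j (by omega) (by omega)) fun i hi => by
      have := h.reverse.asym_mul_s le_rfl hr (i := m - 1 - i) (by omega)
      rwa [show m - 1 - (m - 1 - i) = i by omega] at this
  exact h2.symm.trans h1

/-- The antisymmetrizer as a product of antisymmetrizers with shifted indices. -/
theorem asym_eq_shift (h : BMWFamily q μ m s t κ) {n : ℕ} (hn : n + 1 ≤ m)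
    (hr : Regular q μ (n + 2)) :
    asym q μ s κ (n + 2) = (q ^ (n + 1) / qNum q (n + 2)) •
      (asym q μ (fun i => s (i + 1)) (fun i => κ (i + 1)) (n + 1) *
        bax q μ (s 0) (κ 0) (q ^ (2 * (n + 1)))⁻¹ *
        asym q μ (fun i => s (i + 1)) (fun i => κ (i + 1)) (n + 1)) := by
  have h1 := (h.mono hn).asym_reverse hr
  have h2 := (h.shift (n := n) 1 hn).asym_reverse (hr.mono (by omega))
  -- Reversing all `n + 1` generators and keeping the first `n` leaves the labels `n, …, 1`, which
  -- is the reversal of the shifted family.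
  have h3 : asym q μ (fun i => s (n - i)) (fun i => κ (n - i)) (n + 1) =
      asym q μ (fun i => s (i + 1)) (fun i => κ (i + 1)) (n + 1) := by
    rw [← h2]
    apply asym_congr <;> intro i hi <;> congr 1 <;> omega
  rw [← h1, asym]
  simp only [Nat.add_sub_cancel, Nat.sub_self, h3]

end BMWFamily

end Abstract

end

end QMat

namespace QMat

open Matrix

noncomputable section

/-! ### Embeddings of operators into tensor powers -/

section Embeddings

set_option linter.unusedSectionVars false

variable {ι : Type} [Fintype ι] [DecidableEq ι]

theorem sum_cons {M : Type*} [AddCommMonoid M] {n : ℕ} (f : (Fin (n + 1) → ι) → M) :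
    ∑ x, f x = ∑ a, ∑ z : Fin n → ι, f (Fin.cons a z) := by
  rw [← Fintype.sum_prod_type']
  exact (Fintype.sum_equiv (Fin.consEquiv fun _ => ι) _ _ fun _ => rfl).symm

theorem sum_snoc {M : Type*} [AddCommMonoid M] {n : ℕ} (f : (Fin (n + 1) → ι) → M) :
    ∑ x, f x = ∑ a, ∑ z : Fin n → ι, f (Fin.snoc z a) := by
  rw [← Fintype.sum_prod_type']
  exact (Fintype.sum_equiv (Fin.snocEquiv fun _ => ι) _ _ fun _ => rfl).symm

theorem cons_eq_cons {n : ℕ} {a b : ι} {z w : Fin n → ι} :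
    (Fin.cons a z : Fin (n + 1) → ι) = Fin.cons b w ↔ a = b ∧ z = w :=
  Fin.cons_inj

theorem ext_cons {n : ℕ} {α : Type*} {X Y : Matrix (Fin (n + 1) → ι) (Fin (n + 1) → ι) α}
    (h : ∀ a z b w, X (Fin.cons a z) (Fin.cons b w) = Y (Fin.cons a z) (Fin.cons b w)) : X = Y := by
  ext x y
  rw [← Fin.cons_self_tail x, ← Fin.cons_self_tail y]
  exact h _ _ _ _

theorem ext_snoc {n : ℕ} {α : Type*} {X Y : Matrix (Fin (n + 1) → ι) (Fin (n + 1) → ι) α}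
    (h : ∀ a z b w, X (Fin.snoc z a) (Fin.snoc w b) = Y (Fin.snoc z a) (Fin.snoc w b)) : X = Y := by
  ext x y
  rw [← Fin.snoc_init_self x, ← Fin.snoc_init_self y]
  exact h _ _ _ _

/-- The homomorphism `X ↦ 1 ⊗ X`. -/
def idTens (n : ℕ) : Matrix (Fin n → ι) (Fin n → ι) ℂ →ₐ[ℂ]
    Matrix (Fin (n + 1) → ι) (Fin (n + 1) → ι) ℂ :=
  AlgHom.ofLinearMap
    { toFun := fun X => Matrix.of fun x y => if x 0 = y 0 then X (Fin.tail x) (Fin.tail y) else 0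
      map_add' := fun X Y => by ext x y; by_cases h : x 0 = y 0 <;> simp [h]
      map_smul' := fun c X => by ext x y; by_cases h : x 0 = y 0 <;> simp [h] }
    (by
      apply ext_cons
      intro a z b w
      by_cases h : a = b <;> simp [h, Matrix.one_apply])
    (by
      intro X Y
      apply ext_cons
      intro a z b w
      by_cases h : a = b <;> simp [h, Matrix.mul_apply, sum_cons])

@[simp]
theorem idTens_apply {n : ℕ} (X : Matrix (Fin n → ι) (Fin n → ι) ℂ) (a b : ι) (z w : Fin n → ι) :
    idTens n X (Fin.cons a z) (Fin.cons b w) = if a = b then X z w else 0 := by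
  simp [idTens]

/-- The homomorphism `X ↦ X ⊗ 1`. -/
def tensId (n : ℕ) : Matrix (Fin n → ι) (Fin n → ι) ℂ →ₐ[ℂ]
    Matrix (Fin (n + 1) → ι) (Fin (n + 1) → ι) ℂ :=
  AlgHom.ofLinearMap
    { toFun := fun X => Matrix.of fun x y =>
        if x (Fin.last n) = y (Fin.last n) then X (Fin.init x) (Fin.init y) else 0
      map_add' := fun X Y => by ext x y; by_cases h : x (Fin.last n) = y (Fin.last n) <;> simp [h]
      map_smul' := fun c X => by
        ext x y; by_cases h : x (Fin.last n) = y (Fin.last n) <;> simp [h] }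
    (by
      apply ext_snoc
      intro a z b w
      by_cases h : a = b <;> simp [h, Matrix.one_apply])
    (by
      intro X Y
      apply ext_snoc
      intro a z b w
      by_cases h : a = b <;> simp [h, Matrix.mul_apply, sum_snoc])

@[simp]
theorem tensId_apply {n : ℕ} (X : Matrix (Fin n → ι) (Fin n → ι) ℂ) (a b : ι) (z w : Fin n → ι) :
    tensId n X (Fin.snoc z a) (Fin.snoc w b) = if a = b then X z w else 0 := by
  simp [tensId]

theorem at₁_zero_apply {A : Type} [Ring A] {n : ℕ} (X : Matrix ι ι A) (a b : ι)
    (z w : Fin n → ι) :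
    at₁ (n + 1) X 0 (Fin.cons a z) (Fin.cons b w) = if z = w then X a b else 0 := by
  have : (∀ j : Fin (n + 1), j ≠ 0 →
      (Fin.cons a z : Fin (n + 1) → ι) j = (Fin.cons b w : Fin (n + 1) → ι) j) ↔ z = w := by
    rw [Fin.forall_fin_succ]
    simp [funext_iff]
  rw [at₁, Matrix.of_apply, if_congr this rfl rfl]
  simp

theorem at₂_zero_apply {n : ℕ} (X : Matrix (ι × ι) (ι × ι) ℂ) (h : 0 + 1 < n + 2)
    (a b a' b' : ι) (z w : Fin n → ι) :
    at₂ (n + 2) X 0 h (Fin.cons a (Fin.cons b z)) (Fin.cons a' (Fin.cons b' w)) =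
      if z = w then X (a, b) (a', b') else 0 := by
  have : (∀ j : Fin (n + 2), j.1 ≠ 0 → j.1 ≠ 0 + 1 →
      (Fin.cons a (Fin.cons b z) : Fin (n + 2) → ι) j =
        (Fin.cons a' (Fin.cons b' w) : Fin (n + 2) → ι) j) ↔ z = w := by
    rw [Fin.forall_fin_succ, Fin.forall_fin_succ]
    simp [funext_iff]
  rw [at₂, Matrix.of_apply, if_congr this rfl rfl]
  rfl

theorem at₂_succ {n i : ℕ} (X : Matrix (ι × ι) (ι × ι) ℂ) (h : i + 1 + 1 < n + 1) :
    at₂ (n + 1) X (i + 1) h = idTens n (at₂ n X i (by omega)) := by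
  apply ext_cons
  intro a z b w
  rw [idTens_apply, at₂, Matrix.of_apply, at₂, Matrix.of_apply, ← ite_and]
  refine if_congr ?_ rfl rfl
  rw [Fin.forall_fin_succ]
  simp

theorem tensId_at₂ {n i : ℕ} (X : Matrix (ι × ι) (ι × ι) ℂ) (h : i + 1 < n) :
    tensId n (at₂ n X i h) = at₂ (n + 1) X i (by omega) := by
  apply ext_snoc
  intro a z b w
  rw [tensId_apply, at₂, Matrix.of_apply, at₂, Matrix.of_apply, ← ite_and]
  have e : ∀ (z : Fin n → ι) (a : ι) (j : ℕ) (hj : j < n),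
      (Fin.snoc z a : Fin (n + 1) → ι) ⟨j, by omega⟩ = z ⟨j, hj⟩ := fun z a j hj =>
    Fin.snoc_castSucc (α := fun _ => ι) a z ⟨j, hj⟩
  rw [e _ _ i (by omega), e _ _ i (by omega), e _ _ (i + 1) h, e _ _ (i + 1) h]
  refine if_congr ?_ rfl rfl
  rw [Fin.forall_fin_succ']
  simp only [Fin.val_castSucc, Fin.snoc_castSucc, Fin.val_last, Fin.snoc_last]
  constructor
  · rintro ⟨h1, h2⟩
    exact ⟨h2, fun _ _ => h1⟩
  · rintro ⟨h1, h2⟩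
    exact ⟨h2 (by omega) (by omega), h1⟩

theorem ext_cons₂ {n : ℕ} {α : Type*} {X Y : Matrix (Fin (n + 2) → ι) (Fin (n + 2) → ι) α}
    (h : ∀ a b z a' b' w, X (Fin.cons a (Fin.cons b z)) (Fin.cons a' (Fin.cons b' w)) =
      Y (Fin.cons a (Fin.cons b z)) (Fin.cons a' (Fin.cons b' w))) : X = Y := by
  apply ext_cons
  intro a z b w
  rw [← Fin.cons_self_tail z, ← Fin.cons_self_tail w]
  exact h _ _ _ _ _ _

theorem at₂_one {n i : ℕ} (h : i + 1 < n) : at₂ (ι := ι) n 1 i h = (1 : Matrix _ _ ℂ) := by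
  induction i generalizing n with
  | zero =>
    obtain ⟨n, rfl⟩ : ∃ m, n = m + 2 := ⟨n - 2, by omega⟩
    apply ext_cons₂
    intro a b z a' b' w
    rw [at₂_zero_apply]
    simp only [Matrix.one_apply, Prod.mk.injEq, ← ite_and, cons_eq_cons]
    exact if_congr (by tauto) rfl rfl
  | succ i ih =>
    obtain ⟨n, rfl⟩ : ∃ m, n = m + 1 := ⟨n - 1, by omega⟩
    rw [at₂_succ, ih, map_one]

theorem at₂_mul {n i : ℕ} (X Y : Matrix (ι × ι) (ι × ι) ℂ) (h : i + 1 < n) :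
    at₂ n (X * Y) i h = at₂ n X i h * at₂ n Y i h := by
  induction i generalizing n with
  | zero =>
    obtain ⟨n, rfl⟩ : ∃ m, n = m + 2 := ⟨n - 2, by omega⟩
    apply ext_cons₂
    intro a b z a' b' w
    simp only [Matrix.mul_apply, sum_cons, at₂_zero_apply, Fintype.sum_prod_type]
    by_cases e : z = w <;> simp [e]
  | succ i ih =>
    obtain ⟨n, rfl⟩ : ∃ m, n = m + 1 := ⟨n - 1, by omega⟩
    rw [at₂_succ, ih, map_mul, at₂_succ, at₂_succ]

/-- `X ↦ X_{i, i + 1}` as a homomorphism. -/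
def at₂Hom (n i : ℕ) (h : i + 1 < n) : Matrix (ι × ι) (ι × ι) ℂ →ₐ[ℂ]
    Matrix (Fin n → ι) (Fin n → ι) ℂ :=
  AlgHom.ofLinearMap
    { toFun := fun X => at₂ n X i h
      map_add' := fun X Y => by
        ext x y
        simp only [at₂, Matrix.of_apply, Matrix.add_apply]
        split_ifs <;> simp
      map_smul' := fun c X => by
        ext x y
        simp only [at₂, Matrix.of_apply, Matrix.smul_apply, RingHom.id_apply]
        split_ifs <;> simp }
    (at₂_one h) fun X Y => at₂_mul X Y h

theorem at₂Hom_apply {n i : ℕ} (h : i + 1 < n) (X : Matrix (ι × ι) (ι × ι) ℂ) :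
    at₂Hom n i h X = at₂ n X i h := rfl

theorem commute_at₂_zero_idTens {n : ℕ} (X : Matrix (ι × ι) (ι × ι) ℂ)
    (Y : Matrix (Fin n → ι) (Fin n → ι) ℂ) (h : 0 + 1 < n + 2) :
    Commute (at₂ (n + 2) X 0 h) (idTens (n + 1) (idTens n Y)) := by
  apply ext_cons₂
  intro a b z a' b' w
  simp [Matrix.mul_apply, sum_cons, at₂_zero_apply, mul_comm]

theorem commute_at₂ {n i j : ℕ} (X Y : Matrix (ι × ι) (ι × ι) ℂ) (hi : i + 1 < n)
    (hj : j + 1 < n) (hij : i + 1 < j) : Commute (at₂ n X i hi) (at₂ n Y j hj) := by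
  induction i generalizing n j with
  | zero =>
    obtain ⟨n, rfl⟩ : ∃ m, n = m + 2 := ⟨n - 2, by omega⟩
    obtain ⟨j, rfl⟩ : ∃ m, j = m + 2 := ⟨j - 2, by omega⟩
    rw [at₂_succ Y, at₂_succ Y]
    exact commute_at₂_zero_idTens _ _ _
  | succ i ih =>
    obtain ⟨n, rfl⟩ : ∃ m, n = m + 1 := ⟨n - 1, by omega⟩
    obtain ⟨j, rfl⟩ : ∃ m, j = m + 1 := ⟨j - 1, by omega⟩
    rw [at₂_succ, at₂_succ]
    exact (ih (by omega) (by omega) (by omega)).map (idTens n)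

theorem commute_at₁_zero_idTens {n : ℕ} (X : Matrix ι ι ℂ)
    (Y : Matrix (Fin n → ι) (Fin n → ι) ℂ) :
    Commute (at₁ (n + 1) X 0) (idTens n Y) := by
  apply ext_cons
  intro a z b w
  simp [Matrix.mul_apply, sum_cons, at₁_zero_apply, mul_comm]

/-- An equation in `V^{⊗ 3}` between operators in adjacent factors holds in all positions. -/
theorem at₂_adjacent {n i : ℕ} (h : i + 2 < n) :
    ∃ φ : Matrix (Fin 3 → ι) (Fin 3 → ι) ℂ →ₐ[ℂ] Matrix (Fin n → ι) (Fin n → ι) ℂ,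
      ∀ X, φ (at₂ 3 X 0 (by norm_num)) = at₂ n X i (by omega) ∧
        φ (at₂ 3 X 1 (by norm_num)) = at₂ n X (i + 1) (by omega) := by
  induction n generalizing i with
  | zero => omega
  | succ n ih =>
    cases i with
    | zero =>
      by_cases hn : n = 2
      · subst hn
        exact ⟨AlgHom.id ℂ _, fun X => ⟨rfl, rfl⟩⟩
      · obtain ⟨φ, hφ⟩ := ih (i := 0) (by omega)
        refine ⟨(tensId n).comp φ, fun X => ⟨?_, ?_⟩⟩
        · rw [AlgHom.comp_apply, (hφ X).1, tensId_at₂]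
        · rw [AlgHom.comp_apply, (hφ X).2, tensId_at₂]
    | succ i =>
      obtain ⟨φ, hφ⟩ := ih (i := i) (by omega)
      refine ⟨(idTens n).comp φ, fun X => ⟨?_, ?_⟩⟩
      · rw [AlgHom.comp_apply, (hφ X).1, at₂_succ]
      · rw [AlgHom.comp_apply, (hφ X).2, at₂_succ]

end Embeddings

end

end QMat

namespace QMat

open Matrix

noncomputable section

/-! ### Representations of the BMW algebras and families -/

section Representations

variable {B : Type} [Ring B] [Algebra ℂ B]

theorem map_asym {C : Type} [Ring C] [Algebra ℂ C] (φ : B →ₐ[ℂ] C) (q μ : ℂ) (s κ : ℕ → B)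
    (n : ℕ) : φ (asym q μ s κ n) = asym q μ (fun i => φ (s i)) (fun i => φ (κ i)) n := by
  induction n with
  | zero => simp [asym]
  | succ n ih =>
    cases n with
    | zero => simp [asym]
    | succ n => simp [asym, bax, ih]

theorem map_kappaOf {C : Type} [Ring C] [Algebra ℂ C] (φ : B →ₐ[ℂ] C) (q μ : ℂ) (s : B) :
    φ (kappaOf q μ s) = kappaOf q μ (φ s) := by
  simp [kappaOf]

theorem BMW.shift_gen (q μ : ℂ) (n n' p : ℕ) (h : p + n ≤ n') (g : BMWGen n) :
    BMW.shift q μ n n' p h (BMW.gen q μ n g) = BMW.gen q μ n' (BMW.trGen n n' p h g) := by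
  simp [BMW.shift, BMW.gen]

theorem BMW.map_antisym {q μ : ℂ} {n : ℕ} (φ : BMW q μ n →ₐ[ℂ] B) (s κ : ℕ → B)
    (hs : ∀ i : Fin (n - 1), φ (BMW.σ q μ n i) = s i)
    (hk : ∀ i : Fin (n - 1), φ (BMW.κ q μ n i) = κ i) :
    φ (BMW.antisym q μ n) = asym q μ s κ n := by
  induction n with
  | zero => simp [BMW.antisym, asym]
  | succ n ih =>
    cases n with
    | zero => simp [BMW.antisym, asym]
    | succ n =>
      have ih' := ih (φ.comp (BMW.shift q μ (n + 1) (n + 2) 0 (by omega)))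
        (fun i => by
          rw [AlgHom.comp_apply, BMW.σ, BMW.shift_gen]; exact hs ⟨i.1 + 0, by omega⟩)
        (fun i => by
          rw [AlgHom.comp_apply, BMW.κ, BMW.shift_gen]; exact hk ⟨i.1 + 0, by omega⟩)
      rw [AlgHom.comp_apply] at ih'
      rw [BMW.antisym, asym, map_smul, map_mul, map_mul, ih']
      simp [BMW.baxMinus, bax, hs, hk]

theorem BMW.gen_rel {q μ : ℂ} {n : ℕ} {x y : FreeAlgebra ℂ (BMWGen n)} (r : BMWRel q μ n x y) :
    RingQuot.mkAlgHom ℂ (BMWRel q μ n) x = RingQuot.mkAlgHom ℂ (BMWRel q μ n) y :=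
  RingQuot.mkAlgHom_rel ℂ r

theorem BMWFamily.of_hom {q μ : ℂ} {n : ℕ} (φ : BMW q μ n →ₐ[ℂ] B) (s t κ : ℕ → B)
    (hq : q ≠ 0) (hν : q - q⁻¹ ≠ 0) (hμ : μ ≠ 0)
    (hs : ∀ i : Fin (n - 1), φ (BMW.gen q μ n (.s i)) = s i)
    (ht : ∀ i : Fin (n - 1), φ (BMW.gen q μ n (.t i)) = t i)
    (hk : ∀ i : Fin (n - 1), φ (BMW.gen q μ n (.k i)) = κ i) :
    BMWFamily q μ (n - 1) s t κ := by
  have key : ∀ {x y : FreeAlgebra ℂ (BMWGen n)}, BMWRel q μ n x y →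
      φ (RingQuot.mkAlgHom ℂ (BMWRel q μ n) x) = φ (RingQuot.mkAlgHom ℂ (BMWRel q μ n) y) :=
    fun r => congrArg φ (BMW.gen_rel r)
  simp only [BMW.gen] at hs ht hk
  constructor
  · exact hq
  · exact hν
  · exact hμ
  · intro i hi; simpa [hs, ht] using key (.s_t ⟨i, hi⟩)
  · intro i hi; simpa [hs, ht] using key (.t_s ⟨i, hi⟩)
  · intro i hi j hj e; simpa [hs] using key (.braid ⟨i, hi⟩ ⟨j, hj⟩ e)
  · rintro i hi j hj (e | e)
    · simpa [hs] using key (.comm ⟨i, hi⟩ ⟨j, hj⟩ e)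
    · simpa [hs] using (key (.comm ⟨j, hj⟩ ⟨i, hi⟩ e)).symm
  · intro i hi; simpa [hs, hk, kappaOf] using key (.kappa ⟨i, hi⟩)
  · intro i hi; simpa [hs, hk] using key (.s_k ⟨i, hi⟩)
  · intro i hi; simpa [hs, hk] using key (.k_s ⟨i, hi⟩)
  · intro i hi j hj e; simpa [hs, ht, hk] using key (.k_s_adj ⟨i, hi⟩ ⟨j, hj⟩ e)
  · intro i hi j hj e; simpa [hs, ht, hk] using key (.k_t_adj ⟨i, hi⟩ ⟨j, hj⟩ e)
  · intro i hi j hj e; simpa [hs, ht, hk] using key (.s_k_adj ⟨i, hi⟩ ⟨j, hj⟩ e)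
  · intro i hi j hj e; simpa [hs, ht, hk] using key (.t_k_adj ⟨i, hi⟩ ⟨j, hj⟩ e)
  · intro i hi j hj e; simpa [hs, ht, hk] using key (.k_k_k ⟨i, hi⟩ ⟨j, hj⟩ e)
  · intro i hi; simpa [hs, hk] using key (.k_k ⟨i, hi⟩)

set_option linter.unusedSectionVars false

variable {ι : Type} [Fintype ι] [DecidableEq ι]

/-- The sequence of operators `X_{i, i + 1}` on `V^{⊗ n}`, extended by zero. -/
def seqAt (n : ℕ) (X : Matrix (ι × ι) (ι × ι) ℂ) (i : ℕ) : Matrix (Fin n → ι) (Fin n → ι) ℂ :=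
  if h : i + 1 < n then at₂ n X i h else 0

theorem seqAt_of_lt {n i : ℕ} (X : Matrix (ι × ι) (ι × ι) ℂ) (h : i + 1 < n) :
    seqAt n X i = at₂ n X i h := dif_pos h

theorem idTens_seqAt {n i : ℕ} (X : Matrix (ι × ι) (ι × ι) ℂ) :
    idTens n (seqAt n X i) = seqAt (n + 1) X (i + 1) := by
  by_cases h : i + 1 < n
  · rw [seqAt_of_lt X h, seqAt_of_lt X (by omega), at₂_succ]
  · rw [seqAt, dif_neg h, seqAt, dif_neg (by omega), map_zero]

theorem tensId_seqAt {n i : ℕ} (X : Matrix (ι × ι) (ι × ι) ℂ) (h : i + 1 < n) :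
    tensId n (seqAt n X i) = seqAt (n + 1) X i := by
  rw [seqAt_of_lt X h, seqAt_of_lt X (by omega), tensId_at₂]

namespace IsBMWType

variable {q μ : ℂ} {R : GL (ι × ι) ℂ}

theorem nu_ne_zero (h : IsBMWType q μ R) : q - q⁻¹ ≠ 0 := by
  intro h0
  have h1 := h.q_ne_zero
  field_simp at h0
  have h2 : (q - 1) * (q + 1) = 0 := by linear_combination h0
  rcases mul_eq_zero.1 h2 with h3 | h3
  · exact h.q_ne_one (sub_eq_zero.1 h3)
  · exact h.q_ne_neg_one (eq_neg_of_add_eq_zero_left h3)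

theorem rho_s (h : IsBMWType q μ R) (n : ℕ) (i : Fin (n - 1)) :
    h.ρ n (BMW.gen q μ n (.s i)) = seqAt n R.1 i := by
  rw [seqAt_of_lt _ (by omega)]
  exact Classical.choose_spec (h.exists_rep n) i

theorem rho_k (h : IsBMWType q μ R) (n : ℕ) (i : Fin (n - 1)) :
    h.ρ n (BMW.gen q μ n (.k i)) = seqAt n (kappaOf q μ R.1) i := by
  rw [BMW.gen, BMW.gen_rel (.kappa i), map_kappaOf, map_kappaOf]
  have := h.rho_s n i
  rw [BMW.gen] at this
  rw [this, seqAt_of_lt _ (by omega), seqAt_of_lt _ (by omega), ← at₂Hom_apply, ← at₂Hom_apply,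
    map_kappaOf]

/-- Both operators are inverse to the image of `σ_i`. -/
theorem rho_t (h : IsBMWType q μ R) (n : ℕ) (i : Fin (n - 1)) :
    h.ρ n (BMW.gen q μ n (.t i)) = seqAt n (R⁻¹).1 i := by
  have h1 : h.ρ n (BMW.gen q μ n (.t i)) * h.ρ n (BMW.gen q μ n (.s i)) = 1 := by
    rw [← map_mul, BMW.gen, BMW.gen, ← map_mul, BMW.gen_rel (.t_s i), map_one, map_one]
  have h2 : h.ρ n (BMW.gen q μ n (.s i)) * seqAt n (R⁻¹).1 i = 1 := by
    rw [h.rho_s, seqAt_of_lt _ (by omega), seqAt_of_lt _ (by omega), ← at₂_mul, ← Units.val_mul,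
      mul_inv_cancel, Units.val_one, at₂_one]
  exact left_inv_eq_right_inv h1 h2

theorem family (h : IsBMWType q μ R) (n : ℕ) :
    BMWFamily q μ (n - 1) (seqAt n R.1) (seqAt n (R⁻¹).1) (seqAt n (kappaOf q μ R.1)) :=
  .of_hom (h.ρ n) _ _ _ h.q_ne_zero h.nu_ne_zero h.mu_ne_zero (h.rho_s n) (h.rho_t n) (h.rho_k n)

end IsBMWType

/-- The antisymmetrizer on `V^{⊗ n}` built from the operator `R`. -/
def alt (q μ : ℂ) (R : Matrix (ι × ι) (ι × ι) ℂ) (n : ℕ) : Matrix (Fin n → ι) (Fin n → ι) ℂ :=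
  asym q μ (seqAt n R) (seqAt n (kappaOf q μ R)) n

theorem tensId_alt (q μ : ℂ) (R : Matrix (ι × ι) (ι × ι) ℂ) (n : ℕ) :
    tensId n (alt q μ R n) = asym q μ (seqAt (n + 1) R) (seqAt (n + 1) (kappaOf q μ R)) n := by
  rw [alt, map_asym]
  exact asym_congr n (fun i hi => tensId_seqAt _ hi) fun i hi => tensId_seqAt _ hi

theorem idTens_alt (q μ : ℂ) (R : Matrix (ι × ι) (ι × ι) ℂ) (n : ℕ) :
    idTens n (alt q μ R n) = asym q μ (fun i => seqAt (n + 1) R (i + 1))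
      (fun i => seqAt (n + 1) (kappaOf q μ R) (i + 1)) n := by
  rw [alt, map_asym]
  exact asym_congr n (fun i _ => idTens_seqAt _) fun i _ => idTens_seqAt _

theorem IsBMWType.rho_antisym {q μ : ℂ} {R : GL (ι × ι) ℂ} (h : IsBMWType q μ R) (n : ℕ) :
    h.ρ n (BMW.antisym q μ n) = alt q μ R.1 n :=
  BMW.map_antisym _ _ _ (h.rho_s n) (h.rho_k n)

theorem IsBMWType.rho_antisymUp {q μ : ℂ} {R : GL (ι × ι) ℂ} (h : IsBMWType q μ R) (n : ℕ) :
    h.ρ (n + 1) (BMW.antisymUp q μ n) = idTens n (alt q μ R.1 n) := by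
  rw [idTens_alt, BMW.antisymUp, ← AlgHom.comp_apply]
  apply BMW.map_antisym
  · intro i
    rw [AlgHom.comp_apply, BMW.σ, BMW.shift_gen]
    exact h.rho_s (n + 1) ⟨i.1 + 1, by omega⟩
  · intro i
    rw [AlgHom.comp_apply, BMW.κ, BMW.shift_gen]
    exact h.rho_k (n + 1) ⟨i.1 + 1, by omega⟩

end Representations

/-! ### Quantum traces -/

section Traces

set_option linter.unusedSectionVars false

variable {ι : Type} [Fintype ι] [DecidableEq ι]

/-- The trace over the last factor weighted by `D`. -/
def lastTrace (D : Matrix ι ι ℂ) (n : ℕ) : Matrix (Fin (n + 1) → ι) (Fin (n + 1) → ι) ℂ →ₗ[ℂ]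
    Matrix (Fin n → ι) (Fin n → ι) ℂ where
  toFun X := Matrix.of fun x y => ∑ e, ∑ f, D e f * X (Fin.snoc x f) (Fin.snoc y e)
  map_add' X Y := by ext x y; simp [mul_add, Finset.sum_add_distrib]
  map_smul' c X := by ext x y; simp [Finset.mul_sum, mul_left_comm]

theorem lastTrace_apply (D : Matrix ι ι ℂ) {n : ℕ}
    (X : Matrix (Fin (n + 1) → ι) (Fin (n + 1) → ι) ℂ) (x y : Fin n → ι) :
    lastTrace D n X x y = ∑ e, ∑ f, D e f * X (Fin.snoc x f) (Fin.snoc y e) := rfl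

/-- With its mirror below this makes the weighted trace a bimodule map, so the outer
antisymmetrizers in the recursion can be pulled out of it. -/
theorem lastTrace_tensId_mul (D : Matrix ι ι ℂ) {n : ℕ} (Y : Matrix (Fin n → ι) (Fin n → ι) ℂ)
    (X : Matrix (Fin (n + 1) → ι) (Fin (n + 1) → ι) ℂ) :
    lastTrace D n (tensId n Y * X) = Y * lastTrace D n X := by
  ext x y
  simp only [lastTrace_apply, Matrix.mul_apply, sum_snoc, tensId_apply, ite_mul, zero_mul,
    Finset.sum_ite_irrel, Finset.sum_const_zero, Finset.sum_ite_eq, Finset.mem_univ, if_true,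
    Finset.mul_sum]
  rw [Finset.sum_comm_cycle]
  refine Finset.sum_congr rfl fun _ _ => Finset.sum_congr rfl fun _ _ => Finset.sum_congr rfl ?_
  intros; ring

theorem lastTrace_mul_tensId (D : Matrix ι ι ℂ) {n : ℕ} (Y : Matrix (Fin n → ι) (Fin n → ι) ℂ)
    (X : Matrix (Fin (n + 1) → ι) (Fin (n + 1) → ι) ℂ) :
    lastTrace D n (X * tensId n Y) = lastTrace D n X * Y := by
  ext x y
  simp only [lastTrace_apply, Matrix.mul_apply, sum_snoc, tensId_apply, mul_ite, mul_zero,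
    Finset.sum_ite_irrel, Finset.sum_const_zero, Finset.sum_ite_eq', Finset.mem_univ, if_true,
    Finset.mul_sum, Finset.sum_mul]
  rw [Finset.sum_comm_cycle]
  refine Finset.sum_congr rfl fun _ _ => Finset.sum_congr rfl fun _ _ => Finset.sum_congr rfl ?_
  intros; ring

theorem lastTrace_idTens (D : Matrix ι ι ℂ) {n : ℕ}
    (X : Matrix (Fin (n + 1) → ι) (Fin (n + 1) → ι) ℂ) :
    lastTrace D (n + 1) (idTens (n + 1) X) = idTens n (lastTrace D n X) := by
  apply ext_cons
  intro a z b w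
  simp only [lastTrace_apply, idTens_apply, ← Fin.cons_snoc_eq_snoc_cons]
  by_cases h : a = b <;> simp [h]

theorem lastTrace_one (D : Matrix ι ι ℂ) (n : ℕ) : lastTrace D n 1 = D.trace • 1 := by
  ext x y
  simp [lastTrace_apply, Matrix.one_apply, Matrix.trace, ite_and]

theorem trace_tensorPow_succ_mul (D : Matrix ι ι ℂ) {n : ℕ}
    (X : Matrix (Fin (n + 1) → ι) (Fin (n + 1) → ι) ℂ) :
    (tensorPow (n + 1) D * X).trace = (tensorPow n D * lastTrace D n X).trace := by
  simp only [Matrix.trace, Matrix.diag, Matrix.mul_apply, sum_snoc, tensorPow, Matrix.of_apply,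
    Fin.prod_univ_castSucc, Fin.snoc_castSucc, Fin.snoc_last, lastTrace_apply, Finset.mul_sum]
  rw [Finset.sum_comm]
  refine Finset.sum_congr rfl fun z _ => ?_
  rw [Finset.sum_comm_cycle]
  refine Finset.sum_congr rfl fun _ _ => Finset.sum_congr rfl fun _ _ => Finset.sum_congr rfl ?_
  intros; ring

theorem lastTrace_at₂ {D : Matrix ι ι ℂ} {X : Matrix (ι × ι) (ι × ι) ℂ} {c : ℂ}
    (h : lastTrace D 1 (at₂ 2 X 0 (by norm_num)) = c • 1) (n : ℕ) :
    lastTrace D (n + 1) (at₂ (n + 2) X n (by omega)) = c • 1 := by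
  induction n with
  | zero => exact h
  | succ n ih => rw [at₂_succ, lastTrace_idTens, ih, map_smul, map_one]

end Traces

end

end QMat

namespace QMat

open Matrix

noncomputable section

/-! ### Quantum traces of `R`, `K` and the antisymmetrizers. -/

section SkewTraces

variable {ι : Type} [Fintype ι] [DecidableEq ι]

theorem traceMiddle_mul_apply (X Y : Matrix (ι × ι) (ι × ι) ℂ) (a b c d : ι) :
    traceMiddle (at₂ 3 X 0 (by norm_num) * at₂ 3 Y 1 (by norm_num)) (a, c) (b, d) =
      ∑ e, ∑ f, X (a, e) (b, f) * Y (f, c) (e, d) := by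
  have h : ∀ a b c : ι, (![a, b, c] : Fin 3 → ι) = Fin.cons a (Fin.cons b (Fin.cons c Fin.elim0)) :=
    fun a b c => by
      ext i; fin_cases i <;> rfl
  simp only [traceMiddle, Matrix.of_apply, h]
  rw [at₂_succ]
  refine Finset.sum_congr rfl fun e _ => ?_
  simp [Matrix.mul_apply, sum_cons, at₂_zero_apply]

/-- Tracing `Tr_(2) R_1 Ψ_2 = P` over the remaining last factor turns `Ψ` into `D_R` and `P` into
the identity. -/
theorem SkewInvertible.lastTrace_eq_one {R : GL (ι × ι) ℂ} (h : SkewInvertible R) :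
    lastTrace h.matD 1 (at₂ 2 R.1 0 (by norm_num)) = (1 : ℂ) • 1 := by
  apply ext_cons
  intro a z b w
  have h1 : ∑ c, traceMiddle (at₂ 3 R.1 0 (by norm_num) * at₂ 3 h.psi 1 (by norm_num))
      (a, c) (b, c) = ∑ c, flipOp (a, c) (b, c) := by
    have h0 : traceMiddle (at₂ 3 R.1 0 (by norm_num) * at₂ 3 h.psi 1 (by norm_num)) = flipOp :=
      (Classical.choose_spec h).1
    simp only [h0]
  simp only [traceMiddle_mul_apply] at h1
  have h2 : ∀ (x : ι) (f : ι) (z : Fin 0 → ι), (Fin.snoc (Fin.cons x z : Fin 1 → ι) f : Fin 2 → ι) =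
      Fin.cons x (Fin.cons f z) := fun x f z => by
    ext i; fin_cases i <;> rfl
  simp only [lastTrace_apply, h2, at₂_zero_apply, SkewInvertible.matD, Matrix.of_apply]
  rw [Subsingleton.elim w z]
  simp only [if_true, Finset.sum_mul, one_smul, Matrix.one_apply, cons_eq_cons, and_true]
  have h3 : ∑ c, (flipOp : Matrix (ι × ι) (ι × ι) ℂ) (a, c) (b, c) = if a = b then 1 else 0 := by
    simp only [flipOp, Matrix.of_apply]
    by_cases hab : a = b
    · subst hab
      rw [if_pos rfl, Finset.sum_eq_single a] <;> simp +contextual [eq_comm]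
    · rw [if_neg hab]
      exact Finset.sum_eq_zero fun c _ => if_neg fun hc => hab (hc.1.trans hc.2)
  rw [← h3, ← h1, Finset.sum_comm]
  rw [Finset.sum_comm_cycle]
  refine Finset.sum_congr rfl fun _ _ => Finset.sum_congr rfl fun _ _ => Finset.sum_congr rfl ?_
  intros; ring

open scoped Kronecker in
theorem at₁_zero_eq_at₂ {n : ℕ} (w : Matrix ι ι ℂ) :
    at₁ (n + 2) w 0 = at₂ (n + 2) (w ⊗ₖ (1 : Matrix ι ι ℂ)) 0 (by omega) := by
  apply ext_cons₂
  intro a b z a' b' z'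
  rw [at₁_zero_apply, at₂_zero_apply]
  by_cases hz : z = z' <;> by_cases hb : b = b' <;>
    simp [hz, hb]

theorem at₂_zero_mul_idTens_apply {n : ℕ} (X : Matrix (ι × ι) (ι × ι) ℂ)
    (Y : Matrix (Fin n → ι) (Fin n → ι) ℂ) (a b a' b' : ι) (z w : Fin n → ι) :
    (at₂ (n + 2) X 0 (by omega) * idTens (n + 1) (idTens n Y)) (Fin.cons a (Fin.cons b z))
      (Fin.cons a' (Fin.cons b' w)) = X (a, b) (a', b') * Y z w := by
  simp [Matrix.mul_apply, sum_cons, at₂_zero_apply]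

theorem at₁_zero_mul_idTens_apply {n : ℕ} (X : Matrix ι ι ℂ)
    (Y : Matrix (Fin n → ι) (Fin n → ι) ℂ) (a b : ι) (z w : Fin n → ι) :
    (at₁ (n + 1) X 0 * idTens n Y) (Fin.cons a z) (Fin.cons b w) = X a b * Y z w := by
  simp [Matrix.mul_apply, sum_cons, at₁_zero_apply]

namespace IsBMWType

variable {q μ : ℂ} {R : GL (ι × ι) ℂ}

theorem exists_kappa_ne (h : IsBMWType q μ R) :
    ∃ a b a' b', kappaOf q μ R.1 (a, b) (a', b') ≠ 0 := by
  by_contra! h0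
  exact h.K_ne_zero (by ext ⟨a, b⟩ ⟨a', b'⟩; exact h0 a b a' b')

theorem kappa_braid (h : IsBMWType q μ R) (e : 0 + 1 < 3) (e' : 1 + 1 < 3) :
    at₂ 3 (kappaOf q μ R.1) 0 e * at₂ 3 (kappaOf q μ R.1) 1 e' * at₂ 3 (kappaOf q μ R.1) 0 e =
      at₂ 3 (kappaOf q μ R.1) 0 e ∧
    at₂ 3 (kappaOf q μ R.1) 1 e' * at₂ 3 (kappaOf q μ R.1) 0 e * at₂ 3 (kappaOf q μ R.1) 1 e' =
      at₂ 3 (kappaOf q μ R.1) 1 e' := by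
  have h1 := (h.family 3).k_k_k 0 (by omega) 1 (by omega) (Or.inl rfl)
  have h2 := (h.family 3).k_k_k 1 (by omega) 0 (by omega) (Or.inr rfl)
  rw [seqAt_of_lt _ e, seqAt_of_lt _ e'] at h1 h2
  exact ⟨h1, h2⟩

/-- The form `K` is nondegenerate in its second argument. -/
theorem eq_zero_of_kappa_mul_idTens (h : IsBMWType q μ R) {Y : Matrix (Fin 1 → ι) (Fin 1 → ι) ℂ}
    (hY : at₂ 2 (kappaOf q μ R.1) 0 (by norm_num) * idTens 1 Y = 0) : Y = 0 := by
  set K := kappaOf q μ R.1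
  have h1 : at₂ 3 K 1 (by norm_num) * idTens 2 (idTens 1 Y) = 0 := by
    rw [at₂_succ, ← map_mul, hY, map_zero]
  -- `K_1 Y_3 = K_1 K_2 K_1 Y_3 = K_1 (K_2 Y_3) K_1 = 0`. As `K_1` and `Y_3` act in disjoint factors
  -- and `K ≠ 0`, the matrix entries give `Y = 0`.
  have h2 : at₂ 3 K 0 (by norm_num) * idTens 2 (idTens 1 Y) = 0 := by
    rw [← (h.kappa_braid (by norm_num) (by norm_num)).1, mul_assoc, (commute_at₂_zero_idTens K Y _).eq,
      ← mul_assoc, mul_assoc (at₂ 3 K 0 _), h1, mul_zero, zero_mul]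
  obtain ⟨a, b, a', b', hK⟩ := h.exists_kappa_ne
  ext z w
  have h3 := congrFun (congrFun h2 (Fin.cons a (Fin.cons b z))) (Fin.cons a' (Fin.cons b' w))
  rw [at₂_zero_mul_idTens_apply] at h3
  exact (mul_eq_zero.1 h3).resolve_left hK

open scoped Kronecker in
/-- The form `K` is nondegenerate in its first argument. -/
theorem eq_zero_of_kappa_mul_kronecker (h : IsBMWType q μ R) {w : Matrix ι ι ℂ}
    (hw : kappaOf q μ R.1 * (w ⊗ₖ (1 : Matrix ι ι ℂ)) = 0) : w = 0 := by
  set K := kappaOf q μ R.1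
  have h1 : at₂ 3 K 0 (by norm_num) * at₁ 3 w 0 = 0 := by
    rw [at₁_zero_eq_at₂, ← at₂_mul, hw, ← at₂Hom_apply, map_zero]
  have h2 : at₁ 3 w 0 * at₂ 3 K 1 (by norm_num) = 0 := by
    have hc : Commute (at₁ 3 w 0) (at₂ 3 K 1 (by norm_num)) := by
      rw [at₂_succ]
      exact commute_at₁_zero_idTens w _
    rw [hc.eq, ← (h.kappa_braid (by norm_num) (by norm_num)).2, mul_assoc, ← hc.eq, ← mul_assoc,
      mul_assoc (at₂ 3 K 1 _), h1, mul_zero, zero_mul]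
  obtain ⟨a, b, a', b', hK⟩ := h.exists_kappa_ne
  ext x y
  rw [at₂_succ] at h2
  have h3 := congrFun (congrFun h2 (Fin.cons x (Fin.cons a (Fin.cons b Fin.elim0))))
    (Fin.cons y (Fin.cons a' (Fin.cons b' Fin.elim0)))
  rw [at₁_zero_mul_idTens_apply, at₂_zero_apply] at h3
  exact (mul_eq_zero.1 h3).resolve_right (by simpa using hK)

/-- Let `X` be the weighted trace of `K`. Tracing `K_1 R_2 = K_1 K_2 R_1⁻¹` over the last factor
gives `K_1 = K_1 X_2 R_1⁻¹`, so `K_1 X_2 = K_1 R_1 = μ K_1`, and `K` is nondegenerate. -/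
theorem lastTrace_kappa (h : IsBMWType q μ R) {D : Matrix ι ι ℂ}
    (hD : lastTrace D 1 (at₂ 2 R.1 0 (by norm_num)) = (1 : ℂ) • 1) :
    lastTrace D 1 (at₂ 2 (kappaOf q μ R.1) 0 (by norm_num)) = μ • 1 := by
  set K := kappaOf q μ R.1 with hK
  have h1 := (h.family 3).k_s_adj 0 (by omega) 1 (by omega) (Or.inl rfl)
  have h2 := (h.family 2).k_s 0 (by omega)
  have h3 := (h.family 2).t_s 0 (by omega)
  rw [seqAt_of_lt _ (by norm_num), seqAt_of_lt _ (by norm_num)] at h2 h3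
  rw [seqAt_of_lt _ (by norm_num), seqAt_of_lt _ (by norm_num), seqAt_of_lt _ (by norm_num),
    seqAt_of_lt _ (by norm_num), ← tensId_at₂ _ (by norm_num : 0 + 1 < 2),
    ← tensId_at₂ _ (by norm_num : 0 + 1 < 2)] at h1
  have h4 := congrArg (lastTrace D 2) h1
  rw [lastTrace_tensId_mul, lastTrace_mul_tensId, lastTrace_tensId_mul, lastTrace_at₂ hD 1,
    at₂_succ, lastTrace_idTens, one_smul, mul_one] at h4
  have h5 := congrArg (· * at₂ 2 R.1 0 (by norm_num)) h4
  simp only [mul_assoc, h3, mul_one] at h5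
  rw [h2] at h5
  rw [← sub_eq_zero]
  apply h.eq_zero_of_kappa_mul_idTens
  rw [map_sub, mul_sub, ← h5, map_smul, map_one, mul_smul_comm, mul_one, sub_self]

/-- Trace `K_1 K_2 K_1 = K_1` over the last factor and compare a nonzero entry of `K`. -/
theorem trace_eq (h : IsBMWType q μ R) {D : Matrix ι ι ℂ}
    (hD : lastTrace D 1 (at₂ 2 R.1 0 (by norm_num)) = (1 : ℂ) • 1) : D.trace = μ * eta q μ := by
  set K := kappaOf q μ R.1 with hK
  have h1 := (h.kappa_braid (by norm_num) (by norm_num)).1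
  have h2 := (h.family 2).k_k 0 (by omega)
  rw [seqAt_of_lt _ (by norm_num)] at h2
  rw [← tensId_at₂ _ (by norm_num : 0 + 1 < 2)] at h1
  have h4 := congrArg (lastTrace D 2) h1
  have h5 : lastTrace D 2 (tensId 2 (at₂ 2 K 0 (by norm_num))) =
      D.trace • at₂ 2 K 0 (by norm_num) := by
    rw [← mul_one (tensId 2 _), lastTrace_tensId_mul, lastTrace_one, mul_smul_comm, mul_one]
  rw [lastTrace_mul_tensId, lastTrace_tensId_mul, lastTrace_at₂ (h.lastTrace_kappa hD) 1, h5,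
    mul_smul_comm, mul_one, smul_mul_assoc, h2, smul_smul] at h4
  obtain ⟨a, b, a', b', hK⟩ := h.exists_kappa_ne
  have h6 := congrFun (congrFun h4 (Fin.cons a (Fin.cons b Fin.elim0)))
    (Fin.cons a' (Fin.cons b' Fin.elim0))
  rw [Matrix.smul_apply, Matrix.smul_apply, at₂_zero_apply, if_pos rfl, smul_eq_mul,
    smul_eq_mul] at h6
  exact (mul_right_cancel₀ hK h6).symm

theorem alt_mul_alt (h : IsBMWType q μ R) {n : ℕ} (hn : 1 ≤ n) (hr : Regular q μ n) :
    alt q μ R.1 n * alt q μ R.1 n = alt q μ R.1 n :=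
  (h.family n).asym_mul_asym (by omega) le_rfl hr

/-- The left side is the trace of a baxterized element over its last factor. The factored right side
isolates the fraction that telescopes. -/
theorem bax_trace_scalar {q μ : ℂ} (hq : q ≠ 0) (hμ : μ ≠ 0) (hν : q - q⁻¹ ≠ 0) {z : ℂ}
    (hz : μ + q * z ≠ 0) :
    μ * eta q μ + (z - 1) / (q - q⁻¹) + μ * (z - 1) / (μ + q * z) * μ =
      (q ^ 2 * z - μ ^ 2) / (q - q⁻¹) * ((μ + q⁻¹ * z) / (μ + q * z)) := by
  rw [eta]
  have h1 : q * (q - q⁻¹) = q ^ 2 - 1 := by field_simp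
  have h2 : q ^ 2 - 1 ≠ 0 := by rw [← h1]; exact mul_ne_zero hq hν
  generalize hX : μ + q * z = X at hz ⊢
  field_simp
  subst hX
  ring

theorem trace_alt_succ (h : IsBMWType q μ R) {D : Matrix ι ι ℂ}
    (hD : lastTrace D 1 (at₂ 2 R.1 0 (by norm_num)) = (1 : ℂ) • 1) {n : ℕ}
    (hr : Regular q μ (n + 2)) :
    (tensorPow (n + 2) D * alt q μ R.1 (n + 2)).trace =
      q ^ (n + 1) / qNum q (n + 2) *
        ((q ^ 2 * (q ^ (2 * (n + 1)))⁻¹ - μ ^ 2) / (q - q⁻¹) *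
          ((μ + q⁻¹ * (q ^ (2 * (n + 1)))⁻¹) / (μ + q * (q ^ (2 * (n + 1)))⁻¹))) *
        (tensorPow (n + 1) D * alt q μ R.1 (n + 1)).trace := by
  rw [trace_tensorPow_succ_mul, alt, asym, ← tensId_alt, map_smul, lastTrace_mul_tensId,
    lastTrace_tensId_mul]
  have h1 : lastTrace D (n + 1) (bax q μ (seqAt (n + 2) R.1 n)
      (seqAt (n + 2) (kappaOf q μ R.1) n) (q ^ (2 * (n + 1)))⁻¹) =
      ((q ^ 2 * (q ^ (2 * (n + 1)))⁻¹ - μ ^ 2) / (q - q⁻¹) *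
          ((μ + q⁻¹ * (q ^ (2 * (n + 1)))⁻¹) / (μ + q * (q ^ (2 * (n + 1)))⁻¹))) •
        (1 : Matrix _ _ ℂ) := by
    rw [← bax_trace_scalar h.q_ne_zero h.mu_ne_zero h.nu_ne_zero
      (hr.mu_ne (n + 1) (by omega) (by omega)), bax, map_add, map_add, map_smul, map_smul,
      seqAt_of_lt _ (by omega), seqAt_of_lt _ (by omega), lastTrace_at₂ hD,
      lastTrace_at₂ (h.lastTrace_kappa hD), lastTrace_one, h.trace_eq hD]
    module
  rw [h1, mul_smul_comm (_ * _) (alt q μ R.1 (n + 1)), mul_one, smul_mul_assoc, h.alt_mul_alt (by omega) (hr.mono (by omega)),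
    mul_smul_comm, mul_smul_comm, smul_smul, Matrix.trace_smul, smul_eq_mul]

theorem trace_alt (h : IsBMWType q μ R) {D : Matrix ι ι ℂ}
    (hD : lastTrace D 1 (at₂ 2 R.1 0 (by norm_num)) = (1 : ℂ) • 1) (hμq : μ + q ≠ 0) (n : ℕ)
    (hr : Regular q μ (n + 1)) :
    (tensorPow (n + 1) D * alt q μ R.1 (n + 1)).trace =
      (∏ i ∈ Finset.range (n + 1),
        q ^ i / qNum q (i + 1) * ((q ^ 2 * (q ^ (2 * i))⁻¹ - μ ^ 2) / (q - q⁻¹))) *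
      ((μ + q * (q ^ (2 * (n + 1)))⁻¹) / (μ + q)) := by
  have hq := h.q_ne_zero
  have hν := h.nu_ne_zero
  -- The numerator of each fraction is the denominator of the next one.
  have e : ∀ i : ℕ, q⁻¹ * (q ^ (2 * i))⁻¹ = q * (q ^ (2 * (i + 1)))⁻¹ := by
    intro i; field_simp; ring
  induction n with
  | zero =>
    have h1 := h.trace_eq hD
    have h2 := bax_trace_scalar hq h.mu_ne_zero hν (z := 1) (by rwa [mul_one])
    have h3 : qNum q 1 = 1 := by rw [qNum, pow_one, div_self hν]
    rw [trace_tensorPow_succ_mul]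
    simp only [alt, asym, lastTrace_one, h1, mul_smul_comm, mul_one, Matrix.trace_smul, zero_add,
      Finset.prod_range_one, h3, pow_zero, mul_zero, inv_one, smul_eq_mul]
    have h4 : (tensorPow 0 D).trace = 1 := by simp [Matrix.trace, tensorPow]
    rw [h4, ← e 0]
    simp only [sub_self, zero_div, mul_zero, add_zero, zero_mul, mul_one] at h2
    rw [mul_one, h2]
    simp
  | succ n ih =>
    have h1 := hr.mu_ne (n + 1) (by omega) (by omega)
    rw [h.trace_alt_succ hD hr, ih (hr.mono (by omega)), Finset.prod_range_succ _ (n + 1), e]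
    generalize μ + q * (q ^ (2 * (n + 1)))⁻¹ = X at h1 ⊢
    field_simp

end IsBMWType

/-- The quantum trace of the antisymmetrizer for `μ = q^{1 - k}`. -/
theorem IsBMWType.trace_alt_top {q μ : ℂ} {R : GL (ι × ι) ℂ} {k : ℕ} (h : IsBMWType q μ R)
    {D : Matrix ι ι ℂ} (hD : lastTrace D 1 (at₂ 2 R.1 0 (by norm_num)) = (1 : ℂ) • 1) (hk : 1 ≤ k)
    (hμ : μ = q / q ^ k) (hμq : μ + q ≠ 0) (hr : Regular q μ k) :
    (tensorPow k D * alt q μ R.1 k).trace =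
      (q ^ 2 / q ^ k) ^ k * ((μ + q * (q ^ (2 * k))⁻¹) / (μ + q)) := by
  obtain ⟨n, rfl⟩ : ∃ n, k = n + 1 := ⟨k - 1, by omega⟩
  have hq := h.q_ne_zero
  have hν := h.nu_ne_zero
  rw [h.trace_alt hD hμq n hr]
  congr 1
  -- For this `μ` the factor is `q^{2-k} (k-i)_q / (i+1)_q`; in the product the `q`-numbers cancel
  -- after reversing the order in the numerator.
  have h1 : ∀ i ∈ Finset.range (n + 1),
      q ^ i / qNum q (i + 1) * ((q ^ 2 * (q ^ (2 * i))⁻¹ - μ ^ 2) / (q - q⁻¹)) =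
        q ^ 2 / q ^ (n + 1) * (qNum q (n + 1 - 1 - i + 1) / qNum q (i + 1)) := by
    intro i hi
    rw [Finset.mem_range] at hi
    obtain ⟨j, rfl⟩ : ∃ j, n = i + j := ⟨n - i, by omega⟩
    have h2 := hr.qNum_ne (i + 1) (by omega) (by omega)
    rw [show i + j + 1 - 1 - i + 1 = j + 1 by omega, div_mul_eq_mul_div, mul_div_assoc']
    rw [mul_div_assoc']
    congr 1
    rw [qNum, hμ, mul_div_assoc']
    congr 1
    field_simp
    ring
  rw [Finset.prod_congr rfl h1, Finset.prod_mul_distrib, Finset.prod_const, Finset.card_range,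
    Finset.prod_div_distrib, Finset.prod_range_reflect (fun i => qNum q (i + 1)) (n + 1), div_self,
    mul_one]
  exact Finset.prod_ne_zero_iff.2 fun i hi => hr.qNum_ne _ (by omega)
    (by rw [Finset.mem_range] at hi; omega)

end SkewTraces

end

end QMat

namespace QMat

open Matrix

noncomputable section

/-! ### Products of antisymmetrizers on overlapping sets of strands. -/

namespace BMWFamily

variable {B : Type} [Ring B] [Algebra ℂ B] {q μ : ℂ} {m : ℕ} {s t κ : ℕ → B}

/-- In the mirrored recursion for the middle factor the outer antisymmetrizers are absorbed by `a`,
so only a baxterized first generator remains. -/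
theorem alt_shift_mul (h : BMWFamily q μ m s t κ) {n : ℕ} (hn : n + 2 ≤ m)
    (hr : Regular q μ (n + 2)) :
    let a := asym q μ (fun i => s (i + 1)) (fun i => κ (i + 1)) (n + 2)
    a * asym q μ s κ (n + 2) * a =
      (q ^ (n + 1) / qNum q (n + 2)) • (a * bax q μ (s 0) (κ 0) (q ^ (2 * (n + 1)))⁻¹ * a) := by
  intro a
  have h' := h.shift (n := n + 1) 1 (by omega)
  have h1 := h'.asym_mul_asym (n := n + 2) (n' := n + 1) (by omega) (by omega) hr
  have h2 := h'.asym_mul_asym' (n := n + 2) (n' := n + 1) (by omega) (by omega) hr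
  rw [h.asym_eq_shift (by omega) hr, mul_smul_comm, smul_mul_assoc, ← mul_assoc, ← mul_assoc, h1,
    mul_assoc, h2]

/-- In the mirrored recursion the outer factors commute with `κ 0`, which leaves `κ 0 * bax * κ 0`
in the middle; that is a multiple of `κ 0`. -/
theorem kappa_asym_kappa (h : BMWFamily q μ m s t κ) {n : ℕ} (hn : n + 2 ≤ m)
    (hr : Regular q μ (n + 2)) :
    let z := (q ^ (2 * (n + 1)))⁻¹
    κ 0 * asym q μ (fun i => s (i + 1)) (fun i => κ (i + 1)) (n + 2) * κ 0 =
      (q ^ (n + 1) / qNum q (n + 2) *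
        (eta q μ + (z - 1) / (q - q⁻¹) * μ⁻¹ + μ * (z - 1) / (μ + q * z))) •
      (κ 0 * asym q μ (fun i => s (i + 1 + 1)) (fun i => κ (i + 1 + 1)) (n + 1)) := by
  intro z
  have h' := h.shift (n := n + 1) 1 (by omega)
  have hc : Commute (κ 0) (asym q μ (fun i => s (i + 1 + 1)) (fun i => κ (i + 1 + 1)) (n + 1)) :=
    commute_asym _ (fun i hi => (h.commute_s_k (by omega) (by omega) (by omega)).symm)
      fun i hi => h.commute_k_k (by omega) (by omega) (by omega)
  have h1 : κ 0 * bax q μ (s 1) (κ 1) z * κ 0 =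
      (eta q μ + (z - 1) / (q - q⁻¹) * μ⁻¹ + μ * (z - 1) / (μ + q * z)) • κ 0 := by
    simp only [bax, mul_add, add_mul, mul_one, mul_smul_comm, smul_mul_assoc,
      h.k_k 0 (by omega), h.k_s_k (i := 0) (j := 1) (by omega) (by omega) (Or.inl rfl),
      h.k_k_k 0 (by omega) 1 (by omega) (Or.inl rfl)]
    module
  have h2 : asym q μ (fun i => s (i + 1 + 1)) (fun i => κ (i + 1 + 1)) (n + 1) *
      asym q μ (fun i => s (i + 1 + 1)) (fun i => κ (i + 1 + 1)) (n + 1) =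
      asym q μ (fun i => s (i + 1 + 1)) (fun i => κ (i + 1 + 1)) (n + 1) :=
    (h'.shift (n := n) 1 (by omega)).asym_mul_asym (by omega) le_rfl (hr.mono (by omega))
  rw [h'.asym_eq_shift (by omega) hr, mul_smul_comm, smul_mul_assoc, mul_smul]
  congr 1
  generalize asym q μ (fun i => s (i + 1 + 1)) (fun i => κ (i + 1 + 1)) (n + 1) = a at hc h2 ⊢
  change κ 0 * (a * bax q μ (s 1) (κ 1) z * a) * κ 0 = _
  calc κ 0 * (a * bax q μ (s 1) (κ 1) z * a) * κ 0
      = κ 0 * a * bax q μ (s 1) (κ 1) z * (a * κ 0) := by simp only [mul_assoc]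
    _ = a * (κ 0 * bax q μ (s 1) (κ 1) z * κ 0) * a := by
        rw [← hc.eq]
        nth_rewrite 1 [hc.eq]
        simp only [mul_assoc]
    _ = _ := by rw [h1, mul_smul_comm, smul_mul_assoc, ← hc.eq, mul_assoc, h2]

theorem shift_shift_mul_shift (h : BMWFamily q μ m s t κ) {n : ℕ} (hn : n + 2 ≤ m)
    (hr : Regular q μ (n + 2)) :
    asym q μ (fun i => s (i + 1 + 1)) (fun i => κ (i + 1 + 1)) (n + 1) *
      asym q μ (fun i => s (i + 1)) (fun i => κ (i + 1)) (n + 2) =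
      asym q μ (fun i => s (i + 1)) (fun i => κ (i + 1)) (n + 2) := by
  have h' := h.shift (n := n + 1) 1 (by omega)
  exact (h'.shift (n := n) 1 (by omega)).asym_mul (n + 1) (by omega)
    (fun j _ _ => hr.qNum_ne j (by omega) (by omega))
    fun i hi => h'.s_mul_asym (by omega) hr (by omega)

end BMWFamily

/-! ### Rectangular operators attached to a vector and a covector on `V^{⊗ n}` -/

section Rectangular

set_option linter.unusedSectionVars false

variable {ι : Type} [Fintype ι] [DecidableEq ι] {n : ℕ}

/-- The map `x ↦ x ⊗ u`. -/
def colR (u : (Fin n → ι) → ℂ) : Matrix (Fin (n + 1) → ι) ι ℂ :=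
  Matrix.of fun x b => if x 0 = b then u (Fin.tail x) else 0

/-- The map `x ↦ u ⊗ x`. -/
def colL (u : (Fin n → ι) → ℂ) : Matrix (Fin (n + 1) → ι) ι ℂ :=
  Matrix.of fun x b => if x (Fin.last n) = b then u (Fin.init x) else 0

@[simp]
theorem colR_apply (u : (Fin n → ι) → ℂ) (a b : ι) (z : Fin n → ι) :
    colR u (Fin.cons a z) b = if a = b then u z else 0 := by simp [colR]

@[simp]
theorem colL_apply (u : (Fin n → ι) → ℂ) (a b : ι) (z : Fin n → ι) :
    colL u (Fin.snoc z a) b = if a = b then u z else 0 := by simp [colL]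

theorem idTens_vecMulVec (u v : (Fin n → ι) → ℂ) :
    idTens n (vecMulVec u v) = colR u * (colR v)ᵀ := by
  apply ext_cons
  intro a z b w
  by_cases h : a = b <;> simp [Matrix.mul_apply, vecMulVec_apply, h]

theorem tensId_vecMulVec (u v : (Fin n → ι) → ℂ) :
    tensId n (vecMulVec u v) = colL u * (colL v)ᵀ := by
  apply ext_snoc
  intro a z b w
  by_cases h : a = b <;> simp [Matrix.mul_apply, vecMulVec_apply, h]

theorem idTens_mul_colR (X : Matrix (Fin n → ι) (Fin n → ι) ℂ) (u : (Fin n → ι) → ℂ) :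
    idTens n X * colR u = colR (X *ᵥ u) := by
  ext x b
  obtain ⟨a, z, rfl⟩ : ∃ a z, x = Fin.cons a z := ⟨_, _, (Fin.cons_self_tail x).symm⟩
  simp [Matrix.mul_apply, sum_cons, mulVec, dotProduct]

theorem colR_transpose_mul_colR (u v : (Fin n → ι) → ℂ) :
    (colR v)ᵀ * colR u = (v ⬝ᵥ u) • 1 := by
  ext a b
  by_cases h : b = a <;>
    simp [Matrix.mul_apply, sum_cons, dotProduct, h, Ne.symm]

theorem colL_transpose_mul_colL (u v : (Fin n → ι) → ℂ) :
    (colL v)ᵀ * colL u = (v ⬝ᵥ u) • 1 := by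
  ext a b
  by_cases h : b = a <;>
    simp [Matrix.mul_apply, sum_snoc, dotProduct, h, Ne.symm]

theorem traceTail_mul_colR_transpose (Y : Matrix (Fin (n + 1) → ι) ι ℂ) (v : (Fin n → ι) → ℂ) :
    traceTail n (Y * (colR v)ᵀ) = (colR v)ᵀ * Y := by
  ext a b
  simp [traceTail, Matrix.mul_apply, sum_cons, mul_comm]

theorem traceTail_colR_mul (u : (Fin n → ι) → ℂ) (Y : Matrix ι (Fin (n + 1) → ι) ℂ) :
    traceTail n (colR u * Y) = Y * colR u := by
  ext a b
  simp [traceTail, Matrix.mul_apply, sum_cons, mul_comm]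

theorem at₁_zero_mul_colR (w : Matrix ι ι ℂ) (u : (Fin n → ι) → ℂ) :
    at₁ (n + 1) w 0 * colR u = colR u * w := by
  ext x b
  obtain ⟨a, z, rfl⟩ : ∃ a z, x = Fin.cons a z := ⟨_, _, (Fin.cons_self_tail x).symm⟩
  simp [Matrix.mul_apply, sum_cons, at₁_zero_apply, mul_comm]

/-- Contracting all legs of `u` but the first with `v` gives the matrix `(colR v)ᵀ * colL u`. Its
right invertibility says that the first leg of `u` spans `V`, so an operator touching `u` only there
is determined by its action. -/
theorem eq_zero_of_at₂_mul_colR {u v : (Fin (n + 1) → ι) → ℂ} {Z : Matrix ι ι ℂ}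
    (hZ : (colR v)ᵀ * colL u * Z = 1) {Y : Matrix (ι × ι) (ι × ι) ℂ}
    (hY : at₂ (n + 2) Y 0 (by omega) * colR u = 0) : Y = 0 := by
  let Y' : Matrix (ι × ι × ι) ι ℂ := Matrix.of fun p b => Y (p.1, p.2.1) (p.2.2, b)
  have h1 : Y' * ((colR v)ᵀ * colL u) = 0 := by
    ext ⟨a, b, d⟩ e
    have h2 : ∀ z, ∑ b', Y (a, b) (d, b') * u (Fin.cons b' z) = 0 := by
      intro z
      have := congrFun (congrFun hY (Fin.cons a (Fin.cons b z))) d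
      simpa [Matrix.mul_apply, sum_cons, at₂_zero_apply] using this
    have h3 : ∀ b', ((colR v)ᵀ * colL u) b' e =
        ∑ z : Fin n → ι, v (Fin.snoc z e) * u (Fin.cons b' z) := by
      intro b'
      rw [Matrix.mul_apply, sum_cons]
      simp [sum_snoc (n := n), Fin.cons_snoc_eq_snoc_cons]
    rw [Matrix.mul_apply]
    simp only [h3, Finset.mul_sum, Y', Matrix.of_apply, Matrix.zero_apply]
    rw [Finset.sum_comm]
    refine Finset.sum_eq_zero fun z _ => ?_
    rw [← mul_zero (v (Fin.snoc z e)), ← h2 z, Finset.mul_sum]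
    exact Finset.sum_congr rfl fun _ _ => by ring
  have h2 : Y' = 0 := by
    rw [← Matrix.mul_one Y', ← hZ, ← Matrix.mul_assoc, h1, Matrix.zero_mul]
  ext ⟨a, b⟩ ⟨a', b'⟩
  exact congrFun (congrFun h2 (a, b, a')) b'

theorem exists_eq_vecMulVec_of_rank_eq_one {κ : Type} [Fintype κ] [DecidableEq κ]
    {X : Matrix κ κ ℂ} (h : X.rank = 1) (hX : X * X = X) :
    ∃ u v : κ → ℂ, X = vecMulVec u v ∧ v ⬝ᵥ u = 1 := by
  obtain ⟨⟨u, _⟩, _, hu⟩ := finrank_eq_one_iff'.1 h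
  -- Every column of `X` is a multiple of the vector `u` spanning its range.
  choose v hv using fun j => hu ⟨X.mulVecLin (Pi.single j 1), LinearMap.mem_range_self _ _⟩
  have h1 : X = vecMulVec u v := by
    ext i j
    have := congrFun (congrArg Subtype.val (hv j)) i
    simp only [SetLike.mk_smul_mk, Pi.smul_apply, smul_eq_mul, mulVecLin_apply,
      mulVec_single_one, col_apply] at this
    rw [vecMulVec_apply, ← this, mul_comm]
  refine ⟨u, v, h1, ?_⟩
  have h2 : X ≠ 0 := by
    rintro rfl
    simp at h
  rw [h1, vecMulVec_mul_vecMulVec] at hX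
  rw [h1] at h2
  rw [vecMulVec_smul] at hX
  have h3 : (v ⬝ᵥ u - 1) • vecMulVec u v = 0 := by rw [sub_smul, one_smul, hX, sub_self]
  exact sub_eq_zero.1 ((smul_eq_zero.1 h3).resolve_right h2)

end Rectangular

/-! ### Scalars -/

section Scalars

variable {q Q : ℂ}

/-- Here and below `Q` stands for `q ^ k`, so `μ = q / Q`. This is the coefficient of
`kappa_asym_kappa` for `k = n + 2`, the eigenvalue called `f₀` later. -/
theorem scalar_kappa (hq : q ≠ 0) (hQ : Q ≠ 0) (hν : q ^ 2 - 1 ≠ 0) (h1 : Q + q ^ 2 ≠ 0)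
    (hk : Q ^ 2 - 1 ≠ 0) :
    Q / q / ((Q - Q⁻¹) / (q - q⁻¹)) * (eta q (q / Q) + (q ^ 2 / Q ^ 2 - 1) / (q - q⁻¹) * (q / Q)⁻¹ +
      q / Q * (q ^ 2 / Q ^ 2 - 1) / (q / Q + q * (q ^ 2 / Q ^ 2))) =
    q * (1 + Q⁻¹) / ((Q - Q⁻¹) / (q - q⁻¹) * (1 + q ^ 2 / Q)) := by
  have e1 : q - q⁻¹ = (q ^ 2 - 1) / q := by field_simp
  have e2 : Q - Q⁻¹ = (Q ^ 2 - 1) / Q := by field_simp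
  have e3 : q / Q + q * (q ^ 2 / Q ^ 2) = q * (Q + q ^ 2) / Q ^ 2 := by field_simp
  have e4 : 1 + q ^ 2 / Q = (Q + q ^ 2) / Q := by field_simp
  rw [eta, e1, e2, e3, e4]
  field_simp
  ring

/-- The scalar by which `R_1` acts between antisymmetrizers. -/
theorem scalar_R (hq : q ≠ 0) (hQ : Q ≠ 0) (hν : q ^ 2 - 1 ≠ 0) (h1 : Q + q ^ 2 ≠ 0)
    (hk : Q ^ 2 - 1 ≠ 0) :
    -(1 + q / Q * ((Q ^ 2)⁻¹ - 1) / (q / Q + q * (Q ^ 2)⁻¹) *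
      (q * (1 + Q⁻¹) / ((Q - Q⁻¹) / (q - q⁻¹) * (1 + q ^ 2 / Q)))) / (((Q ^ 2)⁻¹ - 1) / (q - q⁻¹)) =
    Q * (1 + Q⁻¹) / ((Q - Q⁻¹) / (q - q⁻¹) * (1 + q ^ 2 / Q)) := by
  have hk1 : Q + 1 ≠ 0 := fun h => hk (by linear_combination (Q - 1) * h)
  have hk2 : 1 - Q ^ 2 ≠ 0 := fun h => hk (by linear_combination -h)
  have e1 : q - q⁻¹ = (q ^ 2 - 1) / q := by field_simp
  have e2 : Q - Q⁻¹ = (Q ^ 2 - 1) / Q := by field_simp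
  have e3 : q / Q + q * (Q ^ 2)⁻¹ = q * (Q + 1) / Q ^ 2 := by field_simp
  have e4 : 1 + q ^ 2 / Q = (Q + q ^ 2) / Q := by field_simp
  have e5 : (Q ^ 2)⁻¹ - 1 = (1 - Q ^ 2) / Q ^ 2 := by field_simp
  rw [e1, e2, e3, e4, e5]
  field_simp
  ring

/-- The scalar by which `R_1⁻¹` acts between antisymmetrizers. -/
theorem scalar_R_inv (hq : q ≠ 0) (hQ : Q ≠ 0) (hν : q ^ 2 - 1 ≠ 0) (h1 : Q + q ^ 2 ≠ 0)
    (hk : Q ^ 2 - 1 ≠ 0) :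
    Q * (1 + Q⁻¹) / ((Q - Q⁻¹) / (q - q⁻¹) * (1 + q ^ 2 / Q)) - (q - q⁻¹) +
      (q - q⁻¹) * (q * (1 + Q⁻¹) / ((Q - Q⁻¹) / (q - q⁻¹) * (1 + q ^ 2 / Q))) =
    q ^ 2 / Q ^ 2 * (Q * (1 + Q⁻¹) / ((Q - Q⁻¹) / (q - q⁻¹) * (1 + q ^ 2 / Q))) := by
  have e1 : q - q⁻¹ = (q ^ 2 - 1) / q := by field_simp
  have e2 : Q - Q⁻¹ = (Q ^ 2 - 1) / Q := by field_simp
  have e4 : 1 + q ^ 2 / Q = (Q + q ^ 2) / Q := by field_simp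
  rw [e1, e2, e4]
  field_simp
  ring

/-- The constant term of `S T` as an affine function of `f`, visibly nonzero in the form on the
right. -/
theorem scalar_const (hq : q ≠ 0) (hQ : Q ≠ 0) (hν : q ^ 2 - 1 ≠ 0) (hk : Q ^ 2 - 1 ≠ 0) :
    Q / q / ((Q - Q⁻¹) / (q - q⁻¹)) * (1 - (q ^ 2 / Q ^ 2 - 1) / (q - q⁻¹) /
      (((Q ^ 2)⁻¹ - 1) / (q - q⁻¹))) = (((Q - Q⁻¹) / (q - q⁻¹)) ^ 2)⁻¹ := by
  have hk2 : 1 - Q ^ 2 ≠ 0 := fun h => hk (by linear_combination -h)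
  have e1 : q - q⁻¹ = (q ^ 2 - 1) / q := by field_simp
  have e2 : Q - Q⁻¹ = (Q ^ 2 - 1) / Q := by field_simp
  have e5 : (Q ^ 2)⁻¹ - 1 = (1 - Q ^ 2) / Q ^ 2 := by field_simp
  rw [e1, e2, e5]
  field_simp
  ring

/-- The value of the same affine function at `f₀`; this is where the normalization `normO` of `O`
comes from. -/
theorem scalar_product (hq : q ≠ 0) (hQ : Q ≠ 0) (hν : q ^ 2 - 1 ≠ 0) (h1 : Q + q ^ 2 ≠ 0)
    (hk : Q ^ 2 - 1 ≠ 0) :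
    (((Q - Q⁻¹) / (q - q⁻¹)) ^ 2)⁻¹ + Q / q / ((Q - Q⁻¹) / (q - q⁻¹)) *
      (q / Q * (q ^ 2 / Q ^ 2 - 1) / (q / Q + q * (q ^ 2 / Q ^ 2)) -
        (q ^ 2 / Q ^ 2 - 1) / (q - q⁻¹) / (((Q ^ 2)⁻¹ - 1) / (q - q⁻¹)) *
          (q / Q * ((Q ^ 2)⁻¹ - 1) / (q / Q + q * (Q ^ 2)⁻¹))) *
      (q * (1 + Q⁻¹) / ((Q - Q⁻¹) / (q - q⁻¹) * (1 + q ^ 2 / Q))) =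
    ((((Q - Q⁻¹) / (q - q⁻¹)) * (1 + q ^ 2 / Q) / (q + q / Q)) ^ 2)⁻¹ := by
  have hk1 : Q + 1 ≠ 0 := fun h => hk (by linear_combination (Q - 1) * h)
  have hk2 : 1 - Q ^ 2 ≠ 0 := fun h => hk (by linear_combination -h)
  have e1 : q - q⁻¹ = (q ^ 2 - 1) / q := by field_simp
  have e2 : Q - Q⁻¹ = (Q ^ 2 - 1) / Q := by field_simp
  have e3 : q / Q + q * (Q ^ 2)⁻¹ = q * (Q + 1) / Q ^ 2 := by field_simp
  have e4 : 1 + q ^ 2 / Q = (Q + q ^ 2) / Q := by field_simp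
  have e5 : (Q ^ 2)⁻¹ - 1 = (1 - Q ^ 2) / Q ^ 2 := by field_simp
  have e6 : q / Q + q * (q ^ 2 / Q ^ 2) = q * (Q + q ^ 2) / Q ^ 2 := by field_simp
  have e7 : q + q / Q = q * (Q + 1) / Q := by field_simp
  rw [e1, e2, e3, e4, e5, e6, e7]
  field_simp
  ring

end Scalars

end

end QMat

namespace QMat

open Matrix

noncomputable section

/-! ### The scalars attached to the top antisymmetrizer. -/

section Orthogonal

variable {ι : Type} [Fintype ι] [DecidableEq ι] {k : ℕ} {q : ℂ} {R : GL (ι × ι) ℂ}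

theorem zpow_one_sub (hq : q ≠ 0) (k : ℕ) : q ^ (1 - (k : ℤ)) = q / q ^ k := by
  rw [zpow_sub₀ hq, zpow_one, zpow_natCast]

theorem normO_eq (hq : q ≠ 0) (k : ℕ) :
    normO k q = qNum q k * (1 + q ^ 2 / q ^ k) / (q + q / q ^ k) := by
  rw [normO, zpow_one_sub hq, zpow_sub₀ hq, zpow_natCast]
  norm_cast

/-- An invertibility criterion for polynomials in an operator with `f² = c f`. -/
theorem exists_mul_eq_one_of_sq {f : Matrix ι ι ℂ} {α β c : ℂ} (hf : f * f = c • f) (hα : α ≠ 0)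
    (hβ : α + β * c ≠ 0) : ∃ Z, (α • (1 : Matrix ι ι ℂ) + β • f) * Z = 1 := by
  refine ⟨α⁻¹ • 1 - (β / (α * (α + β * c))) • f, ?_⟩
  simp only [add_mul, mul_sub, smul_mul_assoc, mul_smul_comm, mul_one, one_mul, hf, smul_smul]
  match_scalars <;> field_simp
  ring

namespace IsHeight

variable {μ : ℂ}

theorem regular (h : IsHeight k q μ R) : Regular q μ k where
  qNum_ne j h1 h2 := by
    have hq := h.bmw.q_ne_zero
    intro h0
    rw [qNum, div_eq_zero_iff, or_iff_left h.bmw.nu_ne_zero, sub_eq_zero] at h0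
    refine h.q_pow_ne j h1 h2 ?_
    rw [two_mul, pow_add]
    nth_rewrite 2 [h0]
    exact mul_inv_cancel₀ (pow_ne_zero _ hq)
  mu_ne i h1 h2 := by
    have hq := h.bmw.q_ne_zero
    intro h0
    apply h.mu_ne i h1 h2.le
    rw [zpow_sub₀ hq, zpow_one]
    norm_cast
    rw [div_eq_mul_inv]
    linear_combination h0

theorem vanish_bax (h : IsHeight k q μ R) :
    idTens k (alt q μ R.1 k) * bax q μ (seqAt (k + 1) R.1 0) (seqAt (k + 1) (kappaOf q μ R.1) 0)
      (q ^ (2 * k))⁻¹ * idTens k (alt q μ R.1 k) = 0 := by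
  have h1 := h.vanish
  have h2 := h.two_le
  have h3 := h.bmw.rho_s (k + 1) ⟨0, by omega⟩
  have h4 := h.bmw.rho_k (k + 1) ⟨0, by omega⟩
  rw [map_mul, map_mul, h.bmw.rho_antisymUp] at h1
  simp only [BMW.baxMinus, BMW.σ, BMW.κ, map_add, map_smul, map_one] at h1
  rw [h3, h4] at h1
  exact h1

/-- All three operators are affine functions of `f = (colR v)ᵀ * K * colR u`. The main point is that
`f` is scalar, which follows from nondegeneracy of both `u` and `K`. -/
theorem scalars (h : IsHeight k q μ R) (hμ : μ = q / q ^ k) {u v : (Fin k → ι) → ℂ}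
    (huv : alt q μ R.1 k = vecMulVec u v) (hvu : v ⬝ᵥ u = 1) :
    ((colR v)ᵀ * colL u) * ((colL v)ᵀ * colR u) = ((normO k q) ^ 2)⁻¹ • (1 : Matrix ι ι ℂ) ∧
    (colR v)ᵀ * seqAt (k + 1) R.1 0 * colR u =
      (q ^ k * (1 + (q ^ k)⁻¹) / (qNum q k * (1 + q ^ 2 / q ^ k))) • (1 : Matrix ι ι ℂ) ∧
    (colR v)ᵀ * seqAt (k + 1) (R⁻¹).1 0 * colR u =
      (q ^ 2 / (q ^ k) ^ 2 *
        (q ^ k * (1 + (q ^ k)⁻¹) / (qNum q k * (1 + q ^ 2 / q ^ k)))) • (1 : Matrix ι ι ℂ) := by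
  have hb := h.bmw
  have hr := h.regular
  have h2 := h.two_le
  have hq := hb.q_ne_zero
  have hvan := h.vanish_bax
  have hnorm := normO_eq hq k
  have hfam := hb.family (k + 1)
  have hq2 : q ^ 2 - 1 ≠ 0 := fun h0 => h.q_pow_ne 1 le_rfl (by omega)
    (by linear_combination h0)
  have hQ2 : (q ^ k) ^ 2 - 1 ≠ 0 := fun h0 => h.q_pow_ne k (by omega) le_rfl
    (by rw [mul_comm, pow_mul]; linear_combination h0)
  have hQ : q ^ k ≠ 0 := pow_ne_zero _ hq
  have hQ1 : q ^ k + 1 ≠ 0 := fun h => hQ2 (by linear_combination (q ^ k - 1) * h)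
  have hQq : q ^ k + q ^ 2 ≠ 0 := by
    intro h0
    apply hr.mu_ne 1 le_rfl (by omega)
    rw [hμ]
    field_simp
    linear_combination q * h0
  obtain ⟨n, rfl⟩ : ∃ n, k = n + 2 := ⟨k - 2, by omega⟩
  have hq1 : q ^ (n + 1) = q ^ (n + 2) / q := by rw [eq_div_iff hq, ← pow_succ]
  have hz : (q ^ (2 * (n + 1)))⁻¹ = q ^ 2 / (q ^ (n + 2)) ^ 2 := by field_simp; ring
  have hz' : (q ^ (2 * (n + 2)))⁻¹ = ((q ^ (n + 2)) ^ 2)⁻¹ := by rw [mul_comm, pow_mul]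
  have hqn : qNum q (n + 2) = (q ^ (n + 2) - (q ^ (n + 2))⁻¹) / (q - q⁻¹) := rfl
  have hkq : qNum q (n + 2) ≠ 0 := hr.qNum_ne _ (by omega) le_rfl
  have hf0 := scalar_kappa hq hQ hq2 hQq hQ2
  have hρ := scalar_R hq hQ hq2 hQq hQ2
  have hρ' := scalar_R_inv hq hQ hq2 hQq hQ2
  have hα := scalar_const hq hQ hq2 hQ2
  have hβ := scalar_product hq hQ hq2 hQq hQ2
  rw [← hqn] at hf0 hρ hρ' hα hβ
  rw [← hnorm, ← hα] at hβ
  have key1 := hfam.alt_shift_mul (n := n) (by omega) hr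
  have key2 := hfam.kappa_asym_kappa (n := n) (by omega) hr
  have key3 := hfam.shift_shift_mul_shift (n := n) (by omega) hr
  simp only [← idTens_alt, ← tensId_alt] at key1 key2 key3
  have ht := hfam.t_eq (i := 0) (by omega)
  have hK0 : seqAt (n + 3) (kappaOf q μ R.1) 0 =
      at₂ (n + 3) (kappaOf q μ R.1) 0 (by omega) := seqAt_of_lt _ _
  rw [huv, idTens_vecMulVec] at key1 key2 key3 hvan
  rw [tensId_vecMulVec] at key1
  rw [hq1, hz] at key1 key2
  rw [hz'] at hvan
  generalize asym q μ (fun i => seqAt (n + 2 + 1) R.1 (i + 1 + 1))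
    (fun i => seqAt (n + 2 + 1) (kappaOf q μ R.1) (i + 1 + 1)) (n + 1) = A₂ at key2 key3
  rw [hK0] at key1 key2 hvan ht
  obtain ⟨K, hK⟩ : ∃ K, K = at₂ (n + 3) (kappaOf q μ R.1) 0 (by omega) := ⟨_, rfl⟩
  rw [← hK] at key1 key2 hvan ht
  simp only [bax, hμ] at key1 hvan key2
  rw [hf0] at key2
  have hWU : (colR v)ᵀ * colR u = 1 := by rw [colR_transpose_mul_colR, hvu, one_smul]
  have hWU' : ∀ X : Matrix ι (Fin (n + 2 + 1) → ι) ℂ, (colR v)ᵀ * (colR u * X) = X := fun X => by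
    rw [← Matrix.mul_assoc, hWU, Matrix.one_mul]
  generalize seqAt (n + 2 + 1) R.1 0 = S at *
  generalize seqAt (n + 2 + 1) (R⁻¹).1 0 = S' at *
  have s1 := congrArg (fun X => (colR v)ᵀ * X * colR u) key1
  simp only [Matrix.mul_assoc, Matrix.mul_smul, Matrix.smul_mul, Matrix.mul_add, Matrix.add_mul,
    hWU, hWU', Matrix.mul_one] at s1
  have s2 := congrArg (fun X => (colR v)ᵀ * X * colR u) hvan
  simp only [Matrix.mul_assoc, Matrix.mul_smul, Matrix.smul_mul, Matrix.mul_add, Matrix.add_mul,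
    hWU, hWU', Matrix.mul_one, Matrix.mul_zero, Matrix.zero_mul] at s2
  have s3 := congrArg (· * colR u) key2
  have s4 := congrArg (· * colR u) key3
  simp only [Matrix.mul_assoc, Matrix.smul_mul, hWU, Matrix.mul_one] at s3 s4
  rw [s4] at s3
  have s5 : (colR v)ᵀ * (S' * colR u) = (colR v)ᵀ * (S * colR u) -
      (q - q⁻¹) • (1 : Matrix ι ι ℂ) + (q - q⁻¹) • ((colR v)ᵀ * (K * colR u)) := by
    rw [ht]
    simp only [Matrix.add_mul, Matrix.sub_mul, Matrix.mul_add, Matrix.mul_sub, Matrix.smul_mul,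
      Matrix.mul_smul, Matrix.one_mul, hWU]
  have ha : (((q ^ (n + 2)) ^ 2)⁻¹ - 1) / (q - q⁻¹) ≠ 0 := by
    refine div_ne_zero (fun h0 => hQ2 ?_) hb.nu_ne_zero
    field_simp at h0
    linear_combination -h0
  have hN : ((normO (n + 2) q) ^ 2)⁻¹ ≠ 0 := by
    rw [hnorm]
    have h3 : 1 + q ^ 2 / q ^ (n + 2) ≠ 0 := by
      rwa [one_add_div hQ, div_ne_zero_iff, and_iff_left hQ]
    have h4 : q + q / q ^ (n + 2) ≠ 0 := by
      intro h0
      field_simp at h0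
      exact hQ1 ((mul_eq_zero.1 (h0.trans (mul_zero _))).resolve_left hq)
    exact inv_ne_zero (pow_ne_zero _ (div_ne_zero (mul_ne_zero hkq h3) h4))
  have hα0 := inv_ne_zero (pow_ne_zero 2 hkq)
  rw [← hα] at hα0
  simp only [Matrix.mul_assoc]
  generalize (((q ^ (n + 2)) ^ 2)⁻¹ - 1) / (q - q⁻¹) = a at *
  generalize q / q ^ (n + 2) * (((q ^ (n + 2)) ^ 2)⁻¹ - 1) /
    (q / q ^ (n + 2) + q * ((q ^ (n + 2)) ^ 2)⁻¹) = b at *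
  generalize (q ^ 2 / (q ^ (n + 2)) ^ 2 - 1) / (q - q⁻¹) = a' at *
  generalize q / q ^ (n + 2) * (q ^ 2 / (q ^ (n + 2)) ^ 2 - 1) /
    (q / q ^ (n + 2) + q * (q ^ 2 / (q ^ (n + 2)) ^ 2)) = b' at *
  generalize q ^ (n + 2) / q / qNum q (n + 2) = c at *
  generalize q * (1 + (q ^ (n + 2))⁻¹) / (qNum q (n + 2) * (1 + q ^ 2 / q ^ (n + 2))) = f₀ at *
  generalize q ^ (n + 2) * (1 + (q ^ (n + 2))⁻¹) / (qNum q (n + 2) * (1 + q ^ 2 / q ^ (n + 2))) = ρ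
    at *
  generalize hf : (colR v)ᵀ * (K * colR u) = f at *
  generalize (colR v)ᵀ * (S * colR u) = r at *
  -- The vanishing condition, compressed to `V`, reads `1 + a r + b f = 0`.
  have s6 : r = (-a⁻¹) • 1 + (-b / a) • f := by
    have : a • r = -(1 : Matrix ι ι ℂ) - b • f := by
      rw [eq_sub_iff_add_eq, eq_neg_iff_add_eq_zero, ← s2]
      abel
    rw [← inv_smul_smul₀ ha r, this]
    match_scalars <;> field_simp
  have s7 : (colR v)ᵀ * (colL u * ((colL v)ᵀ * colR u)) =
      (c * (1 - a' / a)) • 1 + (c * (b' - a' / a * b)) • f := by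
    rw [s1, s6]
    match_scalars <;> (field_simp; try ring)
  -- By `s3`, `K U f = f₀ K U`; apply `(colR v)ᵀ` on the left.
  have s8 : f * f = f₀ • f := by
    rw [← hf, Matrix.mul_assoc, Matrix.mul_assoc, hf, s3, Matrix.mul_smul, hf]
  obtain ⟨Z, hZ⟩ := exists_mul_eq_one_of_sq s8 hα0 (hβ ▸ hN)
  -- `K U (f - f₀) = 0` says that `K_1 (f - f₀)_1` kills `U`. The first leg of `u` is nondegenerate
  -- because `S T` is invertible, so `K (f - f₀)_1 = 0`; then nondegeneracy of `K` applies.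
  have s9 : f = f₀ • 1 := by
    rw [← sub_eq_zero]
    apply hb.eq_zero_of_kappa_mul_kronecker
    apply eq_zero_of_at₂_mul_colR (n := n + 1) (u := u) (v := v) (Z := (colL v)ᵀ * colR u * Z)
    · rw [← Matrix.mul_assoc, Matrix.mul_assoc _ (colL u), s7, hZ]
    · rw [at₂_mul, ← at₁_zero_eq_at₂, Matrix.mul_assoc, at₁_zero_mul_colR, ← hK, Matrix.mul_sub,
        Matrix.mul_sub, s3]
      simp
  refine ⟨?_, ?_, ?_⟩
  · rw [s7, s9, ← hβ]
    module
  · rw [s6, s9, ← hρ]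
    match_scalars
    field_simp
    ring
  · rw [s5, s6, s9, ← hρ', ← hρ]
    match_scalars
    field_simp
    ring

end IsHeight

namespace IsOrthogonalType

/-- The rank one antisymmetrizer is given by a vector and a covector. -/
theorem exists_vectors (h : IsOrthogonalType k q R) :
    ∃ u v : (Fin k → ι) → ℂ, alt q (q ^ (1 - (k : ℤ))) R.1 k = vecMulVec u v ∧ v ⬝ᵥ u = 1 := by
  have h1 := h.rank_eq_one
  rw [h.height.bmw.rho_antisym] at h1
  exact exists_eq_vecMulVec_of_rank_eq_one h1
    (h.height.bmw.alt_mul_alt (by have := h.height.two_le; omega) h.height.regular)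

end IsOrthogonalType

end Orthogonal

end

end QMat

namespace QMat

open Matrix

noncomputable section

/-! ### Products of adjacent generators in a group -/

section GroupWords

variable {G : Type} [Group G]

/-- `f 0 * f 1 * ⋯ * f (n - 1)`. -/
def upProd (f : ℕ → G) : ℕ → G
  | 0 => 1
  | n + 1 => upProd f n * f n

/-- `f (n - 1) * ⋯ * f 1 * f 0`. -/
def downProd (f : ℕ → G) : ℕ → G
  | 0 => 1
  | n + 1 => f n * downProd f n

theorem upProd_inv (f : ℕ → G) (n : ℕ) : upProd (fun i => (f i)⁻¹) n = (downProd f n)⁻¹ := by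
  induction n with
  | zero => simp [upProd, downProd]
  | succ n ih => rw [upProd, downProd, ih, _root_.mul_inv_rev]

theorem commute_upProd {f : ℕ → G} {a : G} (n : ℕ) (h : ∀ i < n, Commute (f i) a) :
    Commute (upProd f n) a := by
  induction n with
  | zero => exact Commute.one_left a
  | succ n ih => exact (ih fun i hi => h i (by omega)).mul_left (h n (by omega))

theorem commute_downProd {f : ℕ → G} {a : G} (n : ℕ) (h : ∀ i < n, Commute (f i) a) :
    Commute (downProd f n) a := by
  induction n with
  | zero => exact Commute.one_left a
  | succ n ih => exact (h n (by omega)).mul_left (ih fun i hi => h i (by omega))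

/-- On its way through the product, `x i` commutes with every factor except the pair `f i * f (i +
1)`, which raises its index. -/
theorem upProd_mul {f x : ℕ → G} (k : ℕ)
    (hadj : ∀ i, i + 1 < k → f i * f (i + 1) * x i = x (i + 1) * (f i * f (i + 1)))
    (hfar : ∀ i < k, ∀ j < k, (i + 1 < j ∨ j + 1 < i) → Commute (f i) (x j)) (i : ℕ)
    (hi : i + 1 < k) : upProd f k * x i = x (i + 1) * upProd f k := by
  induction k with
  | zero => omega
  | succ k ih =>
    by_cases h : i + 1 < k
    · rw [upProd, mul_assoc, (hfar k (by omega) i (by omega) (by omega)).eq, ← mul_assoc,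
        ih (fun i hi => hadj i (by omega)) (fun i hi j hj => hfar i (by omega) j (by omega)) h,
        mul_assoc]
    · obtain rfl : k = i + 1 := by omega
      have hc : Commute (upProd f i) (x (i + 1)) :=
        commute_upProd i fun j hj => hfar j (by omega) (i + 1) (by omega) (by omega)
      rw [upProd, upProd, mul_assoc, mul_assoc, ← mul_assoc (f i), hadj i hi, ← mul_assoc, hc.eq]
      simp only [mul_assoc]

/-- `C 0 = e 0 * f 0`, `C (i + 1) = f (i + 1) * C i * (f (i + 1))⁻¹`. -/
def conjSeq (e f : ℕ → G) : ℕ → G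
  | 0 => e 0 * f 0
  | i + 1 => f (i + 1) * conjSeq e f i * (f (i + 1))⁻¹

/-- This is the inductive step for ordering the product of the copies: each new copy contributes one
`e i` on the left and one `f i` on the right. -/
theorem downProd_mul_conjSeq {e f : ℕ → G} (k : ℕ)
    (he : ∀ i, i + 1 < k → f i * f (i + 1) * e i = e (i + 1) * (f i * f (i + 1)))
    (hf : ∀ i, i + 1 < k → f i * f (i + 1) * f i = f (i + 1) * (f i * f (i + 1)))
    (hfar : ∀ i < k, ∀ j < k, (i + 1 < j ∨ j + 1 < i) → Commute (f i) (f j)) (i : ℕ)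
    (hi : i < k) : downProd f i * conjSeq e f i = e i * downProd f (i + 1) := by
  induction i with
  | zero => simp [downProd, conjSeq]
  | succ i ih =>
    have hc : Commute (downProd f i) (f (i + 1)) :=
      commute_downProd i fun j hj => hfar j (by omega) (i + 1) (by omega) (by omega)
    calc downProd f (i + 1) * conjSeq e f (i + 1)
        = f i * (downProd f i * f (i + 1)) * conjSeq e f i * (f (i + 1))⁻¹ := by
          simp only [downProd, conjSeq, mul_assoc]
      _ = f i * f (i + 1) * (downProd f i * conjSeq e f i) * (f (i + 1))⁻¹ := by
          rw [hc.eq]; simp only [mul_assoc]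
      _ = (f i * f (i + 1) * e i) * f i * (downProd f i * (f (i + 1))⁻¹) := by
          rw [ih (by omega), downProd]; simp only [mul_assoc]
      _ = e (i + 1) * (f i * f (i + 1) * f i) * ((f (i + 1))⁻¹ * downProd f i) := by
          rw [he i hi, hc.inv_right.eq]; simp only [mul_assoc]
      _ = e (i + 1) * downProd f (i + 1 + 1) := by
          rw [hf i hi]; simp [downProd, mul_assoc]

theorem upProd_conjSeq {e f : ℕ → G} (k : ℕ)
    (he : ∀ i, i + 1 < k → f i * f (i + 1) * e i = e (i + 1) * (f i * f (i + 1)))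
    (hf : ∀ i, i + 1 < k → f i * f (i + 1) * f i = f (i + 1) * (f i * f (i + 1)))
    (hfar : ∀ i < k, ∀ j < k, (i + 1 < j ∨ j + 1 < i) → Commute (f i) (f j)) (n : ℕ)
    (hn : n ≤ k) : upProd (conjSeq e f) n = upProd e n * downProd f n := by
  induction n with
  | zero => simp [upProd, downProd]
  | succ n ih =>
    rw [upProd, ih (by omega), mul_assoc, downProd_mul_conjSeq k he hf hfar n (by omega), upProd,
      mul_assoc]

end GroupWords

/-! ### The operators of a compatible pair -/

section Pairs

set_option linter.unusedSectionVars false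

variable {ι : Type} [Fintype ι] [DecidableEq ι]

/-- `X ↦ X_{i, i + 1}` on invertible operators (trivial if `i + 1 < n` fails). -/
def unitAt (n i : ℕ) : GL (ι × ι) ℂ →* (Matrix (Fin n → ι) (Fin n → ι) ℂ)ˣ :=
  if h : i + 1 < n then Units.map (MonoidHomClass.toMonoidHom (at₂Hom n i h)) else 1

theorem val_unitAt {n i : ℕ} (X : GL (ι × ι) ℂ) (h : i + 1 < n) :
    (unitAt n i X).1 = at₂ n X.1 i h := by
  rw [unitAt, dif_pos h]
  rfl

theorem val_unitAt_inv {n i : ℕ} (X : GL (ι × ι) ℂ) (h : i + 1 < n) :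
    (unitAt n i X)⁻¹.1 = at₂ n (X⁻¹).1 i h := by
  rw [← map_inv, val_unitAt]

theorem commute_unitAt {n i j : ℕ} (X Y : GL (ι × ι) ℂ) (h : i + 1 < j ∨ j + 1 < i) :
    Commute (unitAt n i X) (unitAt n j Y) := by
  by_cases hi : i + 1 < n
  · by_cases hj : j + 1 < n
    · apply Units.ext
      rw [Units.val_mul, Units.val_mul, val_unitAt X hi, val_unitAt Y hj]
      rcases h with h | h
      · exact commute_at₂ _ _ _ _ h
      · exact (commute_at₂ _ _ _ _ h).symm
    · rw [unitAt.eq_def n j, dif_neg hj]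
      exact Commute.one_right _
  · rw [unitAt.eq_def n i, dif_neg hi]
    exact Commute.one_left _

theorem unitAt_adjacent {n i : ℕ} (h : i + 2 < n) :
    ∃ φ : (Matrix (Fin 3 → ι) (Fin 3 → ι) ℂ)ˣ →* (Matrix (Fin n → ι) (Fin n → ι) ℂ)ˣ,
      ∀ X, φ (unitAt 3 0 X) = unitAt n i X ∧ φ (unitAt 3 1 X) = unitAt n (i + 1) X := by
  obtain ⟨φ, hφ⟩ := at₂_adjacent (ι := ι) h
  refine ⟨Units.map (MonoidHomClass.toMonoidHom φ), fun X => ⟨Units.ext ?_, Units.ext ?_⟩⟩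
  · rw [val_unitAt X (by omega), ← (hφ X.1).1, ← val_unitAt X]
    rfl
  · rw [val_unitAt X (by omega), ← (hφ X.1).2, ← val_unitAt X]
    rfl

namespace IsQMPair

variable {R F : GL (ι × ι) ℂ}

theorem braid_R (h : IsQMPair R F) {n i : ℕ} (hi : i + 2 < n) :
    unitAt n i R * unitAt n (i + 1) R * unitAt n i R =
      unitAt n (i + 1) R * (unitAt n i R * unitAt n (i + 1) R) := by
  obtain ⟨φ, hφ⟩ := unitAt_adjacent (ι := ι) hi
  rw [← (hφ R).1, ← (hφ R).2, ← mul_assoc]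
  simp only [← map_mul]
  congr 1
  apply Units.ext
  simp only [Units.val_mul, val_unitAt _ (show 0 + 1 < 3 by norm_num),
    val_unitAt _ (show 1 + 1 < 3 by norm_num)]
  exact h.ybR

theorem braid_F (h : IsQMPair R F) {n i : ℕ} (hi : i + 2 < n) :
    unitAt n i F * unitAt n (i + 1) F * unitAt n i F =
      unitAt n (i + 1) F * (unitAt n i F * unitAt n (i + 1) F) := by
  obtain ⟨φ, hφ⟩ := unitAt_adjacent (ι := ι) hi
  rw [← (hφ F).1, ← (hφ F).2, ← mul_assoc]
  simp only [← map_mul]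
  congr 1
  apply Units.ext
  simp only [Units.val_mul, val_unitAt _ (show 0 + 1 < 3 by norm_num),
    val_unitAt _ (show 1 + 1 < 3 by norm_num)]
  exact h.ybF

theorem twist_down (h : IsQMPair R F) {n i : ℕ} (hi : i + 2 < n) :
    unitAt n i R * unitAt n (i + 1) F * unitAt n i F =
      unitAt n (i + 1) F * unitAt n i F * unitAt n (i + 1) R := by
  obtain ⟨φ, hφ⟩ := unitAt_adjacent (ι := ι) hi
  rw [← (hφ F).1, ← (hφ F).2, ← (hφ R).1, ← (hφ R).2]
  simp only [← map_mul]
  congr 1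
  apply Units.ext
  simp only [Units.val_mul, val_unitAt _ (show 0 + 1 < 3 by norm_num),
    val_unitAt _ (show 1 + 1 < 3 by norm_num)]
  exact h.twist.1

theorem twist_up (h : IsQMPair R F) {n i : ℕ} (hi : i + 2 < n) :
    unitAt n (i + 1) R * unitAt n i F * unitAt n (i + 1) F =
      unitAt n i F * unitAt n (i + 1) F * unitAt n i R := by
  obtain ⟨φ, hφ⟩ := unitAt_adjacent (ι := ι) hi
  rw [← (hφ F).1, ← (hφ F).2, ← (hφ R).1, ← (hφ R).2]
  simp only [← map_mul]
  congr 1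
  apply Units.ext
  simp only [Units.val_mul, val_unitAt _ (show 0 + 1 < 3 by norm_num),
    val_unitAt _ (show 1 + 1 < 3 by norm_num)]
  exact h.twist.2

theorem twist_up_zpow (h : IsQMPair R F) {n i : ℕ} (hi : i + 2 < n) (ε : ℤ) :
    unitAt n i F * unitAt n (i + 1) F * unitAt n i (R ^ ε) =
      unitAt n (i + 1) (R ^ ε) * (unitAt n i F * unitAt n (i + 1) F) := by
  have h1 : SemiconjBy (unitAt n i F * unitAt n (i + 1) F) (unitAt n i R) (unitAt n (i + 1) R) := by
    rw [SemiconjBy, ← h.twist_up hi, mul_assoc]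
  rw [map_zpow, map_zpow]
  exact h1.zpow_right ε

/-- For `ε = -1` this is the braid relation rearranged; hence both signs give the same intertwining
rule. -/
theorem braid_zpow (h : IsQMPair R F) {n i : ℕ} (hi : i + 2 < n) (ε : ℤˣ) :
    unitAt n i (R ^ (ε : ℤ)) * unitAt n (i + 1) (R ^ (ε : ℤ)) * unitAt n i R =
      unitAt n (i + 1) R * (unitAt n i (R ^ (ε : ℤ)) * unitAt n (i + 1) (R ^ (ε : ℤ))) := by
  have h1 := h.braid_R hi
  rcases Int.units_eq_one_or ε with rfl | rfl
  · simpa using h1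
  · simp only [Units.val_neg, Units.val_one, _root_.zpow_neg, zpow_one, map_inv]
    generalize unitAt n i R = a at *
    generalize unitAt n (i + 1) R = b at *
    rw [← _root_.mul_inv_rev, inv_mul_eq_iff_eq_mul, ← mul_assoc, eq_mul_inv_iff_mul_eq]
    rw [← mul_assoc, h1, mul_assoc]

theorem upProd_zpow_mul (h : IsQMPair R F) (k : ℕ) (ε : ℤˣ) {i : ℕ} (hi : i + 1 < k) :
    upProd (fun i => unitAt (k + 1) i (R ^ (ε : ℤ))) k * unitAt (k + 1) i R =
      unitAt (k + 1) (i + 1) R * upProd (fun i => unitAt (k + 1) i (R ^ (ε : ℤ))) k :=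
  upProd_mul (f := fun i => unitAt (k + 1) i (R ^ (ε : ℤ))) (x := fun i => unitAt (k + 1) i R) k
    (fun i hi => h.braid_zpow (by omega) ε) (fun i _ j _ e => commute_unitAt _ _ e) i hi

theorem downProd_mul (h : IsQMPair R F) (k : ℕ) {i : ℕ} (hi : i + 1 < k) :
    downProd (fun i => unitAt (k + 1) i F) k * unitAt (k + 1) (i + 1) R =
      unitAt (k + 1) i R * downProd (fun i => unitAt (k + 1) i F) k := by
  have h1 := upProd_mul (f := fun i => (unitAt (k + 1) i F)⁻¹) (x := fun i => unitAt (k + 1) i R) k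
    (fun i hi => by
      rw [← _root_.mul_inv_rev, inv_mul_eq_iff_eq_mul, ← mul_assoc, eq_mul_inv_iff_mul_eq, ← mul_assoc]
      exact h.twist_down (by omega))
    (fun i _ j _ e => (commute_unitAt _ _ e).inv_left) i hi
  rw [upProd_inv, inv_mul_eq_iff_eq_mul, ← mul_assoc, eq_mul_inv_iff_mul_eq] at h1
  exact h1.symm

theorem upProd_conjSeq (h : IsQMPair R F) (k : ℕ) (ε : ℤ) :
    upProd (conjSeq (fun i => unitAt (k + 1) i (R ^ ε)) fun i => unitAt (k + 1) i F) k =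
      upProd (fun i => unitAt (k + 1) i (R ^ ε)) k * downProd (fun i => unitAt (k + 1) i F) k :=
  QMat.upProd_conjSeq (e := fun i => unitAt (k + 1) i (R ^ ε)) (f := fun i => unitAt (k + 1) i F) k
    (fun i hi => h.twist_up_zpow (by omega) ε)
    (fun i hi => h.braid_F (by omega)) (fun i _ j _ e => commute_unitAt _ _ e) k le_rfl

end IsQMPair

theorem prodDown_eq (F : GL (ι × ι) ℂ) (k : ℕ) :
    prodDown F k = (downProd (fun i => unitAt (k + 1) i F) k).1 := by
  have key : ∀ m, m ≤ k → ∀ e : ∀ i : Fin m, i.1 + 1 < k + 1,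
      ((List.ofFn fun i : Fin m => at₂ (k + 1) F.1 i.1 (e i)).reverse).prod =
        (downProd (fun i => unitAt (k + 1) i F) m).1 := by
    intro m
    induction m with
    | zero => intro _ _; simp [downProd]
    | succ m ih =>
      intro hm e
      rw [List.ofFn_succ', List.concat_eq_append, List.reverse_append, List.prod_append]
      simp only [Fin.val_castSucc, Fin.val_last, List.reverse_singleton, List.prod_singleton]
      rw [ih (by omega) fun i => by omega, downProd, Units.val_mul, val_unitAt F (by omega)]
  exact key k le_rfl _

theorem prodInvUp_eq (F : GL (ι × ι) ℂ) (k : ℕ) :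
    prodInvUp F k = ((downProd (fun i => unitAt (k + 1) i F) k)⁻¹).1 := by
  rw [← upProd_inv]
  have key : ∀ m, m ≤ k → ∀ e : ∀ i : Fin m, i.1 + 1 < k + 1,
      (List.ofFn fun i : Fin m => at₂ (k + 1) (F⁻¹).1 i.1 (e i)).prod =
        (upProd (fun i => (unitAt (k + 1) i F)⁻¹) m).1 := by
    intro m
    induction m with
    | zero => intro _ _; simp [upProd]
    | succ m ih =>
      intro hm e
      rw [List.ofFn_succ', List.concat_eq_append, List.prod_append]
      simp only [Fin.val_castSucc, Fin.val_last, List.prod_singleton]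
      rw [ih (by omega) fun i => by omega, upProd, Units.val_mul, val_unitAt_inv F (by omega)]
  exact key k le_rfl _

end Pairs

/-! ### Intertwining of antisymmetrizers -/

section Intertwining

variable {B : Type} [Ring B] [Algebra ℂ B] {q μ : ℂ}

theorem semiconjBy_kappaOf {g x y : B} (h : SemiconjBy g x y) :
    SemiconjBy g (kappaOf q μ x) (kappaOf q μ y) := by
  have h1 : SemiconjBy g (1 : B) 1 := SemiconjBy.one_right g
  have hs : ∀ (c : ℂ) {x y : B}, SemiconjBy g x y → SemiconjBy g (c • x) (c • y) :=
    fun c x y h => by rw [SemiconjBy, mul_smul_comm, smul_mul_assoc, h.eq]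
  exact hs _ (((hs _ h1).sub_right h).mul_right ((hs _ h1).add_right h))

/-- Intertwining passes from the generators to the antisymmetrizers through the recursion. -/
theorem semiconjBy_asym {g : B} {s κ s' κ' : ℕ → B} (n : ℕ)
    (hs : ∀ i, i + 1 < n → SemiconjBy g (s i) (s' i))
    (hk : ∀ i, i + 1 < n → SemiconjBy g (κ i) (κ' i)) :
    SemiconjBy g (asym q μ s κ n) (asym q μ s' κ' n) := by
  have h1 : SemiconjBy g (1 : B) 1 := SemiconjBy.one_right g
  have hsm : ∀ (c : ℂ) {x y : B}, SemiconjBy g x y → SemiconjBy g (c • x) (c • y) :=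
    fun c x y h => by rw [SemiconjBy, mul_smul_comm, smul_mul_assoc, h.eq]
  induction n with
  | zero => exact h1
  | succ n ih =>
    cases n with
    | zero => exact h1
    | succ n =>
      have ih' := ih (fun i hi => hs i (by omega)) fun i hi => hk i (by omega)
      exact hsm _ ((ih'.mul_right
        ((h1.add_right (hsm _ (hs n (by omega)))).add_right (hsm _ (hk n (by omega))))).mul_right
          ih')

variable {ι : Type} [Fintype ι] [DecidableEq ι]

theorem seqAt_kappaOf {n i : ℕ} (X : Matrix (ι × ι) (ι × ι) ℂ) (h : i + 1 < n) :
    seqAt n (kappaOf q μ X) i = kappaOf q μ (seqAt n X i) := by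
  rw [seqAt_of_lt _ h, seqAt_of_lt _ h, ← at₂Hom_apply, map_kappaOf, at₂Hom_apply]

theorem tensId_alt_mul {R : GL (ι × ι) ℂ} {k : ℕ} {g : Matrix (Fin (k + 1) → ι) (Fin (k + 1) → ι) ℂ}
    (h : ∀ i, i + 1 < k →
      g * (unitAt (k + 1) (i + 1) R).1 = (unitAt (k + 1) i R).1 * g) :
    g * idTens k (alt q μ R.1 k) = tensId k (alt q μ R.1 k) * g := by
  have h1 : ∀ i, i + 1 < k → SemiconjBy g (seqAt (k + 1) R.1 (i + 1)) (seqAt (k + 1) R.1 i) := by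
    intro i hi
    have := h i hi
    rwa [val_unitAt R (by omega), val_unitAt R (by omega), ← seqAt_of_lt, ← seqAt_of_lt] at this
  rw [idTens_alt, tensId_alt]
  refine semiconjBy_asym k h1 fun i hi => ?_
  rw [seqAt_kappaOf _ (by omega), seqAt_kappaOf _ (by omega)]
  exact semiconjBy_kappaOf (h1 i hi)

theorem idTens_alt_mul {R : GL (ι × ι) ℂ} {k : ℕ} {g : Matrix (Fin (k + 1) → ι) (Fin (k + 1) → ι) ℂ}
    (h : ∀ i, i + 1 < k →
      g * (unitAt (k + 1) i R).1 = (unitAt (k + 1) (i + 1) R).1 * g) :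
    g * tensId k (alt q μ R.1 k) = idTens k (alt q μ R.1 k) * g := by
  have h1 : ∀ i, i + 1 < k → SemiconjBy g (seqAt (k + 1) R.1 i) (seqAt (k + 1) R.1 (i + 1)) := by
    intro i hi
    have := h i hi
    rwa [val_unitAt R (by omega), val_unitAt R (by omega), ← seqAt_of_lt, ← seqAt_of_lt] at this
  rw [idTens_alt, tensId_alt]
  refine semiconjBy_asym k h1 fun i hi => ?_
  rw [seqAt_kappaOf _ (by omega), seqAt_kappaOf _ (by omega)]
  exact semiconjBy_kappaOf (h1 i hi)

end Intertwining

end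

end QMat

namespace QMat

open Matrix

noncomputable section

section Representations

variable {ι : Type} [Fintype ι] [DecidableEq ι]

/-! ### Matrices over `End V` as operators -/

/-- A matrix over `End V` on `V^{⊗ n}` is an operator on `V ⊗ V^{⊗ n}`. -/
def foldEnd (n : ℕ) : Matrix (Fin n → ι) (Fin n → ι) (Matrix ι ι ℂ) →+*
    Matrix (Fin (n + 1) → ι) (Fin (n + 1) → ι) ℂ where
  toFun X := Matrix.of fun x y => X (Fin.tail x) (Fin.tail y) (x 0) (y 0)
  map_one' := by
    apply ext_cons
    intro a z b w
    by_cases h : z = w <;> simp [Matrix.one_apply, h]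
  map_mul' X Y := by
    apply ext_cons
    intro a z b w
    simp only [Matrix.of_apply, Fin.tail_cons, Fin.cons_zero, Matrix.mul_apply, sum_cons,
      Matrix.sum_apply]
    exact Finset.sum_comm
  map_zero' := rfl
  map_add' X Y := rfl

theorem foldEnd_apply {n : ℕ} (X : Matrix (Fin n → ι) (Fin n → ι) (Matrix ι ι ℂ)) (a b : ι)
    (z w : Fin n → ι) : foldEnd n X (Fin.cons a z) (Fin.cons b w) = X z w a b := rfl

theorem foldEnd_injective (n : ℕ) : Function.Injective (foldEnd (ι := ι) n) := by
  intro X Y h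
  ext z w a b
  exact congrFun₂ h (Fin.cons a z) (Fin.cons b w)

theorem foldEnd_num {n : ℕ} (X : Matrix (Fin n → ι) (Fin n → ι) ℂ) :
    foldEnd n (num (Matrix ι ι ℂ) X) = idTens n X := by
  apply ext_cons
  intro a z b w
  rw [foldEnd_apply, idTens_apply, num, Matrix.map_apply, Matrix.algebraMap_matrix_apply]
  rfl

/-- The matrix over `End V` of an operator on `V ⊗ V`. -/
def splitEnd (L : Matrix (ι × ι) (ι × ι) ℂ) : Matrix ι ι (Matrix ι ι ℂ) :=
  Matrix.of fun a b => Matrix.of fun c d => L (c, a) (d, b)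

theorem foldEnd_at₁ {n : ℕ} (L : Matrix (ι × ι) (ι × ι) ℂ) (h : 0 < n) :
    foldEnd n (at₁ n (splitEnd L) ⟨0, h⟩) = at₂ (n + 1) L 0 (by omega) := by
  obtain ⟨n, rfl⟩ : ∃ m, n = m + 1 := ⟨n - 1, by omega⟩
  apply ext_cons₂
  intro a b z a' b' w
  rw [foldEnd_apply, at₂_zero_apply]
  have : (⟨0, h⟩ : Fin (n + 1)) = 0 := rfl
  rw [this, at₁_zero_apply]
  by_cases h : z = w <;> simp [h, splitEnd]

/-- Folding puts the representation space in front and moves `F_i` to `F_{i+1}`, so the recursion of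
the copies becomes that of `conjSeq`. -/
theorem foldEnd_copy (L F : GL (ι × ι) ℂ) {k i : ℕ} (hi : i < k) {e : ℕ → _}
    (he : (e 0 * unitAt (k + 1) 0 F).1 = at₂ (k + 1) L.1 0 (by omega)) :
    foldEnd k (copy F k (splitEnd L.1) i hi) = (conjSeq e (fun i => unitAt (k + 1) i F) i).1 := by
  induction i with
  | zero => rw [copy, foldEnd_at₁ _ hi, conjSeq, he]
  | succ i ih =>
    rw [copy, conjSeq, map_mul, map_mul, foldEnd_num, foldEnd_num, ih _ he, Units.val_mul,
      Units.val_mul, val_unitAt F (by omega), val_unitAt_inv F (by omega), at₂_succ, at₂_succ]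

theorem foldEnd_copyProd (L F : GL (ι × ι) ℂ) {k : ℕ} {e : ℕ → _} (hk : 0 < k)
    (he : (e 0 * unitAt (k + 1) 0 F).1 = at₂ (k + 1) L.1 0 (by omega)) :
    foldEnd k (copyProd F k (splitEnd L.1)) =
      (upProd (conjSeq e fun i => unitAt (k + 1) i F) k).1 := by
  have key : ∀ m, (hm : m ≤ k) →
      foldEnd k (List.ofFn fun i : Fin m => copy F k (splitEnd L.1) i.1 (by omega)).prod =
        (upProd (conjSeq e fun i => unitAt (k + 1) i F) m).1 := by
    intro m
    induction m with
    | zero => intro _; simp [upProd]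
    | succ m ih =>
      intro hm
      rw [List.ofFn_succ', List.concat_eq_append, List.prod_append]
      simp only [Fin.val_castSucc, Fin.val_last, List.prod_singleton]
      rw [map_mul, ih (by omega), upProd, Units.val_mul, foldEnd_copy L F _ he]
  exact key k le_rfl

theorem IsQMPair.foldEnd_copyProd {R F : GL (ι × ι) ℂ} (h : IsQMPair R F) {k : ℕ} (hk : 0 < k)
    (ε : ℤ) : foldEnd k (copyProd F k (splitEnd (R ^ ε * F).1)) =
      (upProd (fun i => unitAt (k + 1) i (R ^ ε)) k * downProd (fun i => unitAt (k + 1) i F) k).1 := by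
  rw [← h.upProd_conjSeq k ε]
  refine QMat.foldEnd_copyProd _ F hk ?_
  rw [← map_mul, val_unitAt]

/-! ### Naturality -/

section Naturality

variable {A B : Type} [Ring A] [Algebra ℂ A] [Ring B] [Algebra ℂ B] (α : A →ₐ[ℂ] B)

theorem num_map {κ : Type} (X : Matrix κ κ ℂ) : (num A X).map α = num B X := by
  ext a b
  simp [num]

theorem copy_map (F : GL (ι × ι) ℂ) (n : ℕ) (M : Matrix ι ι A) (i : ℕ) (hi : i < n) :
    (copy F n M i hi).map α = copy F n (M.map α) i hi := by
  induction i with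
  | zero =>
    ext x y
    simp only [copy, at₁, Matrix.map_apply, Matrix.of_apply]
    split_ifs <;> simp
  | succ i ih => rw [copy, copy, Matrix.map_mul, Matrix.map_mul, ih, num_map, num_map]

theorem copyProd_map (F : GL (ι × ι) ℂ) (n : ℕ) (M : Matrix ι ι A) :
    (copyProd F n M).map α = copyProd F n (M.map α) := by
  have h := map_list_prod (α.mapMatrix (m := Fin n → ι))
    (List.ofFn fun i : Fin n => copy F n M i.1 i.2)
  rw [AlgHom.mapMatrix_apply, List.map_ofFn] at h
  rw [copyProd, h, copyProd]
  congr 2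
  ext1 i
  exact copy_map α F n M _ _

theorem ch_map {q μ : ℂ} {R : GL (ι × ι) ℂ} (F : GL (ι × ι) ℂ) (hb : IsBMWType q μ R)
    (hs : SkewInvertible R) (n : ℕ) (x : BMW q μ n) (α : QMA R F →ₐ[ℂ] Matrix ι ι ℂ) :
    α (ch F hb hs n x) = traceTail n (idTens n (tensorPow n hs.matD) *
      foldEnd n (copyProd F n ((qM R F).map α)) * idTens n (hb.ρ n x)) := by
  have h1 : α (ch F hb hs n x) = Matrix.trace ((num (QMA R F) (tensorPow n hs.matD) *
      (copyProd F n (qM R F) * num (QMA R F) (hb.ρ n x))).map α) :=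
    AddMonoidHom.map_trace α _
  rw [h1, Matrix.map_mul, Matrix.map_mul, num_map, num_map, copyProd_map, ← foldEnd_num,
    ← foldEnd_num, ← map_mul, ← map_mul, ← mul_assoc]
  ext a b
  simp only [traceTail, Matrix.of_apply, foldEnd_apply, Matrix.trace, Matrix.diag, Matrix.sum_apply]

end Naturality

/-! ### The representations -/

variable {R F : GL (ι × ι) ℂ}

theorem isAlpha_iff {ε : ℤˣ} {α : QMA R F →ₐ[ℂ] Matrix ι ι ℂ} :
    IsAlpha ε α ↔ (qM R F).map α = splitEnd (R ^ (ε : ℤ) * F).1 := by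
  simp [IsAlpha, ← Matrix.ext_iff, splitEnd]

/-- After folding, the product of the two copies is `R_1^ε R_2^ε F_2 F_1`. Moving `R_2` through it
lowers the index to `1` in the `F` part and restores it in the `R` part. -/
theorem IsQMPair.commute_copyProd (h : IsQMPair R F) (ε : ℤˣ) :
    num (Matrix ι ι ℂ) (at₂ 2 R.1 0 (by norm_num)) *
        copyProd F 2 (splitEnd (R ^ (ε : ℤ) * F).1) =
      copyProd F 2 (splitEnd (R ^ (ε : ℤ) * F).1) *
        num (Matrix ι ι ℂ) (at₂ 2 R.1 0 (by norm_num)) := by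
  apply foldEnd_injective
  have h1 := h.upProd_zpow_mul 2 ε (i := 0) (by norm_num)
  have h2 := h.downProd_mul 2 (i := 0) (by norm_num)
  rw [map_mul, map_mul, h.foldEnd_copyProd (by norm_num), foldEnd_num, ← at₂_succ R.1 (by norm_num),
    ← val_unitAt R (by norm_num), ← Units.val_mul, ← Units.val_mul, mul_assoc, h2, ← mul_assoc,
    ← mul_assoc, h1]

theorem IsQMPair.existsUnique_isAlpha (h : IsQMPair R F) (ε : ℤˣ) :
    ∃! α : QMA R F →ₐ[ℂ] Matrix ι ι ℂ, IsAlpha ε α := by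
  have hφ : (freeM (ι := ι)).map (FreeAlgebra.lift ℂ fun p : ι × ι =>
      splitEnd (R ^ (ε : ℤ) * F).1 p.1 p.2) = splitEnd (R ^ (ε : ℤ) * F).1 := by
    ext a b
    simp [freeM]
  have hrel : ∀ ⦃x y : FreeAlgebra ℂ (ι × ι)⦄, QMARel R F x y →
      FreeAlgebra.lift ℂ (fun p : ι × ι => splitEnd (R ^ (ε : ℤ) * F).1 p.1 p.2) x =
        FreeAlgebra.lift ℂ (fun p : ι × ι => splitEnd (R ^ (ε : ℤ) * F).1 p.1 p.2) y := by
    rintro _ _ ⟨x, y⟩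
    rw [← Matrix.map_apply (f := FreeAlgebra.lift ℂ _), ← Matrix.map_apply
      (f := FreeAlgebra.lift ℂ _), Matrix.map_mul, Matrix.map_mul, num_map, copyProd_map, hφ,
      h.commute_copyProd ε]
  refine ⟨RingQuot.liftAlgHom ℂ ⟨_, hrel⟩, ?_, fun β hβ => ?_⟩
  · intro a b c d
    simp [qM, freeM, splitEnd]
  · apply RingQuot.ringQuot_ext'
    apply FreeAlgebra.hom_ext
    ext1 ⟨a, b⟩
    ext c d
    have := hβ a b c d
    simpa [qM, freeM, splitEnd] using this

end Representations

end

end QMat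

namespace QMat

open Matrix

noncomputable section

section QuantumDeterminant

variable {ι : Type} [Fintype ι] [DecidableEq ι] {k : ℕ} {q μ : ℂ} {R F : GL (ι × ι) ℂ}
  {u v : (Fin k → ι) → ℂ}

/-! ### Intertwiners of rank one antisymmetrizers -/

/-- An intertwiner carries the range of `1 ⊗ A` into that of `A ⊗ 1`; both are copies of `V`, so it
acts through an operator on `V`. -/
theorem mul_colR_of_idTens {g : Matrix (Fin (k + 1) → ι) (Fin (k + 1) → ι) ℂ} (hvu : v ⬝ᵥ u = 1)
    (h : g * idTens k (vecMulVec u v) = tensId k (vecMulVec u v) * g) :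
    g * colR u = colL u * ((colL v)ᵀ * g * colR u) := by
  rw [idTens_vecMulVec, tensId_vecMulVec] at h
  have h1 := congrArg (· * colR u) h
  simp only [Matrix.mul_assoc, colR_transpose_mul_colR, hvu, one_smul, Matrix.mul_one] at h1
  rw [h1, Matrix.mul_assoc]

theorem mul_colL_of_tensId {g : Matrix (Fin (k + 1) → ι) (Fin (k + 1) → ι) ℂ} (hvu : v ⬝ᵥ u = 1)
    (h : g * tensId k (vecMulVec u v) = idTens k (vecMulVec u v) * g) :
    g * colL u = colR u * ((colR v)ᵀ * g * colL u) := by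
  rw [idTens_vecMulVec, tensId_vecMulVec] at h
  have h1 := congrArg (· * colL u) h
  simp only [Matrix.mul_assoc, colL_transpose_mul_colL, hvu, one_smul, Matrix.mul_one] at h1
  rw [h1, Matrix.mul_assoc]

theorem transpose_mul_of_tensId {g : Matrix (Fin (k + 1) → ι) (Fin (k + 1) → ι) ℂ}
    (hvu : v ⬝ᵥ u = 1) (h : g * tensId k (vecMulVec u v) = idTens k (vecMulVec u v) * g) :
    (colR v)ᵀ * g = (colR v)ᵀ * g * colL u * (colL v)ᵀ := by
  rw [idTens_vecMulVec, tensId_vecMulVec] at h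
  have h1 := congrArg ((colR v)ᵀ * ·) h
  simp only [← Matrix.mul_assoc, colR_transpose_mul_colR, hvu, one_smul, Matrix.one_mul] at h1
  exact h1.symm

theorem IsQMPair.downProd_mul_idTens_alt (h : IsQMPair R F) :
    (downProd (fun i => unitAt (k + 1) i F) k).1 * idTens k (alt q μ R.1 k) =
      tensId k (alt q μ R.1 k) * (downProd (fun i => unitAt (k + 1) i F) k).1 :=
  tensId_alt_mul fun i hi => by rw [← Units.val_mul, h.downProd_mul k hi, Units.val_mul]

theorem IsQMPair.downProd_inv_mul_tensId_alt (h : IsQMPair R F) :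
    ((downProd (fun i => unitAt (k + 1) i F) k)⁻¹).1 * tensId k (alt q μ R.1 k) =
      idTens k (alt q μ R.1 k) * ((downProd (fun i => unitAt (k + 1) i F) k)⁻¹).1 := by
  rw [Units.inv_mul_eq_iff_eq_mul, ← mul_assoc, Units.eq_mul_inv_iff_mul_eq]
  exact h.downProd_mul_idTens_alt.symm

theorem IsQMPair.upProd_mul_tensId_alt (h : IsQMPair R F) (ε : ℤˣ) :
    (upProd (fun i => unitAt (k + 1) i (R ^ (ε : ℤ))) k).1 * tensId k (alt q μ R.1 k) =
      idTens k (alt q μ R.1 k) * (upProd (fun i => unitAt (k + 1) i (R ^ (ε : ℤ))) k).1 :=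
  idTens_alt_mul fun i hi => by rw [← Units.val_mul, h.upProd_zpow_mul k ε hi, Units.val_mul]

/-! ### The operator `O` -/

theorem normO_ne_zero (h : IsHeight k q μ R) (hμ : μ = q / q ^ k) : normO k q ≠ 0 := by
  have hq := h.bmw.q_ne_zero
  have h2 := h.two_le
  have hQ : q ^ k ≠ 0 := pow_ne_zero _ hq
  have hQ1 : q ^ k + 1 ≠ 0 := fun h0 => h.q_pow_ne k (by omega) le_rfl
    (by rw [mul_comm, pow_mul]; linear_combination (q ^ k - 1) * h0)
  have hQq : 1 + q ^ 2 / q ^ k ≠ 0 := by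
    intro h0
    apply h.regular.mu_ne 1 le_rfl (by omega)
    rw [hμ]
    field_simp at h0 ⊢
    linear_combination q * h0
  rw [normO_eq hq]
  refine div_ne_zero (mul_ne_zero (h.regular.qNum_ne _ (by omega) le_rfl) hQq) fun h0 => ?_
  field_simp at h0
  exact hQ1 ((mul_eq_zero.1 (h0.trans (mul_zero _))).resolve_left hq)

theorem rhoUp_eq (hR : IsOrthogonalType k q R)
    (huv : alt q (q ^ (1 - (k : ℤ))) R.1 k = vecMulVec u v) :
    rhoUp hR = colR u * (colR v)ᵀ := by
  rw [rhoUp, hR.height.bmw.rho_antisymUp, huv, idTens_vecMulVec]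

theorem opOInv_eq (hRF : IsQMPair R F) (hR : IsOrthogonalType k q R)
    (huv : alt q (q ^ (1 - (k : ℤ))) R.1 k = vecMulVec u v) (hvu : v ⬝ᵥ u = 1) :
    opOInv F hR = normO k q • ((colR v)ᵀ * colL u *
      ((colL v)ᵀ * (downProd (fun i => unitAt (k + 1) i F) k).1 * colR u)) := by
  have h1 := hRF.downProd_mul_idTens_alt (k := k) (q := q) (μ := q ^ (1 - (k : ℤ)))
  rw [huv] at h1
  rw [opOInv, prodDown_eq, rhoUp_eq hR huv, ← Matrix.mul_assoc, traceTail_mul_colR_transpose,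
    mul_colR_of_idTens hvu h1]
  simp only [Matrix.mul_assoc]

theorem opO_eq (hRF : IsQMPair R F) (hR : IsOrthogonalType k q R)
    (huv : alt q (q ^ (1 - (k : ℤ))) R.1 k = vecMulVec u v) (hvu : v ⬝ᵥ u = 1) :
    opO F hR = normO k q • ((colR v)ᵀ * ((downProd (fun i => unitAt (k + 1) i F) k)⁻¹).1 *
      colL u * ((colL v)ᵀ * colR u)) := by
  have h1 := hRF.downProd_inv_mul_tensId_alt (k := k) (q := q) (μ := q ^ (1 - (k : ℤ)))
  rw [huv] at h1
  rw [opO, prodInvUp_eq, rhoUp_eq hR huv, Matrix.mul_assoc, traceTail_colR_mul]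
  conv_lhs => rw [transpose_mul_of_tensId hvu h1, Matrix.mul_assoc]

theorem opO_mul_opOInv (hRF : IsQMPair R F) (hR : IsOrthogonalType k q R) :
    opO F hR * opOInv F hR = 1 := by
  obtain ⟨u, v, huv, hvu⟩ := hR.exists_vectors
  have hq := hR.height.bmw.q_ne_zero
  have hc := normO_ne_zero hR.height (zpow_one_sub hq k)
  have h1 := hRF.downProd_inv_mul_tensId_alt (k := k) (q := q) (μ := q ^ (1 - (k : ℤ)))
  have hTS := (hR.height.scalars (zpow_one_sub hq k) huv hvu).1
  rw [huv] at h1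
  -- The compressions of `G⁻¹` and `G` to the two copies of `V` are inverse to each other.
  have hN : (colR v)ᵀ * ((downProd (fun i => unitAt (k + 1) i F) k)⁻¹).1 * colL u *
      ((colL v)ᵀ * (downProd (fun i => unitAt (k + 1) i F) k).1 * colR u) = 1 := by
    rw [← Matrix.mul_assoc, ← Matrix.mul_assoc, ← transpose_mul_of_tensId hvu h1,
      Matrix.mul_assoc ((colR v)ᵀ), Units.inv_mul, Matrix.mul_one, colR_transpose_mul_colR, hvu,
      one_smul]
  -- The factors occur in `O O⁻¹` in the order opposite to that in `scalars`.
  have hST := mul_eq_one_comm.1 (show (normO k q • ((colR v)ᵀ * colL u)) *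
      (normO k q • ((colL v)ᵀ * colR u)) = 1 by
    rw [smul_mul_smul_comm, hTS, smul_smul, ← pow_two, mul_inv_cancel₀ (pow_ne_zero 2 hc),
      one_smul])
  rw [opO_eq hRF hR huv hvu, opOInv_eq hRF hR huv hvu]
  rw [smul_mul_smul_comm] at hST ⊢
  generalize (colR v)ᵀ * ((downProd (fun i => unitAt (k + 1) i F) k)⁻¹).1 * colL u = N' at *
  generalize (colL v)ᵀ * (downProd (fun i => unitAt (k + 1) i F) k).1 * colR u = N at *
  calc _ = N' * ((normO k q * normO k q) • ((colL v)ᵀ * colR u * ((colR v)ᵀ * colL u))) * N := by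
        simp only [mul_smul_comm, smul_mul_assoc, Matrix.mul_assoc]
    _ = 1 := by rw [hST, mul_one, hN]

/-! ### The quantum determinant -/

theorem upProd_mul_eigen {n : ℕ} {ι' : Type} {e : ℕ → (Matrix (Fin n → ι) (Fin n → ι) ℂ)ˣ}
    {U : Matrix (Fin n → ι) ι' ℂ} {c : ℂ} (m : ℕ)
    (h : ∀ i < m, (e (i + 1)).1 * U = c • U) :
    (upProd e (m + 1)).1 * U = c ^ m • ((e 0).1 * U) := by
  induction m with
  | zero => simp [upProd]
  | succ m ih =>
    rw [upProd, Units.val_mul, Matrix.mul_assoc, h m (by omega), Matrix.mul_smul,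
      ih fun i hi => h i (by omega), smul_smul, pow_succ']

theorem IsBMWType.unitAt_mul_colR (hb : IsBMWType q μ R) (hr : Regular q μ k)
    (huv : alt q μ R.1 k = vecMulVec u v) (hvu : v ⬝ᵥ u = 1) {i : ℕ} (hi : i + 1 < k) :
    (unitAt (k + 1) (i + 1) R).1 * colR u = (-q⁻¹) • colR u := by
  have h1 := ((hb.family (k + 1)).shift (n := k - 1) 1 (by omega)).s_mul_asym (n := k) (by omega)
    hr hi
  rw [← idTens_alt, huv, idTens_vecMulVec, seqAt_of_lt _ (by omega)] at h1
  have h2 := congrArg (· * colR u) h1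
  simp only [Matrix.mul_assoc, Matrix.smul_mul, colR_transpose_mul_colR, hvu, one_smul,
    Matrix.mul_one] at h2
  rw [val_unitAt R (by omega), h2]

theorem IsBMWType.unitAt_inv_mul_colR (hb : IsBMWType q μ R) (hr : Regular q μ k)
    (huv : alt q μ R.1 k = vecMulVec u v) (hvu : v ⬝ᵥ u = 1) {i : ℕ} (hi : i + 1 < k) :
    (unitAt (k + 1) (i + 1) R⁻¹).1 * colR u = (-q) • colR u := by
  have h1 := congrArg ((unitAt (k + 1) (i + 1) R)⁻¹.1 * ·) (hb.unitAt_mul_colR hr huv hvu hi)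
  simp only [← Matrix.mul_assoc, Units.inv_mul, Matrix.one_mul, Matrix.mul_smul] at h1
  rw [map_inv, ← smul_inv_smul₀ (inv_ne_zero (neg_ne_zero.2 hb.q_ne_zero)) (_ * colR u)]
  rw [inv_inv, inv_neg, smul_comm, ← h1]

/-- The factors `R_2^ε, …, R_k^ε` act on `colR u` by a number, and the remaining `R_1^ε` is
compressed to a scalar by `scalars`. -/
theorem transpose_mul_upProd_mul (h : IsHeight k q μ R) (hμ : μ = q / q ^ k)
    (huv : alt q μ R.1 k = vecMulVec u v) (hvu : v ⬝ᵥ u = 1) (ε : ℤˣ) :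
    (colR v)ᵀ * (upProd (fun i => unitAt (k + 1) i (R ^ (ε : ℤ))) k).1 * colR u =
      ((-1) ^ (k - 1) * (normO k q)⁻¹) • (1 : Matrix ι ι ℂ) := by
  have h2 := h.two_le
  have hq := h.bmw.q_ne_zero
  have hk : k = k - 1 + 1 := by omega
  have hqk : q ^ k = q ^ (k - 1) * q := by rw [← pow_succ, ← hk]
  have hqp : q ^ (k - 1) ≠ 0 := pow_ne_zero _ hq
  have key : ∀ (X : GL (ι × ι) ℂ) (c ρ : ℂ),
      (∀ i, i + 1 < k → (unitAt (k + 1) (i + 1) X).1 * colR u = c • colR u) →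
      (colR v)ᵀ * seqAt (k + 1) X.1 0 * colR u = ρ • (1 : Matrix ι ι ℂ) →
      (colR v)ᵀ * (upProd (fun i => unitAt (k + 1) i X) k).1 * colR u =
        (c ^ (k - 1) * ρ) • (1 : Matrix ι ι ℂ) := by
    intro X c ρ hX hρ
    have h3 := upProd_mul_eigen (e := fun i => unitAt (k + 1) i X) (U := colR u) (c := c) (k - 1)
      fun i hi => hX i (by omega)
    rw [← hk, val_unitAt X (by omega), ← seqAt_of_lt] at h3
    rw [Matrix.mul_assoc, h3, Matrix.mul_smul, ← Matrix.mul_assoc, hρ, smul_smul]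
  obtain ⟨-, hs, hs'⟩ := h.scalars hμ huv hvu
  rw [normO_eq hq]
  rcases Int.units_eq_one_or ε with rfl | rfl
  · rw [Units.val_one, zpow_one, key R _ _ (fun i hi => h.bmw.unitAt_mul_colR h.regular huv hvu hi)
      hs, neg_pow, inv_pow, hqk, inv_div]
    congr 1
    field_simp
  -- The eigenvalue `-q` replaces `-q⁻¹`; the resulting factor `q^{2(k-1)}` is compensated by the
  -- `q^{2-2k}` in the scalar of `R_1⁻¹`. Hence the image of the determinant does not depend on the
  -- sign.
  · rw [Units.val_neg, Units.val_one, _root_.zpow_neg, zpow_one,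
      key R⁻¹ _ _ (fun i hi => h.bmw.unitAt_inv_mul_colR h.regular huv hvu hi) hs', neg_pow, hqk,
      inv_div]
    congr 1
    field_simp

theorem trace_tensorPow_mul_alt (hR : IsOrthogonalType k q R) :
    (tensorPow k hR.height.skew.matD * alt q (q ^ (1 - (k : ℤ))) R.1 k).trace =
      q ^ ((k : ℤ) * (1 - (k : ℤ))) := by
  have h := hR.height
  have h2 := h.two_le
  have hq := h.bmw.q_ne_zero
  have hμ := zpow_one_sub hq k
  have hQ : q ^ k ≠ 0 := pow_ne_zero _ hq
  have hQ1 : q ^ k + 1 ≠ 0 := fun h0 => h.q_pow_ne k (by omega) le_rfl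
    (by rw [mul_comm, pow_mul]; linear_combination (q ^ k - 1) * h0)
  have hμq : q ^ (1 - (k : ℤ)) + q ≠ 0 := by
    rw [hμ]
    intro h0
    field_simp at h0
    refine hQ1 ((mul_eq_zero.1 (?_ : q * (q ^ k + 1) = 0)).resolve_left hq)
    linear_combination h0
  rw [h.bmw.trace_alt_top h.skew.lastTrace_eq_one (by omega) hμ hμq h.regular, mul_comm (k : ℤ),
    _root_.zpow_mul, hμ, zpow_natCast, mul_comm 2 k, pow_mul q k 2]
  have e : q ^ 2 / q ^ k = q / q ^ k * q := by ring
  have e' : (q / q ^ k + q * ((q ^ k) ^ 2)⁻¹) / (q / q ^ k + q) = (q ^ k)⁻¹ := by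
    rw [hμ] at hμq
    rw [div_eq_iff hμq]
    field_simp
    ring
  rw [e, e', mul_pow, mul_assoc, mul_inv_cancel₀ hQ, mul_one]

theorem IsAlpha.map_qDet {ε : ℤˣ} {α : QMA R F →ₐ[ℂ] Matrix ι ι ℂ} (hα : IsAlpha ε α)
    (hRF : IsQMPair R F) (hR : IsOrthogonalType k q R) :
    α (qDet F hR) =
      ((-1 : ℂ) ^ (k - 1) * q ^ ((k : ℤ) * (1 - (k : ℤ)))) • opOInv F hR := by
  obtain ⟨u, v, huv, hvu⟩ := hR.exists_vectors
  have h2 := hR.height.two_le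
  have hμ := zpow_one_sub hR.height.bmw.q_ne_zero k
  have hc := normO_ne_zero hR.height hμ
  have hδ := trace_tensorPow_mul_alt hR
  have hTS := (hR.height.scalars hμ huv hvu).1
  have hWEU := transpose_mul_upProd_mul hR.height hμ huv hvu ε
  have hG := hRF.downProd_mul_idTens_alt (k := k) (q := q) (μ := q ^ (1 - (k : ℤ)))
  have hE := hRF.upProd_mul_tensId_alt (k := k) (q := q) (μ := q ^ (1 - (k : ℤ))) ε
  rw [huv] at hG hE hδ
  rw [qDet, ch_map, isAlpha_iff.1 hα, hRF.foldEnd_copyProd (by omega), hR.height.bmw.rho_antisym,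
    huv, idTens_vecMulVec, opOInv_eq hRF hR huv hvu, Units.val_mul, ← Matrix.mul_assoc,
    traceTail_mul_colR_transpose]
  have hG' := mul_colR_of_idTens hvu hG
  have hE' := mul_colL_of_tensId hvu hE
  rw [transpose_mul_of_tensId hvu hE, Matrix.mul_assoc] at hWEU
  generalize (upProd (fun i => unitAt (k + 1) i (R ^ (ε : ℤ))) k).1 = E at *
  generalize (downProd (fun i => unitAt (k + 1) i F) k).1 = G at *
  -- In `hWEU` the unknown is multiplied by `(colL v)ᵀ * colR u`, whose inverse is `normO² • (colR
  -- v)ᵀ * colL u`.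
  have hM : (colR v)ᵀ * E * colL u =
      ((-1) ^ (k - 1) * normO k q) • ((colR v)ᵀ * colL u) := by
    have h3 := congrArg (· * ((normO k q) ^ 2 • ((colR v)ᵀ * colL u))) hWEU
    have h4 := mul_eq_one_comm.1 (show (normO k q ^ 2 • ((colR v)ᵀ * colL u)) *
        ((colL v)ᵀ * colR u) = 1 by
      rw [smul_mul_assoc, hTS, smul_smul, mul_inv_cancel₀ (pow_ne_zero 2 hc), one_smul])
    simp only [Matrix.mul_assoc ((colR v)ᵀ * E * colL u)] at h3
    rw [h4, Matrix.mul_one, smul_mul_assoc, one_mul, smul_smul] at h3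
    rw [h3]
    congr 1
    field_simp
  -- The weight acts only on the factors carrying `u`, so its compression is the number `v · D^{⊗k}
  -- u`, the quantum trace of the antisymmetrizer.
  have hD : (colR v)ᵀ * (idTens k (tensorPow k hR.height.skew.matD) * colR u) =
      q ^ ((k : ℤ) * (1 - (k : ℤ))) • (1 : Matrix ι ι ℂ) := by
    rw [idTens_mul_colR, colR_transpose_mul_colR, ← hδ, mul_vecMulVec, trace_vecMulVec,
      dotProduct_comm]
  generalize idTens k (tensorPow k hR.height.skew.matD) = D at *
  generalize (colL v)ᵀ * G * colR u = N at *
  calc (colR v)ᵀ * (D * (E * G) * colR u) = (colR v)ᵀ * (D * (E * (G * colR u))) := by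
        simp only [Matrix.mul_assoc]
    _ = (colR v)ᵀ * (D * colR u) * ((colR v)ᵀ * E * colL u) * N := by
        rw [hG', ← Matrix.mul_assoc E, hE']
        simp only [Matrix.mul_assoc]
    _ = _ := by
        rw [hD, hM]
        simp only [smul_mul_assoc, mul_smul_comm, one_mul, smul_smul]
        congr 1
        ring

end QuantumDeterminant

end

end QMat

theorem mainTheorem5 {ι : Type} [Fintype ι] [DecidableEq ι] (k : ℕ) (q : ℂ)
    (R F : Matrix.GeneralLinearGroup (ι × ι) ℂ) (hRF : QMat.IsQMPair R F)
    (hR : QMat.IsOrthogonalType k q R) :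
    QMat.opO F hR * QMat.opOInv F hR = 1 ∧ QMat.opOInv F hR * QMat.opO F hR = 1 ∧
      ∀ ε : ℤˣ,
        (∃! α : QMat.QMA R F →ₐ[ℂ] Matrix ι ι ℂ, QMat.IsAlpha ε α) ∧
        ∀ α : QMat.QMA R F →ₐ[ℂ] Matrix ι ι ℂ, QMat.IsAlpha ε α →
          α (QMat.qDet F hR) =
            ((-1 : ℂ) ^ (k - 1) * q ^ ((k : ℤ) * (1 - (k : ℤ)))) • QMat.opOInv F hR :=
  ⟨QMat.opO_mul_opOInv hRF hR, mul_eq_one_comm.1 (QMat.opO_mul_opOInv hRF hR), fun ε =>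
    ⟨hRF.existsUnique_isAlpha ε, fun _ hα => hα.map_qDet hRF hR⟩⟩
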